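/- Let $k$ be a field of characteristic $p>0$, $R=k[x_1,x_2]$ with the standard grading, and let $G\subset SL_2(k)$ be a finite group of one of the types below, with $p\nmid |G|$; that is, $G=PHP^{-1}$ for some $P\in GL_2(k)$, where $H$ is the following standard group (the roots of unity involved are assumed to lie in $k$; $f$ is invariant if $f(gx)=f(x)$ for all $g$ in the group): * $A_n$ ($n\ge 2$), $|G|=n$: $H=\langle \mathrm{diag}(\varepsilon,\varepsilon^{-1})\rangle$, $\varepsilon$ a primitive $n$-th root of $1$; * $D_n$ ($n\ge 2$), $|G|=4n$: $H=\langle \mathrm{diag}(\varepsilon,\varepsilon^{-1}),\begin{pmatrix}0&i\\ i&0\end{pmatrix}\rangle$, $\varepsilon$ a primitive $2n$-th root of $1$, $i^2=-1$; * $E_6$, $|G|=24$ (binary tetrahedral): $H=\langle \mathrm{diag}(i,-i),\begin{pmatrix}0&i\\ i&0\end{pmatrix},\tfrac12\begin{pmatrix}1-i&1-i\\ -1-i&1+i\end{pmatrix}\rangle$, $i^2=-1$; * $E_7$, $|G|=48$ (binary octahedral): $H$ is generated by the previous group with $i=\zeta^2$ and $\mathrm{diag}(\zeta,\zeta^{-1})$,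 $\zeta$ a primitive $8$-th root of $1$; * $E_8$, $|G|=120$ (binary icosahedral): $H=\langle \mathrm{diag}(-\varepsilon^3,-\varepsilon^2),\ \tfrac1s\begin{pmatrix}\varepsilon^4-\varepsilon&\varepsilon^2-\varepsilon^3\\ \varepsilon^2-\varepsilon^3&\varepsilon-\varepsilon^4\end{pmatrix}\rangle$, $\varepsilon$ a primitive $5$-th root of $1$, $s=\varepsilon+\varepsilon^4-\varepsilon^2-\varepsilon^3$. Let $S=R^G$ and let $I=\bigoplus_{m>0}S_m$ be its graded maximal ideal. Put $t=x_1^5x_2-x_1x_2^5$, $W=x_1^8+14x_1^4x_2^4+x_2^8$, $\chi=x_1^{12}-33x_1^8x_2^4-33x_1^4x_2^8+x_2^{12}$. Let $h_1,h_2,h_3$ be obtained by the substitution $x\mapsto P^{-1}x$ from the following polynomials, let $d_i=\deg h_i$, and let $l$ and the relation $F\in k[X_1,X_2,X_3]$ be as follows: * $A_n$: $x_1x_2,\ x_1^n,\ x_2^n$; $l=n+1$; $F=X_1^n-X_2X_3$; * $D_n$: $-2x_1^2x_2^2,\ x_1^{2n}+(-1)^nx_2^{2n},\ x_1x_2(x_1^{2n}-(-1)^nx_2^{2n})$;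 $l=2n+3$; $F=2^{n+1}X_3^2+2^nX_1X_2^2-4X_1^{n+1}$; * $E_6$: $t,\ W,\ \chi$; $l=13$; $F=108X_1^4-X_2^3+X_3^2$; * $E_7$: $W,\ t^2,\ t\chi$; $l=19$; $F=X_3^2-X_1^3X_2+108X_2^3$; * $E_8$: $x_1x_2(x_1^{10}+11x_1^5x_2^5-x_2^{10})$, $\ x_1^{30}+x_2^{30}+522(x_1^{25}x_2^5-x_1^5x_2^{25})-10005(x_1^{20}x_2^{10}+x_1^{10}x_2^{20})$, $\ -x_1^{20}-x_2^{20}+228(x_1^{15}x_2^5-x_1^5x_2^{15})-494x_1^{10}x_2^{10}$; $l=31$; $F=X_2^2+X_3^3-1728X_1^5$. Then $|G|$ is as listed, $S=k[h_1,h_2,h_3]$, the kernel of $k[X_1,X_2,X_3]\to R$, $X_i\mapsto h_i$, is generated by $F$, $IR=(h_1,h_2,h_3)R$, and $IR$ has a minimal graded Hilbert–Burch resolution $$0\to R(-l)^2\xrightarrow{\ \psi\ }R(-d_1)\oplus R(-d_2)\oplus R(-d_3)\xrightarrow{(h_1,h_2,h_3)} IR\to 0,\qquad I_2(\psi)=IR.$$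 For $q=p^n$ and $n_0=\gcd\{m: S_m\ne0\}$ put $f_n(x)=\frac1q\sum_{j=0}^{n_0-1}\ell\big((S/I^{[q]})_{\lfloor xq\rfloor n_0+j}\big)$ and $g_n(x)=(1-\theta)f_n(x)+\theta f_n(x+\frac1q)$, where $\theta$ is the fractional part of $xq$. The sequence $g_n$ converges uniformly on $[0,\infty)$, and its limit, the Hilbert–Kunz density function $f_{S,I}$, is the following function (which is $0$ for all larger $x$): * $A_n$, $n$ even: $\frac{4x}{n}$ on $[0,1]$; $\frac4n$ on $[1,\frac n2]$; $\frac{2(2-4x+2n)}{n}$ on $[\frac n2,\frac{n+1}2]$. * $A_n$, $n$ odd: $\frac xn$ on $[0,2]$; $\frac2n$ on $[2,n]$; $\frac{2-2x+2n}{n}$ on $[n,n+1]$. * $D_n$: $\frac xn$ on $[0,2]$; $\frac2n$ on $[2,n]$; $\frac{n+2-x}{n}$ on $[n,n+1]$; $\frac{2n+3-2x}{n}$ on $[n+1,n+\frac32]$. * $E_6$: $\frac x6$ on $[0,3]$; $\frac12$ on $[3,4]$; $\frac{7-x}6$ on $[4,6]$; $\frac{13-2x}6$ on $[6,\frac{13}2]$.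 * $E_7$: $\frac x{12}$ on $[0,4]$; $\frac13$ on $[4,6]$; $\frac{10-x}{12}$ on $[6,9]$; $\frac{19-2x}{12}$ on $[9,\frac{19}2]$. * $E_8$: $\frac x{30}$ on $[0,6]$; $\frac6{30}$ on $[6,10]$; $\frac{16-x}{30}$ on $[10,15]$; $\frac{31-2x}{30}$ on $[15,\frac{31}2]$. Consequently the Hilbert–Kunz multiplicity $e_{HK}(R^G,I)=\lim_{q=p^n\to\infty}\ell(S/I^{[q]})/q^2$ exists (all these lengths being finite) and equals $\int_0^\infty f_{S,I}(x)\,dx=2-\frac1{|G|}$. -/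

import Mathlib

open MvPolynomial Filter Topology Matrix

/-! ### Hilbert–Kunz functions of a graded pair -/

namespace HilbertKunz

section General

variable {k R : Type*} [Field k] [CommRing R] [Algebra k R]

/-- The ideal `I^{[q]}` generated by the `q`-th powers of the elements of `I`. -/
def frobPower (I : Ideal R) (q : ℕ) : Ideal R :=
  Ideal.span ((fun a => a ^ q) '' (I : Set R))

/-- The Krull dimension of `R` as a natural number. -/
noncomputable def dim (R : Type*) [CommRing R] : ℕ :=
  ((ringKrullDim R).unbotD 0).toNat

/-- `gcd {n | 𝒜 n ≠ 0}`: the largest `d` that divides every such `n`. -/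
noncomputable def degreeGCD (𝒜 : ℕ → Submodule k R) : ℕ :=
  sSup {d : ℕ | ∀ n, 𝒜 n ≠ ⊥ → d ∣ n}

/-- The length (over `k = R₀`) of the degree `m` component of `R ⧸ J`, which is the image of
`𝒜 m` in `R ⧸ J`. -/
noncomputable def gradedLength (𝒜 : ℕ → Submodule k R) (J : Ideal R) (m : ℕ) : ℕ :=
  Module.finrank k ((𝒜 m).map (Ideal.Quotient.mkₐ k J).toLinearMap)

/-- The step function
`f_n(x) = q^{-(d-1)} * ∑_{j < n₀} ℓ((R ⧸ I^{[q]})_{⌊xq⌋ n₀ + j})`, where `q = p ^ n`, `d = dim R`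
and `n₀ = gcd {m | R_m ≠ 0}`. -/
noncomputable def stepDensity (𝒜 : ℕ → Submodule k R) [GradedAlgebra 𝒜] (I : Ideal R)
    (p n : ℕ) (x : ℝ) : ℝ :=
  (∑ j ∈ Finset.range (degreeGCD 𝒜),
      (gradedLength 𝒜 (frobPower I (p ^ n)) (⌊x * (p : ℝ) ^ n⌋₊ * degreeGCD 𝒜 + j) : ℝ)) /
    ((p : ℝ) ^ n) ^ (dim R - 1)

/-- The piecewise linear interpolation `g_n` of `f_n`:
`g_n(x) = (1 - t) f_n(x) + t f_n(x + 1 / q)`, where `t` is the fractional part of `x q`. -/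
noncomputable def interpDensity (𝒜 : ℕ → Submodule k R) [GradedAlgebra 𝒜] (I : Ideal R)
    (p n : ℕ) (x : ℝ) : ℝ :=
  (1 - Int.fract (x * (p : ℝ) ^ n)) * stepDensity 𝒜 I p n x +
    Int.fract (x * (p : ℝ) ^ n) * stepDensity 𝒜 I p n (x + 1 / (p : ℝ) ^ n)

/-- `f : [0, ∞) → ℝ` is the Hilbert–Kunz density function of `(R, I)`: the sequence `g_n`
converges to `f`, uniformly on `[0, ∞)`. -/
def IsHKDensity (𝒜 : ℕ → Submodule k R) [GradedAlgebra 𝒜] (I : Ideal R) (p : ℕ)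
    (f : ℝ → ℝ) : Prop :=
  TendstoUniformlyOn (fun n : ℕ => interpDensity 𝒜 I p n) f atTop (Set.Ici 0)

/-- `e` is the Hilbert–Kunz multiplicity of `(R, I)`: all `R ⧸ I^{[q]}`, `q = p ^ n`, have finite
length, and `ℓ(R ⧸ I^{[q]}) / q ^ d → e` with `d = dim R`. -/
def IsHKMultiplicity (I : Ideal R) (p : ℕ) (e : ℝ) : Prop :=
  (∀ n : ℕ, Module.length R (R ⧸ frobPower I (p ^ n)) ≠ ⊤) ∧
  Tendsto (fun n : ℕ =>
    ((Module.length R (R ⧸ frobPower I (p ^ n))).toNat : ℝ) / ((p : ℝ) ^ n) ^ dim R)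
    atTop (𝓝 e)

end General

/-! ### Invariant rings in two variables -/

section Invariants

variable {k : Type*} [Field k]

/-- The linear substitution `f(x) ↦ f(M x)` on `k[x₁, x₂]`. -/
noncomputable def subst (M : Matrix (Fin 2) (Fin 2) k) :
    MvPolynomial (Fin 2) k →ₐ[k] MvPolynomial (Fin 2) k :=
  bind₁ M.toMvPolynomial

/-- The ring of invariants `k[x₁, x₂]^G` of a subgroup `G` of `SL₂(k)`. -/
noncomputable def invariantRing (G : Subgroup (SpecialLinearGroup (Fin 2) k)) :
    Subalgebra k (MvPolynomial (Fin 2) k) where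
  carrier := {f | ∀ g ∈ G, subst (g : Matrix (Fin 2) (Fin 2) k) f = f}
  mul_mem' ha hb g hg := by rw [map_mul, ha g hg, hb g hg]
  add_mem' ha hb g hg := by rw [map_add, ha g hg, hb g hg]
  algebraMap_mem' c g _ := AlgHom.commutes _ c

theorem mem_invariantRing {G : Subgroup (SpecialLinearGroup (Fin 2) k)}
    {f : MvPolynomial (Fin 2) k} :
    f ∈ invariantRing G ↔ ∀ g ∈ G, subst (g : Matrix (Fin 2) (Fin 2) k) f = f := Iff.rfl

/-- The degree `m` part of the ring of invariants (for the usual degree of polynomials). -/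
noncomputable def invGrading (G : Subgroup (SpecialLinearGroup (Fin 2) k)) (m : ℕ) :
    Submodule k (invariantRing G) :=
  (homogeneousSubmodule (Fin 2) k m).comap (invariantRing G).val.toLinearMap

theorem mem_invGrading {G : Subgroup (SpecialLinearGroup (Fin 2) k)} {m : ℕ}
    {f : invariantRing G} :
    f ∈ invGrading G m ↔ (f : MvPolynomial (Fin 2) k).IsHomogeneous m := Iff.rfl

theorem subst_isHomogeneous (M : Matrix (Fin 2) (Fin 2) k) {f : MvPolynomial (Fin 2) k} {m : ℕ}
    (hf : f.IsHomogeneous m) : (subst M f).IsHomogeneous m := by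
  have h := hf.aeval (M.toMvPolynomial) (n := 1) (fun i => M.toMvPolynomial_isHomogeneous i)
  rw [one_mul] at h
  exact h

theorem homogeneousComponent_subst (M : Matrix (Fin 2) (Fin 2) k) (f : MvPolynomial (Fin 2) k)
    (m : ℕ) : homogeneousComponent m (subst M f) = subst M (homogeneousComponent m f) := by
  conv_lhs => rw [← sum_homogeneousComponent f]
  rw [map_sum, map_sum]
  have h : ∀ i, homogeneousComponent m (subst M (homogeneousComponent i f)) =
      if m = i then subst M (homogeneousComponent i f) else 0 := fun i =>
    homogeneousComponent_of_mem (subst_isHomogeneous M (homogeneousComponent_isHomogeneous i f))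
  simp only [h, Finset.sum_ite_eq, Finset.mem_range]
  split_ifs with hm
  · rfl
  · rw [homogeneousComponent_eq_zero m f (by omega), map_zero]

theorem homogeneousComponent_mem_invariantRing
    {G : Subgroup (SpecialLinearGroup (Fin 2) k)} {f : MvPolynomial (Fin 2) k}
    (hf : f ∈ invariantRing G) (m : ℕ) : homogeneousComponent m f ∈ invariantRing G := by
  intro g hg
  rw [← homogeneousComponent_subst, hf g hg]

noncomputable instance invGrading.gradedAlgebra (G : Subgroup (SpecialLinearGroup (Fin 2) k)) :
    GradedAlgebra (invGrading G) := by
  classical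
  have hone : SetLike.GradedMonoid (invGrading G) :=
    { one_mem := isHomogeneous_one _ _
      mul_mem := fun _ _ _ _ ha hb => IsHomogeneous.mul ha hb }
  let comp : invariantRing G → (m : ℕ) → invGrading G m := fun f m =>
    ⟨⟨homogeneousComponent m (f : MvPolynomial (Fin 2) k),
      homogeneousComponent_mem_invariantRing f.2 m⟩, homogeneousComponent_isHomogeneous m _⟩
  let dec : invariantRing G → DirectSum ℕ (fun m => invGrading G m) := fun f =>
    DirectSum.mk (fun m => invGrading G m)
      (Finset.range ((f : MvPolynomial (Fin 2) k).totalDegree + 1)) (fun m => comp f m)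
  have hdec : ∀ f m, dec f m = comp f m := by
    intro f m
    by_cases hm : m ∈ Finset.range ((f : MvPolynomial (Fin 2) k).totalDegree + 1)
    · exact DirectSum.mk_apply_of_mem hm
    · have h0 : dec f m = 0 := DirectSum.mk_apply_of_notMem hm
      rw [h0]
      refine Subtype.ext (Subtype.ext ?_)
      rw [Finset.mem_range, not_lt] at hm
      exact (homogeneousComponent_eq_zero m _ (by omega)).symm
  have hcoe : ∀ (x : DirectSum ℕ (fun m => invGrading G m)) (m : ℕ),
      comp (DirectSum.coeAddMonoidHom (invGrading G) x) m = x m := by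
    intro x m
    induction x using DirectSum.induction_on with
    | zero => exact Subtype.ext (Subtype.ext (by simp [comp]))
    | of i y =>
      rw [DirectSum.coeAddMonoidHom_of]
      have hy : ((y : invariantRing G) : MvPolynomial (Fin 2) k).IsHomogeneous i := y.2
      refine Subtype.ext (Subtype.ext ?_)
      change homogeneousComponent m ((y : invariantRing G) : MvPolynomial (Fin 2) k) = _
      rw [homogeneousComponent_of_mem hy]
      split_ifs with h
      · subst h
        rw [DirectSum.of_eq_same]
      · rw [DirectSum.of_eq_of_ne _ _ _ h]
        rfl
    | add x y hx hy =>
      rw [map_add, DirectSum.add_apply, ← hx, ← hy]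
      exact Subtype.ext (Subtype.ext (by simp [comp]))
  have hinj : ∀ f, DirectSum.coeAddMonoidHom (invGrading G) (dec f) = f := by
    intro f
    refine Subtype.ext ?_
    rw [← sum_homogeneousComponent
      ((DirectSum.coeAddMonoidHom (invGrading G) (dec f) : invariantRing G) :
        MvPolynomial (Fin 2) k)]
    have h1 : ∀ m, homogeneousComponent m
        ((DirectSum.coeAddMonoidHom (invGrading G) (dec f) : invariantRing G) :
          MvPolynomial (Fin 2) k) =
        homogeneousComponent m (f : MvPolynomial (Fin 2) k) := fun m =>
      congrArg (fun z : invGrading G m => ((z : invariantRing G) : MvPolynomial (Fin 2) k))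
        ((hcoe (dec f) m).trans (hdec f m))
    rw [sum_homogeneousComponent]
    refine MvPolynomial.ext _ _ (fun c => ?_)
    have h2 := congrArg (coeff c) (h1 c.degree)
    simpa [coeff_homogeneousComponent] using h2
  exact
    { toGradedMonoid := hone
      toDecomposition :=
        { decompose' := dec
          left_inv := hinj
          right_inv := fun x => by
            refine DFinsupp.ext (fun m => ?_)
            exact (hdec _ m).trans (hcoe x m) } }

/-- The graded maximal ideal `⨁_{m > 0} S_m` of `S = k[x₁, x₂]^G`. -/
noncomputable def gradedMaximalIdeal (G : Subgroup (SpecialLinearGroup (Fin 2) k)) :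
    Ideal (invariantRing G) :=
  (HomogeneousIdeal.irrelevant (invGrading G)).toIdeal

end Invariants

/-! ### Hilbert–Burch resolutions -/

/-- For homogeneous `h 0, h 1, h 2` in `R = k[x₁, x₂]` of degrees `d 0, d 1, d 2`,
`0 → R(-l)² --ψ--> R(-d 0) ⊕ R(-d 1) ⊕ R(-d 2) --(h 0, h 1, h 2)--> (h 0, h 1, h 2) R → 0`
is a minimal graded free resolution, and the `2 × 2` minors of `ψ` generate the ideal. The rows of
`ψ` are the images of the two basis vectors, and minimality holds since the entries are
homogeneous of the positive degrees `l - d i`. -/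
structure IsHilbertBurchResolution {k : Type*} [Field k]
    (h : Fin 3 → MvPolynomial (Fin 2) k) (d : Fin 3 → ℕ) (l : ℕ)
    (ψ : Matrix (Fin 2) (Fin 3) (MvPolynomial (Fin 2) k)) : Prop where
  isHomogeneous_gen : ∀ i, (h i).IsHomogeneous (d i)
  degree_lt : ∀ i, d i < l
  isHomogeneous_entry : ∀ j i, (ψ j i).IsHomogeneous (l - d i)
  injective : Function.Injective (fun v : Fin 2 → MvPolynomial (Fin 2) k => v ᵥ* ψ)
  exact : Function.Exact (fun v : Fin 2 → MvPolynomial (Fin 2) k => v ᵥ* ψ)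
    (fun w : Fin 3 → MvPolynomial (Fin 2) k => w ⬝ᵥ h)
  minors : Ideal.span (Set.range fun s : Fin 2 → Fin 3 => (ψ.submatrix id s).det) =
    Ideal.span (Set.range h)

end HilbertKunz

/-! ### The finite subgroups of `SL₂(k)` of type `A`, `D`, `E` -/

/-- The types of the finite subgroups. The index of `A` is the order of the cyclic group, and the
binary dihedral group of type `D n` has order `4 n`. -/
inductive KleinType where
  | A (n : ℕ)
  | D (n : ℕ)
  | E6
  | E7
  | E8

namespace KleinType

open HilbertKunz

/-- The range of the index: `n ≥ 2` in the types `A n` and `D n`. -/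
def IsValid : KleinType → Prop
  | A n => 2 ≤ n
  | D n => 2 ≤ n
  | _ => True

/-- The order of the group. -/
def order : KleinType → ℕ
  | A n => n
  | D n => 4 * n
  | E6 => 24
  | E7 => 48
  | E8 => 120

section Groups

variable {k : Type*} [Field k]

/-- The subgroup of `SL₂(k)` generated by the given matrices (of determinant `1`). -/
def generated (s : Set (Matrix (Fin 2) (Fin 2) k)) : Subgroup (SpecialLinearGroup (Fin 2) k) :=
  Subgroup.closure {g | (g : Matrix (Fin 2) (Fin 2) k) ∈ s}

/-- Generators of the binary tetrahedral group, for `i` with `i ^ 2 = -1`. -/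
def tetrahedralGens (i : k) : Set (Matrix (Fin 2) (Fin 2) k) :=
  {!![i, 0; 0, -i], !![0, i; i, 0],
    !![(1 - i) / 2, (1 - i) / 2; (-1 - i) / 2, (1 + i) / 2]}

/-- `H` is the standard group of the given type: the cyclic, binary dihedral, binary tetrahedral,
binary octahedral or binary icosahedral group. -/
def IsStandard : KleinType → Subgroup (SpecialLinearGroup (Fin 2) k) → Prop
  | A n, H => ∃ ε : k, IsPrimitiveRoot ε n ∧ H = generated {!![ε, 0; 0, ε⁻¹]}
  | D n, H => ∃ ε i : k, IsPrimitiveRoot ε (2 * n) ∧ i ^ 2 = -1 ∧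
      H = generated {!![ε, 0; 0, ε⁻¹], !![0, i; i, 0]}
  | E6, H => ∃ i : k, i ^ 2 = -1 ∧ H = generated (tetrahedralGens i)
  | E7, H => ∃ ζ : k, IsPrimitiveRoot ζ 8 ∧
      H = generated (insert !![ζ, 0; 0, ζ⁻¹] (tetrahedralGens (ζ ^ 2)))
  | E8, H => ∃ ε s : k, IsPrimitiveRoot ε 5 ∧ s = ε + ε ^ 4 - ε ^ 2 - ε ^ 3 ∧
      H = generated {!![-ε ^ 3, 0; 0, -ε ^ 2],
        !![(ε ^ 4 - ε) / s, (ε ^ 2 - ε ^ 3) / s; (ε ^ 2 - ε ^ 3) / s, (ε - ε ^ 4) / s]}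

/-- `G = P H P⁻¹` for the standard group `H` of type `t`. -/
def IsConjStandard (t : KleinType) (P : GL (Fin 2) k)
    (G : Subgroup (SpecialLinearGroup (Fin 2) k)) : Prop :=
  ∃ H : Subgroup (SpecialLinearGroup (Fin 2) k), t.IsStandard H ∧
    ∀ g : SpecialLinearGroup (Fin 2) k, g ∈ G ↔
      ∃ h ∈ H, (g : Matrix (Fin 2) (Fin 2) k) = P.val * h * P⁻¹.val

end Groups

section Generators

variable (k : Type*) [Field k]

/-- `x₁⁵x₂ - x₁x₂⁵`. -/
noncomputable def octaT : MvPolynomial (Fin 2) k := X 0 ^ 5 * X 1 - X 0 * X 1 ^ 5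

/-- `x₁⁸ + 14x₁⁴x₂⁴ + x₂⁸`. -/
noncomputable def octaW : MvPolynomial (Fin 2) k :=
  X 0 ^ 8 + 14 * X 0 ^ 4 * X 1 ^ 4 + X 1 ^ 8

/-- `x₁¹² - 33x₁⁸x₂⁴ - 33x₁⁴x₂⁸ + x₂¹²`. -/
noncomputable def octaX : MvPolynomial (Fin 2) k :=
  X 0 ^ 12 - 33 * X 0 ^ 8 * X 1 ^ 4 - 33 * X 0 ^ 4 * X 1 ^ 8 + X 1 ^ 12

/-- The generators `h₁, h₂, h₃` of the ring of invariants of the standard group. -/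
noncomputable def gens : KleinType → Fin 3 → MvPolynomial (Fin 2) k
  | A n => ![X 0 * X 1, X 0 ^ n, X 1 ^ n]
  | D n => ![-2 * X 0 ^ 2 * X 1 ^ 2,
      X 0 ^ (2 * n) + (-1) ^ n * X 1 ^ (2 * n),
      X 0 * X 1 * (X 0 ^ (2 * n) - (-1) ^ n * X 1 ^ (2 * n))]
  | E6 => ![octaT k, octaW k, octaX k]
  | E7 => ![octaW k, octaT k ^ 2, octaT k * octaX k]
  | E8 => ![X 0 * X 1 * (X 0 ^ 10 + 11 * X 0 ^ 5 * X 1 ^ 5 - X 1 ^ 10),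
      X 0 ^ 30 + X 1 ^ 30 + 522 * (X 0 ^ 25 * X 1 ^ 5 - X 1 ^ 25 * X 0 ^ 5)
        - 10005 * (X 0 ^ 20 * X 1 ^ 10 + X 0 ^ 10 * X 1 ^ 20),
      -X 0 ^ 20 - X 1 ^ 20 + 228 * (X 0 ^ 15 * X 1 ^ 5 - X 1 ^ 15 * X 0 ^ 5)
        - 494 * (X 0 ^ 10 * X 1 ^ 10)]

/-- The relation among `h₁, h₂, h₃`. -/
noncomputable def relation : KleinType → MvPolynomial (Fin 3) k
  | A n => X 0 ^ n - X 1 * X 2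
  | D n => 2 ^ (n + 1) * X 2 ^ 2 + 2 ^ n * X 0 * X 1 ^ 2 - 4 * X 0 ^ (n + 1)
  | E6 => 108 * X 0 ^ 4 - X 1 ^ 3 + X 2 ^ 2
  | E7 => X 2 ^ 2 - X 0 ^ 3 * X 1 + 108 * X 1 ^ 3
  | E8 => X 1 ^ 2 + X 2 ^ 3 - 1728 * X 0 ^ 5

end Generators

/-- The degrees of `h₁, h₂, h₃`. -/
def degrees : KleinType → Fin 3 → ℕ
  | A n => ![2, n, n]
  | D n => ![4, 2 * n, 2 * n + 2]
  | E6 => ![6, 8, 12]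
  | E7 => ![8, 12, 18]
  | E8 => ![12, 30, 20]

/-- The common degree of the two syzygies of `h₁, h₂, h₃`. -/
def syzygyDegree : KleinType → ℕ
  | A n => n + 1
  | D n => 2 * n + 3
  | E6 => 13
  | E7 => 19
  | E8 => 31

/-- The Hilbert–Kunz density function, as a function on `[0, ∞)`. -/
noncomputable def density : KleinType → ℝ → ℝ
  | A n, x =>
    if Even n then
      if x ≤ 1 then 4 * x / n
      else if x ≤ n / 2 then 4 / n
      else if x ≤ (n + 1) / 2 then 2 * (2 - 4 * x + 2 * n) / n
      else 0
    else
      if x ≤ 2 then x / n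
      else if x ≤ n then 2 / n
      else if x ≤ n + 1 then (2 - 2 * x + 2 * n) / n
      else 0
  | D n, x =>
    if x ≤ 2 then x / n
    else if x ≤ n then 2 / n
    else if x ≤ n + 1 then (n + 2 - x) / n
    else if x ≤ n + 3 / 2 then (2 * n + 3 - 2 * x) / n
    else 0
  | E6, x =>
    if x ≤ 3 then x / 6
    else if x ≤ 4 then 1 / 2
    else if x ≤ 6 then (7 - x) / 6
    else if x ≤ 13 / 2 then (13 - 2 * x) / 6
    else 0
  | E7, x =>
    if x ≤ 4 then x / 12
    else if x ≤ 6 then 1 / 3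
    else if x ≤ 9 then (10 - x) / 12
    else if x ≤ 19 / 2 then (19 - 2 * x) / 12
    else 0
  | E8, x =>
    if x ≤ 6 then x / 30
    else if x ≤ 10 then 6 / 30
    else if x ≤ 15 then (16 - x) / 30
    else if x ≤ 31 / 2 then (31 - 2 * x) / 30
    else 0

end KleinType

/-! Write `R = k[x₁, x₂]` and `S = R^G`. The density is found by counting dimensions, without
averaging over `G`. The `S`-module `R` is finite of rank `|G|`, and a maximal independent family of
monomials is a homogeneous basis of it up to one homogeneous denominator `Δ`. Expanding syzygies in
this basis shows the following for homogeneous elements of `S`: `|G|` times the dimension of a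
graded piece of their syzygies over `S` agrees with the total dimension of a block of `n₀`
consecutive pieces of their syzygies over `R`, up to a shift in degree that depends on `G` alone
(`exists_block_bounds`).

Over `R` the syzygies are explicit. In each type the generators are the maximal minors of a
homogeneous `2 × 3` matrix and two of them are coprime (`IsMinors`), so the rows of the matrix are a
basis of the syzygies. As the `q`-th power map is a ring homomorphism, the matrix of `q`-th powers
does the same for the `hᵢ^q`, with `l` and `dᵢ` multiplied by `q`. The Euler characteristic in
degree `m`, with `n₀ ∣ m`, then gives `|G| ℓ((S/I^[q])_m) = n₀ (m - ∑ (m - dᵢ q)₊ + 2 (m - l q)₊) +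
O(1)`, where the error is bounded independently of `q` and `m` (`exists_gradedLength_bound`).
Putting `m ≈ n₀ x q` gives the density function with uniform convergence. Summing over `m` gives the
multiplicity `(2 l² - ∑ dᵢ²) / (2 |G|)`, which is `2 - 1/|G|` because `2 l² - ∑ dᵢ² = 4 |G| - 2` in
every type.

The rings of invariants are determined by three methods. For a cyclic diagonal group invariance is a
condition on single monomials. In the types `D n` and `E₇` one extra generator acts on the
invariants of a smaller group of known type by signs (`mem_of_mem_double_cover`). In the types `E₆`
and `E₈` the orbit of the line through `(1, 0)` is the zero set of an invariant `θ` of degree `6` or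
`12`: invariants that vanish at `(1, 0)` are divisible by `θ`, and the others have the degree of a
monomial in the two remaining generators (`invariantRing_eq_adjoin_of_lines`). The same orbits of
lines give the orders of the groups (`card_eq_of_lines`). Finally the relation `F` is irreducible,
and the kernel of a map from `k[X₁, X₂, X₃]` onto a ring of dimension `2` has no room for anything
outside `(F)`. -/

namespace HilbertKunz

/-! ### Linear substitutions and the graded pieces of `k[x₁, x₂]`. -/

section Substitution

variable {k : Type*} [Field k]

/-- The order is reversed because `f ↦ f(Mx)` is a right action; this accounts for the inverse in
`substAction`. -/
theorem subst_subst (M N : Matrix (Fin 2) (Fin 2) k) (f : MvPolynomial (Fin 2) k) :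
    subst M (subst N f) = subst (N * M) f := by
  unfold subst
  rw [bind₁_bind₁]
  congr 2
  funext i
  rw [toMvPolynomial_mul]

theorem subst_one (f : MvPolynomial (Fin 2) k) : subst (1 : Matrix (Fin 2) (Fin 2) k) f = f := by
  unfold subst
  rw [toMvPolynomial_one, bind₁_X_left]
  rfl

theorem subst_X (M : Matrix (Fin 2) (Fin 2) k) (i : Fin 2) :
    subst M (X i) = C (M i 0) * X 0 + C (M i 1) * X 1 := by
  unfold subst
  rw [bind₁_X_right, Matrix.toMvPolynomial, Fin.sum_univ_two]
  simp [C_mul_X_eq_monomial]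

theorem subst_C (M : Matrix (Fin 2) (Fin 2) k) (c : k) : subst M (C c) = C c := by
  unfold subst
  rw [bind₁_C_right]

theorem aeval_subst {B : Type*} [CommRing B] [Algebra k B] (v : Fin 2 → B)
    (M : Matrix (Fin 2) (Fin 2) k) (f : MvPolynomial (Fin 2) k) :
    aeval v (subst M f) =
      aeval (fun i => algebraMap k B (M i 0) * v 0 + algebraMap k B (M i 1) * v 1) f := by
  unfold subst
  rw [aeval_bind₁]
  congr 2
  funext i
  rw [Matrix.toMvPolynomial, Fin.sum_univ_two]
  simp [← C_mul_X_eq_monomial]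

theorem eval_subst (v : Fin 2 → k) (M : Matrix (Fin 2) (Fin 2) k)
    (f : MvPolynomial (Fin 2) k) : eval v (subst M f) = eval (M *ᵥ v) f := by
  have h := aeval_subst v M f
  rw [← aeval_eq_eval, ← aeval_eq_eval]
  refine h.trans ?_
  congr 2
  funext i
  simp [Matrix.mulVec, dotProduct, Fin.sum_univ_two]

/-- The automorphism of `k[x₁, x₂]` given by an invertible substitution. -/
noncomputable def substEquiv (P : GL (Fin 2) k) :
    MvPolynomial (Fin 2) k ≃ₐ[k] MvPolynomial (Fin 2) k :=
  AlgEquiv.ofAlgHom (subst P.val) (subst P⁻¹.val)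
    (AlgHom.ext fun f => by
      rw [AlgHom.comp_apply, subst_subst, ← Units.val_mul, inv_mul_cancel, Units.val_one,
        subst_one, AlgHom.id_apply])
    (AlgHom.ext fun f => by
      rw [AlgHom.comp_apply, subst_subst, ← Units.val_mul, mul_inv_cancel, Units.val_one,
        subst_one, AlgHom.id_apply])

theorem substEquiv_apply (P : GL (Fin 2) k) (f : MvPolynomial (Fin 2) k) :
    substEquiv P f = subst P.val f := rfl

/-- The exponent `(i, j)`. -/
noncomputable def expo (i j : ℕ) : Fin 2 →₀ ℕ := Finsupp.single 0 i + Finsupp.single 1 j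

@[simp] theorem expo_zero (i j : ℕ) : expo i j 0 = i := by simp [expo]

@[simp] theorem expo_one (i j : ℕ) : expo i j 1 = j := by simp [expo]

theorem eq_expo (d : Fin 2 →₀ ℕ) : d = expo (d 0) (d 1) := by
  ext i
  fin_cases i <;> simp

theorem degree_eq (d : Fin 2 →₀ ℕ) : d.degree = d 0 + d 1 := by
  rw [Finsupp.degree_eq_sum, Fin.sum_univ_two]

theorem finrank_homogeneousSubmodule (m : ℕ) :
    Module.finrank k (homogeneousSubmodule (Fin 2) k m) = m + 1 := by
  let φ : homogeneousSubmodule (Fin 2) k m →ₗ[k] (Fin (m + 1) → k) :=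
    LinearMap.pi fun i => (lcoeff k (expo i (m - i))) ∘ₗ (homogeneousSubmodule (Fin 2) k m).subtype
  have hφ : ∀ f i, φ f i = coeff (expo i (m - i)) (f : MvPolynomial (Fin 2) k) := fun _ _ => rfl
  have hinj : Function.Injective φ := by
    intro f g hfg
    refine Subtype.ext (MvPolynomial.ext _ _ fun d => ?_)
    by_cases hd : d.degree = m
    · have h := congrFun hfg ⟨d 0, by rw [degree_eq] at hd; omega⟩
      rw [hφ, hφ] at h
      have hd1 : m - d 0 = d 1 := by rw [degree_eq] at hd; omega
      simp only [hd1] at h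
      rwa [← eq_expo] at h
    · have hf : (f : MvPolynomial (Fin 2) k).IsHomogeneous m := f.2
      have hg : (g : MvPolynomial (Fin 2) k).IsHomogeneous m := g.2
      rw [hf.coeff_eq_zero hd, hg.coeff_eq_zero hd]
  have hsurj : Function.Surjective φ := by
    intro c
    refine ⟨⟨∑ i : Fin (m + 1), monomial (expo i (m - i)) (c i), ?_⟩, ?_⟩
    · refine Submodule.sum_mem _ fun i _ => isHomogeneous_monomial _ ?_
      rw [degree_eq, expo_zero, expo_one]
      omega
    · funext j
      rw [hφ]
      change coeff _ (∑ i : Fin (m + 1), monomial (expo i (m - i)) (c i)) = _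
      rw [coeff_sum, Finset.sum_eq_single j]
      · rw [coeff_monomial, if_pos rfl]
      · intro i _ hij
        rw [coeff_monomial, if_neg]
        intro h
        have := DFunLike.congr_fun h 0
        rw [expo_zero, expo_zero] at this
        exact hij (Fin.ext this)
      · intro h
        exact absurd (Finset.mem_univ j) h
  rw [(LinearEquiv.ofBijective φ ⟨hinj, hsurj⟩).finrank_eq]
  simp

instance (m : ℕ) : FiniteDimensional k (homogeneousSubmodule (Fin 2) k m) :=
  FiniteDimensional.of_finrank_pos (by rw [finrank_homogeneousSubmodule]; omega)

theorem homogeneousComponent_mul_right {f g : MvPolynomial (Fin 2) k} {e : ℕ}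
    (hg : g.IsHomogeneous e) (m : ℕ) :
    homogeneousComponent m (f * g) = if e ≤ m then homogeneousComponent (m - e) f * g else 0 := by
  let := gradedAlgebra (σ := Fin 2) (R := k)
  rw [← decomposition.decompose'_apply]
  split_ifs with h
  · rw [← decomposition.decompose'_apply]
    exact DirectSum.coe_decompose_mul_of_right_mem_of_le (homogeneousSubmodule (Fin 2) k)
      (a := f) hg h
  · exact DirectSum.coe_decompose_mul_of_right_mem_of_not_le (homogeneousSubmodule (Fin 2) k)
      (a := f) hg h

end Substitution

/-! ### Syzygies of the maximal minors of a `2 × 3` matrix -/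

section Cross

variable {A : Type*} [CommRing A]

theorem dotProduct_fin_three (w h : Fin 3 → A) : w ⬝ᵥ h = w 0 * h 0 + w 1 * h 1 + w 2 * h 2 := by
  rw [dotProduct, Fin.sum_univ_three]

variable [IsDomain A]

/-- A syzygy of the maximal minors of a `2 × 3` matrix is a combination of its rows, as soon as two
of the minors have no common factor. -/
theorem exists_combination_of_dotProduct_eq_zero [UniqueFactorizationMonoid A] {a b h : Fin 3 → A}
    (h0 : h 0 = a 1 * b 2 - a 2 * b 1) (h1 : h 1 = a 2 * b 0 - a 0 * b 2)
    (h2 : h 2 = a 0 * b 1 - a 1 * b 0) {i j : Fin 3} (hi : h i ≠ 0) (hij : IsRelPrime (h i) (h j))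
    {w : Fin 3 → A} (hw : w ⬝ᵥ h = 0) : ∃ x y : A, w = fun i => x * a i + y * b i := by
  have hw' := hw
  rw [dotProduct_fin_three, h0, h1, h2] at hw'
  -- In terms of cross products `h = a × b`, `u = w × b` and `v = a × w`. Since `a`, `b` and `w` are
  -- all orthogonal to `h`, both `u` and `v` are parallel to `h`; this is `key`.
  let u : Fin 3 → A := ![w 1 * b 2 - w 2 * b 1, w 2 * b 0 - w 0 * b 2, w 0 * b 1 - w 1 * b 0]
  let v : Fin 3 → A := ![a 1 * w 2 - a 2 * w 1, a 2 * w 0 - a 0 * w 2, a 0 * w 1 - a 1 * w 0]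
  have key : ∀ m n : Fin 3, u m * h n = u n * h m ∧ v m * h n = v n * h m := by
    intro m n
    fin_cases m <;> fin_cases n <;> constructor <;> simp [u, v, h0, h1, h2] <;>
      first
      | ring1
      | linear_combination (b 2) * hw'
      | linear_combination -(b 2) * hw'
      | linear_combination (b 1) * hw'
      | linear_combination -(b 1) * hw'
      | linear_combination (b 0) * hw'
      | linear_combination -(b 0) * hw'
      | linear_combination (a 2) * hw'
      | linear_combination -(a 2) * hw'
      | linear_combination (a 1) * hw'
      | linear_combination -(a 1) * hw'
      | linear_combination (a 0) * hw'
      | linear_combination -(a 0) * hw'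
  -- `h i` divides `u i * h j = u j * h i` and is coprime to `h j`, so it divides `u i`. The
  -- quotients are the coefficients sought.
  obtain ⟨x, hx⟩ : h i ∣ u i := hij.dvd_of_dvd_mul_right ⟨u j, by rw [(key i j).1]; ring⟩
  obtain ⟨y, hy⟩ : h i ∣ v i := hij.dvd_of_dvd_mul_right ⟨v j, by rw [(key i j).2]; ring⟩
  have hu : ∀ n, u n = x * h n := fun n => mul_right_cancel₀ hi (by
    rw [(key n i).1, hx]; ring)
  have hv : ∀ n, v n = y * h n := fun n => mul_right_cancel₀ hi (by
    rw [(key n i).2, hy]; ring)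
  refine ⟨x, y, funext fun n => mul_right_cancel₀ hi ?_⟩
  -- Cramer's rule; only the case `n = m` needs `w ⬝ᵥ h = 0`.
  have e : ∀ n m, w n * h m = u m * a n + v m * b n := by
    intro n m
    fin_cases n <;> fin_cases m <;> simp [u, v, h0, h1, h2] <;>
      first
      | ring1
      | linear_combination hw'
  rw [e n i, hu, hv]
  ring

/-- Cramer's rule again: a single non-zero minor makes the rows independent. -/
theorem eq_zero_of_combination_eq_zero {a b h : Fin 3 → A}
    (h0 : h 0 = a 1 * b 2 - a 2 * b 1) (h1 : h 1 = a 2 * b 0 - a 0 * b 2)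
    (h2 : h 2 = a 0 * b 1 - a 1 * b 0) {i : Fin 3} (hi : h i ≠ 0) {x y : A}
    (hxy : ∀ i, x * a i + y * b i = 0) : x = 0 ∧ y = 0 := by
  have e0 := hxy 0
  have e1 := hxy 1
  have e2 := hxy 2
  constructor <;> refine (mul_eq_zero.mp ?_).resolve_right hi <;> fin_cases i <;>
    simp only [h0, h1, h2, Fin.zero_eta, Fin.mk_one, Fin.reduceFinMk]
  · linear_combination b 2 * e1 - b 1 * e2
  · linear_combination b 0 * e2 - b 2 * e0
  · linear_combination b 1 * e0 - b 0 * e1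
  · linear_combination a 1 * e2 - a 2 * e1
  · linear_combination a 2 * e0 - a 0 * e2
  · linear_combination a 0 * e1 - a 1 * e0

end Cross

end HilbertKunz

namespace HilbertKunz

/-! ### The extension `S ⊂ R`: Galois with group `G`, finite, of rank `|G|`. -/

section Galois

variable {k : Type*} [Field k] (G : Subgroup (SpecialLinearGroup (Fin 2) k))

/-- The action of `G` on `k[x₁, x₂]` by `(g • f)(x) = f(g⁻¹ x)`. -/
noncomputable abbrev substAction : MulSemiringAction G (MvPolynomial (Fin 2) k) where
  smul g f := subst ((g⁻¹ : G) : SpecialLinearGroup (Fin 2) k).val f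
  one_smul f := by
    change subst ((1⁻¹ : G) : SpecialLinearGroup (Fin 2) k).val f = f
    simpa using subst_one f
  mul_smul g g' f := by
    change subst (((g * g')⁻¹ : G) : SpecialLinearGroup (Fin 2) k).val f =
      subst ((g⁻¹ : G) : SpecialLinearGroup (Fin 2) k).val
        (subst ((g'⁻¹ : G) : SpecialLinearGroup (Fin 2) k).val f)
    rw [subst_subst, _root_.mul_inv_rev]
    rfl
  smul_zero g := map_zero _
  smul_add g a b := map_add _ a b
  smul_one g := map_one _
  smul_mul g a b := map_mul _ a b

theorem eq_one_of_subst_X {M : Matrix (Fin 2) (Fin 2) k}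
    (h : ∀ i, subst M (X i : MvPolynomial (Fin 2) k) = X i) : M = 1 := by
  have h1 : ∀ i j, M i j = (1 : Matrix (Fin 2) (Fin 2) k) i j := by
    intro i j
    have := congrArg (coeff (Finsupp.single j 1)) (h i)
    rw [subst_X, coeff_add, coeff_C_mul, coeff_C_mul, coeff_X, coeff_X, coeff_X] at this
    fin_cases i <;> fin_cases j <;>
      simpa [Finsupp.single_left_inj, Matrix.one_apply] using this
  ext i j
  exact h1 i j

theorem isGaloisGroup_invariantRing :
    letI := substAction G
    IsGaloisGroup G (invariantRing G) (MvPolynomial (Fin 2) k) := by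
  let := substAction G
  have hs : ∀ (g : G) (f : MvPolynomial (Fin 2) k),
      g • f = subst ((g⁻¹ : G) : SpecialLinearGroup (Fin 2) k).val f := fun _ _ => rfl
  refine ⟨⟨fun {g g'} h => ?_⟩, ⟨fun g s f => ?_⟩, ⟨fun f hf => ?_⟩⟩
  · have h1 : ∀ f : MvPolynomial (Fin 2) k, (g⁻¹ * g') • f = f := fun f => by
      rw [mul_smul, ← h f, inv_smul_smul]
    have h2 := eq_one_of_subst_X (fun i => by simpa only [hs] using h1 (X i))
    have h3 : (g⁻¹ * g')⁻¹ = 1 := by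
      apply Subtype.ext
      apply Subtype.ext
      exact h2
    rw [inv_eq_one, inv_mul_eq_one] at h3
    exact h3
  · rw [Algebra.smul_def, Algebra.smul_def, smul_mul']
    congr 1
    rw [hs]
    exact s.2 _ (g⁻¹ : G).2
  · refine ⟨⟨f, fun g hg => ?_⟩, rfl⟩
    have := hf ⟨g, hg⟩⁻¹
    rw [hs, inv_inv] at this
    exact this

theorem isIntegral_invariantRing [Finite G] :
    Algebra.IsIntegral (invariantRing G) (MvPolynomial (Fin 2) k) := by
  let := substAction G
  have := (isGaloisGroup_invariantRing G).isInvariant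
  exact Algebra.IsInvariant.isIntegral _ _ G

theorem finite_invariantRing [Finite G] :
    Module.Finite (invariantRing G) (MvPolynomial (Fin 2) k) := by
  have := isIntegral_invariantRing G
  have : Algebra.FiniteType (invariantRing G) (MvPolynomial (Fin 2) k) :=
    Algebra.FiniteType.of_restrictScalars_finiteType k _ _
  exact Algebra.IsIntegral.finite

/-- Artin's theorem. It does not need `|G|` to be invertible in `k`, and it is the source of the
factor `Nat.card G` in all later counts. -/
theorem finrank_invariantRing [Finite G] :
    Module.finrank (invariantRing G) (MvPolynomial (Fin 2) k) = Nat.card G := by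
  let := substAction G
  have := isGaloisGroup_invariantRing G
  exact (IsGaloisGroup.card_eq_finrank' G _ _).symm

end Galois

/-! ### Maximal linearly independent families -/

section Torsion

variable {A M : Type*} [CommRing A] [IsDomain A] [AddCommGroup M] [Module A M]

theorem exists_smul_mem_of_span_eq_top {N : Submodule A M} {T : Set M}
    (hT : Submodule.span A T = ⊤) (h : ∀ x ∈ T, ∃ a : A, a ≠ 0 ∧ a • x ∈ N) (x : M) :
    ∃ a : A, a ≠ 0 ∧ a • x ∈ N := by
  have hx : x ∈ Submodule.span A T := hT ▸ Submodule.mem_top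
  induction hx using Submodule.span_induction with
  | mem x hx => exact h x hx
  | zero => exact ⟨1, one_ne_zero, by simp⟩
  | add x y _ _ hx hy =>
    obtain ⟨a, ha, hax⟩ := hx
    obtain ⟨b, hb, hby⟩ := hy
    refine ⟨a * b, mul_ne_zero ha hb, ?_⟩
    rw [smul_add, mul_smul, smul_comm, mul_smul]
    exact N.add_mem (N.smul_mem _ hax) (N.smul_mem _ hby)
  | smul c x _ hx =>
    obtain ⟨a, ha, hax⟩ := hx
    refine ⟨a, ha, ?_⟩
    rw [smul_comm]
    exact N.smul_mem _ hax

/-- The product of the denominators of finitely many generators is a common denominator. -/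
theorem exists_smul_mem_of_finite [Module.Finite A M] {N : Submodule A M}
    (h : ∀ x : M, ∃ a : A, a ≠ 0 ∧ a • x ∈ N) : ∃ a : A, a ≠ 0 ∧ ∀ x : M, a • x ∈ N := by
  classical
  obtain ⟨T, hT⟩ := Module.Finite.fg_top (R := A) (M := M)
  choose f hf hfN using h
  refine ⟨∏ x ∈ T, f x, Finset.prod_ne_zero_iff.mpr fun x _ => hf x, fun x => ?_⟩
  have hx : x ∈ Submodule.span A (T : Set M) := hT ▸ Submodule.mem_top
  induction hx using Submodule.span_induction with
  | mem x hx =>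
    rw [← Finset.prod_erase_mul _ _ hx, mul_smul]
    exact N.smul_mem _ (hfN x)
  | zero => simp
  | add x y _ _ hx hy => rw [smul_add]; exact N.add_mem hx hy
  | smul c x _ hx => rw [smul_comm]; exact N.smul_mem _ hx

/-- The quotient by a maximal independent subfamily is torsion, so the subfamily has as many members
as the rank. Choosing it inside a given spanning family allows the basis of `R` over `S` to consist
of monomials. -/
theorem exists_linearIndependent_fin_finrank [Module.Finite A M] {ι : Type*} (v : ι → M)
    (hv : Submodule.span A (Set.range v) = ⊤) :
    ∃ b : Fin (Module.finrank A M) → ι, LinearIndependent A (v ∘ b) ∧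
      ∃ a : A, a ≠ 0 ∧ ∀ x : M, a • x ∈ Submodule.span A (Set.range (v ∘ b)) := by
  obtain ⟨s, hs, hmax⟩ := exists_maximal_linearIndepOn A v
  have h1 : ∀ x : M, ∃ a : A, a ≠ 0 ∧ a • x ∈ Submodule.span A (v '' s) := by
    refine exists_smul_mem_of_span_eq_top hv ?_
    rintro _ ⟨i, rfl⟩
    by_cases hi : i ∈ s
    · exact ⟨1, one_ne_zero, by rw [one_smul]; exact Submodule.subset_span ⟨i, hi, rfl⟩⟩
    · exact hmax i hi
  have hli : LinearIndependent A (fun i : s => v i) := hs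
  have hfin : Finite s := hli.finite
  have hfs : Fintype s := Fintype.ofFinite s
  have hcard : Fintype.card s = Module.finrank A M := by
    have h2 := finrank_span_eq_card hli
    rw [← h2, ← Set.image_eq_range]
    have h3 := rank_quotient_add_rank_of_isDomain (Submodule.span A (v '' s))
    rw [rank_eq_zero_iff.mpr, zero_add] at h3
    · unfold Module.finrank
      rw [h3]
    · intro x
      obtain ⟨x, rfl⟩ := Submodule.Quotient.mk_surjective _ x
      obtain ⟨a, ha, hax⟩ := h1 x
      exact ⟨a, ha, by rwa [← Submodule.Quotient.mk_smul, Submodule.Quotient.mk_eq_zero]⟩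
  let eq := (Fintype.equivFinOfCardEq hcard).symm
  refine ⟨fun j => (eq j : ι), hli.comp eq eq.injective, ?_⟩
  have hr : Set.range (v ∘ fun j => (eq j : ι)) = v '' s := by
    rw [Set.image_eq_range]
    exact eq.surjective.range_comp (fun i : s => v i)
  rw [hr]
  exact exists_smul_mem_of_finite h1

end Torsion

/-! ### Homogeneous bases of `R` over `S` up to a denominator. -/

section GenericBasis

variable {k : Type*} [Field k]

/-- The degree `m` part of the ring of invariants, as a subspace of `k[x₁, x₂]`. -/
noncomputable def invPart (G : Subgroup (SpecialLinearGroup (Fin 2) k)) (m : ℕ) :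
    Submodule k (MvPolynomial (Fin 2) k) :=
  Subalgebra.toSubmodule (invariantRing G) ⊓ homogeneousSubmodule (Fin 2) k m

section Shift

variable {M : Type*} [AddCommGroup M] [Module k M]

/-- The degree `m` part of the shift by `e` of a graded space. -/
noncomputable def shiftedPart (A : ℕ → Submodule k M) (e m : ℕ) : Submodule k M :=
  if e ≤ m then A (m - e) else ⊥

theorem shiftedPart_of_le {A : ℕ → Submodule k M} {e m : ℕ} (h : e ≤ m) :
    shiftedPart A e m = A (m - e) := if_pos h

theorem shiftedPart_of_not_le {A : ℕ → Submodule k M} {e m : ℕ} (h : ¬ e ≤ m) :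
    shiftedPart A e m = ⊥ := if_neg h

theorem mem_shiftedPart {A : ℕ → Submodule k M} {e m : ℕ} {x : M} :
    x ∈ shiftedPart A e m ↔ e ≤ m ∧ x ∈ A (m - e) ∨ ¬ e ≤ m ∧ x = 0 := by
  by_cases h : e ≤ m
  · simp [shiftedPart_of_le h, h]
  · simp [shiftedPart_of_not_le h, h]

instance (A : ℕ → Submodule k M) [∀ m, FiniteDimensional k (A m)] (e m : ℕ) :
    FiniteDimensional k (shiftedPart A e m) := by
  by_cases h : e ≤ m
  · rw [shiftedPart_of_le h]
    infer_instance
  · rw [shiftedPart_of_not_le h]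
    infer_instance

end Shift

variable {G : Subgroup (SpecialLinearGroup (Fin 2) k)}

instance (m : ℕ) : FiniteDimensional k (invPart G m) :=
  Submodule.finiteDimensional_of_le (inf_le_right : _ ≤ homogeneousSubmodule (Fin 2) k m)

/-- Homogeneous elements `a j` of `k[x₁, x₂]` that form a basis over `k[x₁, x₂]^G` up to the
denominator `Δ`. -/
structure IsGenericBasis (G : Subgroup (SpecialLinearGroup (Fin 2) k)) {N : ℕ}
    (a : Fin N → MvPolynomial (Fin 2) k) (e : Fin N → ℕ) (Δ : MvPolynomial (Fin 2) k) (δ : ℕ) :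
    Prop where
  isHomogeneous : ∀ j, (a j).IsHomogeneous (e j)
  mem : Δ ∈ invPart G δ
  ne_zero : Δ ≠ 0
  indep : ∀ c : Fin N → MvPolynomial (Fin 2) k, (∀ j, c j ∈ invariantRing G) →
    ∑ j, c j * a j = 0 → ∀ j, c j = 0
  exists_eq : ∀ m f, f ∈ homogeneousSubmodule (Fin 2) k m →
    ∃ c : Fin N → MvPolynomial (Fin 2) k,
      (∀ j, c j ∈ shiftedPart (invPart G) (e j) (m + δ)) ∧ Δ * f = ∑ j, c j * a j

theorem exists_isGenericBasis [Finite G] :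
    ∃ (a : Fin (Nat.card G) → MvPolynomial (Fin 2) k) (e : Fin (Nat.card G) → ℕ)
      (Δ : MvPolynomial (Fin 2) k) (δ : ℕ), IsGenericBasis G a e Δ δ := by
  have := finite_invariantRing G
  have hspan : Submodule.span (invariantRing G)
      (Set.range fun d : Fin 2 →₀ ℕ => (monomial d 1 : MvPolynomial (Fin 2) k)) = ⊤ := by
    rw [eq_top_iff]
    intro f _
    rw [f.as_sum]
    refine Submodule.sum_mem _ fun d _ => ?_
    have : monomial d (coeff d f) =
        (algebraMap k (invariantRing G) (coeff d f)) • (monomial d 1 : MvPolynomial (Fin 2) k) := by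
      rw [algebraMap_smul, smul_monomial, smul_eq_mul, mul_one]
    rw [this]
    exact Submodule.smul_mem _ _ (Submodule.subset_span ⟨d, rfl⟩)
  have key := exists_linearIndependent_fin_finrank _ hspan
  rw [finrank_invariantRing] at key
  obtain ⟨b, hb, D, hD, hgen⟩ := key
  have hD' : (D : MvPolynomial (Fin 2) k) ≠ 0 := fun h => hD (Subtype.ext h)
  -- Any non-zero homogeneous component of the common denominator `D` is one too: for `f` of degree
  -- `m`, take the part of degree `m + δ` in `D f = ∑ cⱼ aⱼ`.
  obtain ⟨δ, hδ⟩ : ∃ δ, homogeneousComponent δ (D : MvPolynomial (Fin 2) k) ≠ 0 := by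
    by_contra! h
    apply hD'
    rw [← sum_homogeneousComponent (D : MvPolynomial (Fin 2) k)]
    exact Finset.sum_eq_zero fun i _ => h i
  have ha : ∀ j, (monomial (b j) 1 : MvPolynomial (Fin 2) k).IsHomogeneous (b j).degree :=
    fun j => isHomogeneous_monomial _ rfl
  refine ⟨fun j => monomial (b j) 1, fun j => (b j).degree,
    homogeneousComponent δ (D : MvPolynomial (Fin 2) k), δ, ha,
    ⟨homogeneousComponent_mem_invariantRing D.2 δ, homogeneousComponent_isHomogeneous _ _⟩, hδ,
    ?_, ?_⟩
  · intro c hc h j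
    have := Fintype.linearIndependent_iff.mp hb (fun j => ⟨c j, hc j⟩)
      (by simpa [Algebra.smul_def] using h) j
    exact congrArg Subtype.val this
  · intro m f hf
    obtain ⟨c, hc⟩ := (Submodule.mem_span_range_iff_exists_fun _).mp (hgen f)
    have hc' : (D : MvPolynomial (Fin 2) k) * f =
        ∑ j, (c j : MvPolynomial (Fin 2) k) * monomial (b j) 1 := hc.symm
    refine ⟨fun j => if (b j).degree ≤ m + δ then
      homogeneousComponent (m + δ - (b j).degree) (c j : MvPolynomial (Fin 2) k) else 0,
      fun j => ?_, ?_⟩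
    · dsimp only
      split_ifs with h
      · rw [shiftedPart_of_le h]
        exact ⟨homogeneousComponent_mem_invariantRing (c j).2 _,
          homogeneousComponent_isHomogeneous _ _⟩
      · exact Submodule.zero_mem _
    · have h := congrArg (homogeneousComponent (m + δ)) hc'
      rw [homogeneousComponent_mul_right hf, if_pos (by omega), Nat.add_sub_cancel_left,
        map_sum] at h
      rw [h]
      refine Finset.sum_congr rfl fun j _ => ?_
      rw [homogeneousComponent_mul_right (ha j), ite_mul, zero_mul]

end GenericBasis

end HilbertKunz

/-! ### Graded syzygies over `S` compared with graded syzygies over `R`. -/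

namespace HilbertKunz

theorem finrank_le_of_injective_of_mapsTo {k V W : Type*} [Field k] [AddCommGroup V] [Module k V]
    [AddCommGroup W] [Module k W] {p : Submodule k V} {q : Submodule k W} [FiniteDimensional k q]
    {f : V →ₗ[k] W} (hf : Function.Injective f) (h : ∀ x ∈ p, f x ∈ q) :
    Module.finrank k p ≤ Module.finrank k q :=
  LinearMap.finrank_le_finrank_of_injective (f := f.restrict h) fun _ _ hxy =>
    Subtype.ext (hf (congrArg Subtype.val hxy))

section Syzygies

/-- Multiplication by `s` in each coordinate. -/
noncomputable def scale {k ι : Type*} [Field k] (s : MvPolynomial (Fin 2) k) :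
    (ι → MvPolynomial (Fin 2) k) →ₗ[k] (ι → MvPolynomial (Fin 2) k) :=
  LinearMap.pi fun i => LinearMap.mulLeft k s ∘ₗ LinearMap.proj i

theorem scale_apply {k ι : Type*} [Field k] (s : MvPolynomial (Fin 2) k)
    (w : ι → MvPolynomial (Fin 2) k) (i : ι) : scale s w i = s * w i := rfl

theorem scale_injective {k ι : Type*} [Field k] {s : MvPolynomial (Fin 2) k} (hs : s ≠ 0) :
    Function.Injective (scale (ι := ι) s) := by
  intro v w hvw
  funext i
  have h := congrFun hvw i
  rw [scale_apply, scale_apply] at h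
  exact mul_left_cancel₀ hs h

variable {k : Type*} [Field k] {ι : Type*} [Fintype ι]

/-- The degree `m` part of the module of syzygies of the elements `h i` of degree `d i`, with
entries in the graded space `A`. -/
noncomputable def syzPart (A : ℕ → Submodule k (MvPolynomial (Fin 2) k)) (d : ι → ℕ)
    (h : ι → MvPolynomial (Fin 2) k) (m : ℕ) : Submodule k (ι → MvPolynomial (Fin 2) k) where
  carrier := {w | (∀ i, w i ∈ shiftedPart A (d i) m) ∧ ∑ i, w i * h i = 0}
  add_mem' {v w} hv hw := ⟨fun i => Submodule.add_mem _ (hv.1 i) (hw.1 i), by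
    simp only [Pi.add_apply, add_mul, Finset.sum_add_distrib, hv.2, hw.2, add_zero]⟩
  zero_mem' := ⟨fun i => Submodule.zero_mem _, by simp⟩
  smul_mem' c w hw := ⟨fun i => Submodule.smul_mem _ _ (hw.1 i), by
    simp only [Pi.smul_apply, smul_mul_assoc, ← Finset.smul_sum, hw.2, smul_zero]⟩

variable {A : ℕ → Submodule k (MvPolynomial (Fin 2) k)} {d : ι → ℕ}
  {h : ι → MvPolynomial (Fin 2) k} {m : ℕ}

theorem mem_syzPart {w : ι → MvPolynomial (Fin 2) k} :
    w ∈ syzPart A d h m ↔ (∀ i, w i ∈ shiftedPart A (d i) m) ∧ ∑ i, w i * h i = 0 := Iff.rfl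

instance [∀ m, FiniteDimensional k (A m)] : FiniteDimensional k (syzPart A d h m) := by
  let φ : syzPart A d h m →ₗ[k] (∀ i, shiftedPart A (d i) m) :=
    LinearMap.pi fun i => (LinearMap.proj i ∘ₗ (syzPart A d h m).subtype).codRestrict _
      fun w => w.2.1 i
  refine FiniteDimensional.of_injective φ fun v w hvw => Subtype.ext (funext fun i => ?_)
  exact congrArg Subtype.val (congrFun hvw i)

variable {G : Subgroup (SpecialLinearGroup (Fin 2) k)}

section Basis

variable {N : ℕ} {a : Fin N → MvPolynomial (Fin 2) k} {e : Fin N → ℕ}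
  {Δ : MvPolynomial (Fin 2) k} {δ : ℕ}

/-- The linear map `c ↦ ∑ j, a j • c j`. -/
noncomputable def combine {ι : Type*} (a : Fin N → MvPolynomial (Fin 2) k)
    (Y : Fin N → Submodule k (ι → MvPolynomial (Fin 2) k)) :
    (∀ j, Y j) →ₗ[k] (ι → MvPolynomial (Fin 2) k) where
  toFun c i := ∑ j, (c j : ι → MvPolynomial (Fin 2) k) i * a j
  map_add' c c' := funext fun i => by simp [add_mul, Finset.sum_add_distrib]
  map_smul' r c := funext fun i => by simp [Finset.smul_sum]

theorem combine_apply {ι : Type*} (Y : Fin N → Submodule k (ι → MvPolynomial (Fin 2) k))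
    (c : ∀ j, Y j) (i : ι) : combine a Y c i = ∑ j, (c j : ι → MvPolynomial (Fin 2) k) i * a j := rfl

theorem mem_invariantRing_of_mem_shiftedPart {f : MvPolynomial (Fin 2) k} {e m : ℕ}
    (hf : f ∈ shiftedPart (invPart G) e m) : f ∈ invariantRing G := by
  by_cases he : e ≤ m
  · rw [shiftedPart_of_le he] at hf
    exact hf.1
  · rw [shiftedPart_of_not_le he, Submodule.mem_bot] at hf
    rw [hf]
    exact Subalgebra.zero_mem _

theorem mem_invariantRing_of_mem_shiftedPart_syzPart {w : ι → MvPolynomial (Fin 2) k} {e m : ℕ}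
    (hw : w ∈ shiftedPart (syzPart (invPart G) d h) e m) (i : ι) : w i ∈ invariantRing G := by
  by_cases he : e ≤ m
  · rw [shiftedPart_of_le he] at hw
    exact mem_invariantRing_of_mem_shiftedPart (hw.1 i)
  · rw [shiftedPart_of_not_le he, Submodule.mem_bot] at hw
    rw [hw]
    exact Subalgebra.zero_mem _

theorem IsGenericBasis.combine_injective (hB : IsGenericBasis G a e Δ δ) (m : ℕ) :
    Function.Injective (combine a fun j => shiftedPart (syzPart (invPart G) d h) (e j) m) := by
  rw [← LinearMap.ker_eq_bot, LinearMap.ker_eq_bot']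
  intro c hc
  funext j
  refine Subtype.ext (funext fun i => ?_)
  exact hB.indep (fun j => (c j : ι → MvPolynomial (Fin 2) k) i)
    (fun j => mem_invariantRing_of_mem_shiftedPart_syzPart (c j).2 i) (congrFun hc i) j

theorem IsGenericBasis.sum_finrank (hB : IsGenericBasis G a e Δ δ) (m : ℕ) :
    ∑ j, Module.finrank k (shiftedPart (syzPart (invPart G) d h) (e j) m) =
      Module.finrank k
        (LinearMap.range (combine a fun j => shiftedPart (syzPart (invPart G) d h) (e j) m)) := by
  rw [LinearMap.finrank_range_of_inj (hB.combine_injective m), Module.finrank_pi_fintype]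

/-- Syzygies over `S`, combined with the `a j` as coefficients, are syzygies over `R`. Independence
of the basis keeps the dimensions. -/
theorem IsGenericBasis.sum_finrank_le (hB : IsGenericBasis G a e Δ δ) (m : ℕ) :
    ∑ j, Module.finrank k (shiftedPart (syzPart (invPart G) d h) (e j) m) ≤
      Module.finrank k (syzPart (homogeneousSubmodule (Fin 2) k) d h m) := by
  rw [hB.sum_finrank]
  refine Submodule.finrank_mono ?_
  rintro _ ⟨c, rfl⟩
  refine ⟨fun i => ?_, ?_⟩
  · rw [combine_apply]
    refine Submodule.sum_mem _ fun j _ => ?_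
    rcases mem_shiftedPart.mp (c j).2 with ⟨he, hc⟩ | ⟨he, hc⟩
    · have hci := hc.1 i
      by_cases hd : d i ≤ m - e j
      · rw [shiftedPart_of_le hd] at hci
        rw [shiftedPart_of_le (by omega)]
        have := hci.2.mul (hB.isHomogeneous j)
        rwa [show m - e j - d i + e j = m - d i by omega] at this
      · rw [shiftedPart_of_not_le hd, Submodule.mem_bot] at hci
        rw [hci, zero_mul]
        exact Submodule.zero_mem _
    · rw [hc, Pi.zero_apply, zero_mul]
      exact Submodule.zero_mem _
  · simp only [combine_apply, Finset.sum_mul]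
    rw [Finset.sum_comm]
    refine Finset.sum_eq_zero fun j _ => ?_
    have h0 : ∑ i, (c j : ι → MvPolynomial (Fin 2) k) i * h i = 0 := by
      rcases mem_shiftedPart.mp (c j).2 with ⟨he, hc⟩ | ⟨he, hc⟩
      · exact hc.2
      · simp [hc]
    simp only [mul_right_comm _ (a j), ← Finset.sum_mul, h0, zero_mul]

/-- Multiply a syzygy over `R` by `Δ` and expand its entries in the basis. The coefficients and the
`h i` are invariant, so independence splits the relation into one syzygy over `S` for each `a j`.
The loss `δ` in degree depends neither on `h` nor on `d`. -/
theorem IsGenericBasis.finrank_le_sum (hB : IsGenericBasis G a e Δ δ)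
    (hh : ∀ i, h i ∈ invariantRing G) (m : ℕ) :
    Module.finrank k (syzPart (homogeneousSubmodule (Fin 2) k) d h m) ≤
      ∑ j, Module.finrank k (shiftedPart (syzPart (invPart G) d h) (e j) (m + δ)) := by
  rw [hB.sum_finrank]
  refine finrank_le_of_injective_of_mapsTo (scale_injective hB.ne_zero) fun w hw => ?_
  -- `exists_eq` yields a shift by `e j` of the degree `m - d i + δ`, whereas the goal shifts by `e
  -- j` first and by `d i` second. As subtraction truncates, the exchange is made by cases.
  have key : ∀ i, ∃ c : Fin N → MvPolynomial (Fin 2) k,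
      (∀ j, c j ∈ invariantRing G) ∧
      (∀ j, e j ≤ m + δ → c j ∈ shiftedPart (invPart G) (d i) (m + δ - e j)) ∧
      (∀ j, ¬ e j ≤ m + δ → c j = 0) ∧ Δ * w i = ∑ j, c j * a j := by
    intro i
    have hi := hw.1 i
    by_cases hd : d i ≤ m
    · rw [shiftedPart_of_le hd] at hi
      obtain ⟨c, hc, hcs⟩ := hB.exists_eq _ _ hi
      refine ⟨c, fun j => mem_invariantRing_of_mem_shiftedPart (hc j), fun j hj => ?_,
        fun j hj => ?_, hcs⟩
      · have := hc j
        by_cases hdj : d i ≤ m + δ - e j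
        · rw [shiftedPart_of_le hdj]
          rwa [shiftedPart_of_le (by omega),
            show m - d i + δ - e j = m + δ - e j - d i by omega] at this
        · rw [shiftedPart_of_not_le (by omega), Submodule.mem_bot] at this
          rw [this]
          exact Submodule.zero_mem _
      · have := hc j
        rwa [shiftedPart_of_not_le (by omega), Submodule.mem_bot] at this
    · rw [shiftedPart_of_not_le hd, Submodule.mem_bot] at hi
      exact ⟨0, fun j => Subalgebra.zero_mem _, fun j _ => Submodule.zero_mem _, fun _ _ => rfl,
        by simp [hi]⟩
  choose c hcS hc hc0 hcs using key
  have hrel : ∀ j, ∑ i, c i j * h i = 0 := by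
    refine hB.indep (fun j => ∑ i, c i j * h i)
      (fun j => Subalgebra.sum_mem _ fun i _ => Subalgebra.mul_mem _ (hcS i j) (hh i)) ?_
    simp only [Finset.sum_mul]
    rw [Finset.sum_comm]
    have : ∀ i, ∑ j, c i j * h i * a j = Δ * (w i * h i) := fun i => by
      rw [← mul_assoc, hcs, Finset.sum_mul]
      exact Finset.sum_congr rfl fun j _ => mul_right_comm _ _ _
    simp only [this, ← Finset.mul_sum, hw.2, mul_zero]
  refine LinearMap.mem_range.mpr ⟨fun j => ⟨fun i => c i j, ?_⟩, funext fun i => ?_⟩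
  swap
  · rw [combine_apply, scale_apply, hcs]
  by_cases hj : e j ≤ m + δ
  · rw [shiftedPart_of_le hj]
    exact ⟨fun i => hc i j hj, hrel j⟩
  · rw [shiftedPart_of_not_le hj, Submodule.mem_bot]
    exact funext fun i => hc0 i j hj

end Basis

/-- Multiplication by a non-zero invariant is injective, so the dimensions cannot decrease between
degrees that differ by the degree of an invariant. -/
theorem finrank_syzPart_le_add {s : MvPolynomial (Fin 2) k} {e : ℕ} (hs : s ∈ invPart G e)
    (hs0 : s ≠ 0) (m : ℕ) :
    Module.finrank k (syzPart (invPart G) d h m) ≤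
      Module.finrank k (syzPart (invPart G) d h (m + e)) := by
  refine finrank_le_of_injective_of_mapsTo (scale_injective hs0) fun w hw => ?_
  refine mem_syzPart.mpr ⟨fun i => ?_, ?_⟩
  · have hi := hw.1 i
    rw [scale_apply]
    by_cases hd : d i ≤ m
    · rw [shiftedPart_of_le hd] at hi
      rw [shiftedPart_of_le (by omega)]
      refine ⟨Subalgebra.mul_mem _ hs.1 hi.1, ?_⟩
      have := hs.2.mul hi.2
      rwa [show e + (m - d i) = m + e - d i by omega] at this
    · rw [shiftedPart_of_not_le hd, Submodule.mem_bot] at hi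
      rw [hi, mul_zero]
      exact Submodule.zero_mem _
  · simp only [scale_apply, mul_assoc, ← Finset.mul_sum, hw.2, mul_zero]

theorem syzPart_eq_bot {n : ℕ} (hn : ∀ m, invPart G m ≠ ⊥ → n ∣ m) (hd : ∀ i, n ∣ d i)
    (hm : ¬ n ∣ m) : syzPart (invPart G) d h m = ⊥ := by
  rw [eq_bot_iff]
  intro w hw
  rw [Submodule.mem_bot]
  funext i
  have hi := hw.1 i
  by_cases hdm : d i ≤ m
  · rw [shiftedPart_of_le hdm] at hi
    have h0 : invPart G (m - d i) = ⊥ := by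
      by_contra hne
      have := Nat.dvd_add (hn _ hne) (hd i)
      rw [Nat.sub_add_cancel hdm] at this
      exact hm this
    rwa [h0, Submodule.mem_bot] at hi
  · rwa [shiftedPart_of_not_le hdm, Submodule.mem_bot] at hi

end Syzygies

end HilbertKunz

namespace HilbertKunz

/-! ### The comparison in blocks of `n` consecutive degrees. -/

section BlockBounds

variable {k : Type*} [Field k] {G : Subgroup (SpecialLinearGroup (Fin 2) k)}

/-- In a block of `n` consecutive degrees each basis element `a j` meets exactly one degree `≡ e j`
mod `n`, and only there does its shifted copy of the syzygies over `S` contribute. Thus a block over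
`R` amounts to `|G|` copies of one graded piece over `S`, and monotonicity replaces the various
shifts `e j` and `δ` by a single `C`. The constant is chosen before `ι`, `d` and `h`: it can
therefore be used for all `q`-th powers at once. -/
theorem exists_block_bounds [Finite G] {n : ℕ} (hn : 0 < n)
    (hdvd : ∀ m, invPart G m ≠ ⊥ → n ∣ m) (hex : ∃ T, ∀ t ≥ T, invPart G (n * t) ≠ ⊥) :
    ∃ C : ℕ, ∀ (ι : Type) [Fintype ι] (d : ι → ℕ) (h : ι → MvPolynomial (Fin 2) k),
      (∀ i, h i ∈ invariantRing G) → (∀ i, n ∣ d i) → ∀ t : ℕ,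
      Nat.card G * Module.finrank k (syzPart (invPart G) d h (n * t)) ≤
        ∑ r ∈ Finset.range n,
          Module.finrank k (syzPart (homogeneousSubmodule (Fin 2) k) d h (n * (t + C) + r)) ∧
      ∑ r ∈ Finset.range n,
          Module.finrank k (syzPart (homogeneousSubmodule (Fin 2) k) d h (n * t + r)) ≤
        Nat.card G * Module.finrank k (syzPart (invPart G) d h (n * (t + C))) := by
  obtain ⟨T, hT⟩ := hex
  obtain ⟨a, e, Δ, δ, hB⟩ := exists_isGenericBasis (G := G)
  obtain ⟨δ', rfl⟩ := hdvd δ fun h0 => hB.ne_zero (by simpa [h0] using hB.mem)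
  -- `δ'` absorbs the denominator, `∑ j, e j` any shift by `e j / n`, and `T` leaves a gap in which
  -- `hmono` finds an invariant.
  refine ⟨T + δ' + ∑ j, e j, fun ι _ d h hh hd t => ?_⟩
  have hmono : ∀ t t', t + T ≤ t' → Module.finrank k (syzPart (invPart G) d h (n * t)) ≤
      Module.finrank k (syzPart (invPart G) d h (n * t')) := by
    intro t t' htt
    obtain ⟨s, hs, hs0⟩ := Submodule.exists_mem_ne_zero_of_ne_bot (hT (t' - t) (by omega))
    have := finrank_syzPart_le_add (d := d) (h := h) hs hs0 (n * t)
    rwa [← mul_add, show t + (t' - t) = t' by omega] at this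
  have hcard : ∀ x : ℕ, Nat.card G * x = ∑ _j : Fin (Nat.card G), x := fun x => by simp
  have hej : ∀ j, e j / n ≤ ∑ j, e j := fun j => (Nat.div_le_self _ _).trans
    (Finset.single_le_sum (f := e) (fun _ _ => Nat.zero_le _) (Finset.mem_univ j))
  constructor
  · rw [hcard]
    calc _ ≤ ∑ j, ∑ r ∈ Finset.range n, Module.finrank k (shiftedPart (syzPart (invPart G) d h)
          (e j) (n * (t + (T + δ' + ∑ j, e j)) + r)) := by
          refine Finset.sum_le_sum fun j _ => ?_
          -- Only the residue of `e j` is kept from the block.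
          refine le_trans ?_ (Finset.single_le_sum (fun _ _ => Nat.zero_le _)
            (Finset.mem_range.mpr (Nat.mod_lt (e j) hn)))
          have h1 : n * (t + (T + δ' + ∑ j, e j)) + e j % n =
              n * (t + (T + δ' + ∑ j, e j) - e j / n) + e j := by
            have h2 := Nat.mod_add_div (e j) n
            rw [Nat.mul_sub]
            have h3 : n * (e j / n) ≤ n * (t + (T + δ' + ∑ j, e j)) :=
              Nat.mul_le_mul_left _ ((hej j).trans (by omega))
            omega
          rw [h1, shiftedPart_of_le (Nat.le_add_left _ _), Nat.add_sub_cancel]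
          have := hej j
          exact hmono _ _ (by omega)
      _ ≤ _ := by
          rw [Finset.sum_comm]
          exact Finset.sum_le_sum fun r _ => hB.sum_finrank_le _
  · rw [hcard]
    calc _ ≤ ∑ j, ∑ r ∈ Finset.range n, Module.finrank k (shiftedPart (syzPart (invPart G) d h)
          (e j) (n * t + r + n * δ')) := by
          rw [Finset.sum_comm]
          exact Finset.sum_le_sum fun r _ => hB.finrank_le_sum hh _
      _ ≤ _ := by
          refine Finset.sum_le_sum fun j _ => ?_
          -- For the other residues the degree left after the shift by `e j` is not a multiple of
          -- `n`, and the piece is zero.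
          rw [Finset.sum_eq_single (e j % n)]
          · by_cases hle : e j ≤ n * t + e j % n + n * δ'
            · rw [shiftedPart_of_le hle]
              have h1 : n * t + e j % n + n * δ' - e j = n * (t + δ' - e j / n) := by
                have h2 := Nat.mod_add_div (e j) n
                rw [Nat.mul_sub, Nat.mul_add]
                omega
              rw [h1]
              exact hmono _ _ (by generalize e j / n = z; omega)
            · rw [shiftedPart_of_not_le hle, finrank_bot]
              exact Nat.zero_le _
          · intro r hr hrj
            by_cases hle : e j ≤ n * t + r + n * δ'
            · rw [shiftedPart_of_le hle, syzPart_eq_bot hdvd hd, finrank_bot]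
              intro hdv
              apply hrj
              have h1 : n ∣ (n * t + n * δ') := Dvd.dvd.add ⟨_, rfl⟩ ⟨_, rfl⟩
              have h2 : n * t + r + n * δ' ≡ e j [MOD n] :=
                ((Nat.modEq_iff_dvd' hle).mpr hdv).symm
              have h3 : n * t + r + n * δ' ≡ r [MOD n] := by
                have : n * t + r + n * δ' = r + n * (t + δ') := by ring
                rw [this, Nat.ModEq, Nat.add_mul_mod_self_left]
              have h4 : r % n = e j % n := h3.symm.trans h2
              rwa [Nat.mod_eq_of_lt (Finset.mem_range.mp hr)] at h4
            · rw [shiftedPart_of_not_le hle, finrank_bot]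
          · intro hr
            exact absurd (Finset.mem_range.mpr (Nat.mod_lt (e j) hn)) hr

end BlockBounds

/-! ### Dimensions of the graded syzygies over `R`. -/

section Dimensions

variable {k : Type*} [Field k]

theorem finrank_shiftedPart_homogeneousSubmodule (e m : ℕ) :
    Module.finrank k (shiftedPart (homogeneousSubmodule (Fin 2) k) e m) = m + 1 - e := by
  by_cases h : e ≤ m
  · rw [shiftedPart_of_le h, finrank_homogeneousSubmodule]
    omega
  · rw [shiftedPart_of_not_le h, finrank_bot]
    omega

/-- The syzygies of a single generator `0` in degree `0` are all of `A`. In this way the block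
bounds also compare the Hilbert functions of `S` and `R`. -/
theorem finrank_syzPart_zero (A : ℕ → Submodule k (MvPolynomial (Fin 2) k))
    [∀ m, FiniteDimensional k (A m)] (m : ℕ) :
    Module.finrank k (syzPart A (fun _ : Unit => 0) (fun _ => 0) m) = Module.finrank k (A m) := by
  apply le_antisymm
  · refine finrank_le_of_injective_of_mapsTo (f := LinearMap.proj ()) (fun v w h => funext fun _ => h)
      fun w hw => ?_
    have := hw.1 ()
    rwa [shiftedPart_of_le (Nat.zero_le _)] at this
  · refine finrank_le_of_injective_of_mapsTo (f := LinearMap.pi fun _ => LinearMap.id)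
      (fun v w h => congrFun h ()) fun f hf => mem_syzPart.mpr ⟨fun i => ?_, by simp⟩
    rwa [shiftedPart_of_le (Nat.zero_le _)]

variable {a b h : Fin 3 → MvPolynomial (Fin 2) k} {d : Fin 3 → ℕ} {l : ℕ}

/-- The dimensions of the graded parts of the module of syzygies of the maximal minors of a
`2 × 3` matrix. -/
theorem finrank_syzPart_minors
    (h0 : h 0 = a 1 * b 2 - a 2 * b 1) (h1 : h 1 = a 2 * b 0 - a 0 * b 2)
    (h2 : h 2 = a 0 * b 1 - a 1 * b 0) {i j : Fin 3} (hi : h i ≠ 0) (hij : IsRelPrime (h i) (h j))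
    (hd : ∀ i, d i ≤ l) (ha : ∀ i, (a i).IsHomogeneous (l - d i))
    (hb : ∀ i, (b i).IsHomogeneous (l - d i)) (m : ℕ) :
    Module.finrank k (syzPart (homogeneousSubmodule (Fin 2) k) d h m) = 2 * (m + 1 - l) := by
  let L := shiftedPart (homogeneousSubmodule (Fin 2) k) l m
  let φ : (L × L) →ₗ[k] (Fin 3 → MvPolynomial (Fin 2) k) :=
    { toFun := fun z i => (z.1 : MvPolynomial (Fin 2) k) * a i + z.2 * b i
      map_add' := fun z z' => funext fun i => by simp; ring
      map_smul' := fun r z => funext fun i => by simp }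
  have hφ : ∀ z i, φ z i = (z.1 : MvPolynomial (Fin 2) k) * a i + z.2 * b i := fun _ _ => rfl
  have hinj : Function.Injective φ := by
    rw [← LinearMap.ker_eq_bot, LinearMap.ker_eq_bot']
    intro z hz
    have := eq_zero_of_combination_eq_zero h0 h1 h2 hi (fun i => congrFun hz i)
    exact Prod.ext (Subtype.ext this.1) (Subtype.ext this.2)
  have hrange : LinearMap.range φ = syzPart (homogeneousSubmodule (Fin 2) k) d h m := by
    apply le_antisymm
    · rintro _ ⟨z, rfl⟩
      refine mem_syzPart.mpr ⟨fun i => ?_, ?_⟩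
      · rw [hφ]
        have key : ∀ c : MvPolynomial (Fin 2) k, c.IsHomogeneous (l - d i) → ∀ f ∈ L,
            f * c ∈ shiftedPart (homogeneousSubmodule (Fin 2) k) (d i) m := by
          intro c hc f hf
          have hdi := hd i
          rcases mem_shiftedPart.mp hf with ⟨hlm, hf⟩ | ⟨hlm, hf⟩
          · rw [shiftedPart_of_le (by omega)]
            have := IsHomogeneous.mul hf hc
            rwa [show m - l + (l - d i) = m - d i by omega] at this
          · rw [hf, zero_mul]
            exact Submodule.zero_mem _
        exact Submodule.add_mem _ (key _ (ha i) _ z.1.2) (key _ (hb i) _ z.2.2)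
      · rw [Fin.sum_univ_three, hφ, hφ, hφ, h0, h1, h2]
        ring
    · intro w hw
      obtain ⟨x, y, hxy⟩ := exists_combination_of_dotProduct_eq_zero h0 h1 h2 hi hij hw.2
      -- The coefficients `x`, `y` need not be homogeneous. Their components of degree `m - l`
      -- suffice to produce `w`, and none is needed if `m < l`.
      have key : ∀ f : MvPolynomial (Fin 2) k,
          (if l ≤ m then homogeneousComponent (m - l) f else 0) ∈ L := by
        intro f
        refine mem_shiftedPart.mpr ?_
        by_cases hlm : l ≤ m
        · rw [if_pos hlm]
          exact Or.inl ⟨hlm, homogeneousComponent_isHomogeneous _ _⟩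
        · rw [if_neg hlm]
          exact Or.inr ⟨hlm, rfl⟩
      refine LinearMap.mem_range.mpr ⟨(⟨_, key x⟩, ⟨_, key y⟩), funext fun i => ?_⟩
      rw [hφ]
      dsimp only
      have hdi := hd i
      rcases mem_shiftedPart.mp (hw.1 i) with ⟨hdm, hwi⟩ | ⟨hdm, hwi⟩
      · have h4 := homogeneousComponent_of_mem (m := m - d i) hwi
        rw [if_pos rfl] at h4
        rw [← h4, hxy]
        dsimp only
        rw [map_add, homogeneousComponent_mul_right (ha i), homogeneousComponent_mul_right (hb i)]
        by_cases hlm : l ≤ m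
        · rw [if_pos hlm, if_pos hlm, if_pos (by omega), if_pos (by omega),
            show m - d i - (l - d i) = m - l by omega]
        · rw [if_neg hlm, if_neg hlm, if_neg (by omega), if_neg (by omega)]
          simp
      · rw [hwi, if_neg (by omega), if_neg (by omega)]
        simp
  rw [← hrange, LinearMap.finrank_range_of_inj hinj, Module.finrank_prod,
    finrank_shiftedPart_homogeneousSubmodule]
  ring

end Dimensions

end HilbertKunz

namespace HilbertKunz

/-! ### Matrices whose minors are the generators, their Frobenius powers and the Hilbert–Burch
resolution. -/

section Minors

variable {k : Type*} [Field k]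

/-- `h` is the vector of the maximal minors of the homogeneous `2 × 3` matrix with rows `a`, `b`,
two of these minors have no common factor, and the degrees of the `h i` are `d i`. -/
structure IsMinors (a b h : Fin 3 → MvPolynomial (Fin 2) k) (d : Fin 3 → ℕ) (l : ℕ) : Prop where
  eq_zero : h 0 = a 1 * b 2 - a 2 * b 1
  eq_one : h 1 = a 2 * b 0 - a 0 * b 2
  eq_two : h 2 = a 0 * b 1 - a 1 * b 0
  ne_zero : ∀ i, h i ≠ 0
  isRelPrime : ∃ i j, IsRelPrime (h i) (h j)
  pos : ∀ i, 0 < d i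
  lt : ∀ i, d i < l
  sum_eq : d 0 + d 1 + d 2 = 2 * l
  homogeneous : ∀ i, (h i).IsHomogeneous (d i)
  homogeneous_left : ∀ i, (a i).IsHomogeneous (l - d i)
  homogeneous_right : ∀ i, (b i).IsHomogeneous (l - d i)

variable {a b h : Fin 3 → MvPolynomial (Fin 2) k} {d : Fin 3 → ℕ} {l : ℕ}

/-- The `q`-th power map is a ring homomorphism, so it commutes with taking minors, and coprimality
passes to powers. This takes the place of the flatness of Frobenius. -/
theorem IsMinors.pow (H : IsMinors a b h d l) (p n : ℕ) [Fact p.Prime] [CharP k p] :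
    IsMinors (fun i => a i ^ p ^ n) (fun i => b i ^ p ^ n) (fun i => h i ^ p ^ n)
      (fun i => d i * p ^ n) (l * p ^ n) where
  eq_zero := by simp only [H.eq_zero, sub_pow_char_pow, mul_pow]
  eq_one := by simp only [H.eq_one, sub_pow_char_pow, mul_pow]
  eq_two := by simp only [H.eq_two, sub_pow_char_pow, mul_pow]
  ne_zero i := pow_ne_zero _ (H.ne_zero i)
  isRelPrime := by
    obtain ⟨i, j, hij⟩ := H.isRelPrime
    exact ⟨i, j, hij.pow⟩
  pos i := Nat.mul_pos (H.pos i) (pow_pos (Fact.out : p.Prime).pos _)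
  lt i := Nat.mul_lt_mul_of_pos_right (H.lt i) (pow_pos (Fact.out : p.Prime).pos _)
  sum_eq := by rw [← add_mul, ← add_mul, H.sum_eq, mul_assoc]
  homogeneous i := (H.homogeneous i).pow _
  homogeneous_left i := by rw [← Nat.sub_mul]; exact (H.homogeneous_left i).pow _
  homogeneous_right i := by rw [← Nat.sub_mul]; exact (H.homogeneous_right i).pow _

theorem IsMinors.subst (H : IsMinors a b h d l) (P : GL (Fin 2) k) :
    IsMinors (fun i => HilbertKunz.subst P.val (a i)) (fun i => HilbertKunz.subst P.val (b i))
      (fun i => HilbertKunz.subst P.val (h i)) d l where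
  eq_zero := by rw [H.eq_zero, map_sub, map_mul, map_mul]
  eq_one := by rw [H.eq_one, map_sub, map_mul, map_mul]
  eq_two := by rw [H.eq_two, map_sub, map_mul, map_mul]
  ne_zero i := (map_ne_zero_iff (substEquiv P) (substEquiv P).injective).mpr (H.ne_zero i)
  isRelPrime := by
    obtain ⟨i, j, hij⟩ := H.isRelPrime
    refine ⟨i, j, fun c hci hcj => ?_⟩
    have hc := map_dvd (substEquiv P).symm hci
    have hc' := map_dvd (substEquiv P).symm hcj
    rw [← substEquiv_apply, AlgEquiv.symm_apply_apply] at hc hc'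
    have := (hij hc hc').map (substEquiv P)
    rwa [AlgEquiv.apply_symm_apply] at this
  pos := H.pos
  lt := H.lt
  sum_eq := H.sum_eq
  homogeneous i := subst_isHomogeneous _ (H.homogeneous i)
  homogeneous_left i := subst_isHomogeneous _ (H.homogeneous_left i)
  homogeneous_right i := subst_isHomogeneous _ (H.homogeneous_right i)

theorem IsMinors.isHilbertBurchResolution (H : IsMinors a b h d l) :
    IsHilbertBurchResolution h d l !![a 0, a 1, a 2; b 0, b 1, b 2] where
  isHomogeneous_gen := H.homogeneous
  degree_lt := H.lt
  isHomogeneous_entry j i := by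
    have ha := H.homogeneous_left
    have hb := H.homogeneous_right
    fin_cases j <;> fin_cases i
    · exact ha 0
    · exact ha 1
    · exact ha 2
    · exact hb 0
    · exact hb 1
    · exact hb 2
  injective := by
    intro v w hvw
    have h1 : ∀ i, (v 0 - w 0) * a i + (v 1 - w 1) * b i = 0 := by
      intro i
      have := congrFun hvw i
      fin_cases i <;> simp [Matrix.vecMul, dotProduct, Fin.sum_univ_two] at this ⊢ <;>
        linear_combination this
    have h2 := eq_zero_of_combination_eq_zero H.eq_zero H.eq_one H.eq_two (H.ne_zero 0) h1
    funext i
    fin_cases i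
    · exact sub_eq_zero.mp h2.1
    · exact sub_eq_zero.mp h2.2
  exact := by
    obtain ⟨i, j, hij⟩ := H.isRelPrime
    intro w
    constructor
    · intro hw
      obtain ⟨x, y, rfl⟩ := exists_combination_of_dotProduct_eq_zero H.eq_zero H.eq_one H.eq_two
        (H.ne_zero i) hij hw
      refine ⟨![x, y], funext fun i => ?_⟩
      fin_cases i <;> simp [Matrix.vecMul, dotProduct, Fin.sum_univ_two]
    · rintro ⟨v, rfl⟩
      simp only [dotProduct_fin_three, H.eq_zero, H.eq_one, H.eq_two]
      simp [Matrix.vecMul, dotProduct, Fin.sum_univ_two]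
      ring
  minors := by
    apply le_antisymm
    · rw [Ideal.span_le]
      rintro _ ⟨s, rfl⟩
      have hm : ∀ i, h i ∈ Ideal.span (Set.range h) := fun i => Ideal.subset_span ⟨i, rfl⟩
      have hm0 := hm 0
      have hm1 := hm 1
      have hm2 := hm 2
      rw [H.eq_zero] at hm0
      rw [H.eq_one] at hm1
      rw [H.eq_two] at hm2
      -- A map `s` may repeat or reverse columns: the minor is then `0` or changes its sign.
      have key : ∀ i j, (!![a 0, a 1, a 2; b 0, b 1, b 2] : Matrix _ _ _) 0 i *
          (!![a 0, a 1, a 2; b 0, b 1, b 2] : Matrix _ _ _) 1 j -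
          (!![a 0, a 1, a 2; b 0, b 1, b 2] : Matrix _ _ _) 0 j *
          (!![a 0, a 1, a 2; b 0, b 1, b 2] : Matrix _ _ _) 1 i ∈ Ideal.span (Set.range h) := by
        intro i j
        fin_cases i <;> fin_cases j <;>
          simp only [Fin.zero_eta, Fin.mk_one, Fin.reduceFinMk, Matrix.of_apply, Matrix.cons_val',
            Matrix.cons_val_zero, Matrix.cons_val_one, Matrix.cons_val, sub_self,
            Submodule.zero_mem] <;>
          first
          | exact hm2
          | exact hm0
          | exact hm1
          | (rw [← neg_mem_iff, neg_sub]; first | exact hm2 | exact hm0 | exact hm1)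
      change Matrix.det _ ∈ Ideal.span (Set.range h)
      rw [Matrix.det_fin_two]
      simpa [mul_comm] using key (s 0) (s 1)
    · rw [Ideal.span_le]
      rintro _ ⟨i, rfl⟩
      have key : ∀ x y : Fin 3, h i = (!![a 0, a 1, a 2; b 0, b 1, b 2].submatrix id
          (![x, y] : Fin 2 → Fin 3)).det → h i ∈ Ideal.span (Set.range fun s : Fin 2 → Fin 3 =>
          (!![a 0, a 1, a 2; b 0, b 1, b 2].submatrix id s).det) :=
        fun x y hxy => Ideal.subset_span ⟨![x, y], hxy.symm⟩
      fin_cases i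
      · exact key 1 2 (by simp [Matrix.det_fin_two, H.eq_zero])
      -- The column order `2, 0` gives the sign in `eq_one`.
      · exact key 2 0 (by simp [Matrix.det_fin_two, H.eq_one])
      · exact key 0 1 (by simp [Matrix.det_fin_two, H.eq_two])

end Minors

/-! ### Frobenius powers of ideals and graded lengths of quotients of `S`. -/

section Ideals

variable {k : Type*} [Field k]

/-- In characteristic `p` the map `a ↦ a ^ q` is additive, so the powers of the generators suffice.
-/
theorem frobPower_span {A : Type*} [CommRing A] {ι : Type*} (g : ι → A) (p n : ℕ)
    [Fact p.Prime] [CharP A p] :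
    frobPower (Ideal.span (Set.range g)) (p ^ n) = Ideal.span (Set.range fun i => g i ^ p ^ n) := by
  unfold frobPower
  apply le_antisymm
  · rw [Ideal.span_le]
    rintro _ ⟨x, hx, rfl⟩
    dsimp only
    rw [SetLike.mem_coe] at hx ⊢
    induction hx using Submodule.span_induction with
    | mem x hx =>
      obtain ⟨i, rfl⟩ := hx
      exact Ideal.subset_span ⟨i, rfl⟩
    | zero =>
      rw [zero_pow (pow_ne_zero _ (Fact.out : p.Prime).ne_zero)]
      exact Submodule.zero_mem _
    | add x y _ _ hx hy =>
      rw [add_pow_char_pow]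
      exact Submodule.add_mem _ hx hy
    | smul c x _ hx =>
      rw [smul_eq_mul, mul_pow]
      exact Ideal.mul_mem_left _ _ hx
  · rw [Ideal.span_le]
    rintro _ ⟨i, rfl⟩
    exact Ideal.subset_span ⟨g i, Ideal.subset_span ⟨i, rfl⟩, rfl⟩

variable {G : Subgroup (SpecialLinearGroup (Fin 2) k)}

theorem map_val_invGrading (m : ℕ) :
    (invGrading G m).map (invariantRing G).val.toLinearMap = invPart G m := by
  ext f
  constructor
  · rintro ⟨g, hg, rfl⟩
    exact ⟨g.2, hg⟩
  · rintro ⟨hf, hfm⟩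
    exact ⟨⟨f, hf⟩, hfm, rfl⟩

theorem val_injective : Function.Injective (invariantRing G).val.toLinearMap :=
  Subtype.val_injective

theorem finrank_map_val (V : Submodule k (invariantRing G)) :
    Module.finrank k (V.map (invariantRing G).val.toLinearMap) = Module.finrank k V :=
  (LinearEquiv.finrank_eq (Submodule.equivMapOfInjective _ val_injective V)).symm

theorem invGrading_eq_bot_iff {m : ℕ} : invGrading G m = ⊥ ↔ invPart G m = ⊥ := by
  rw [← map_val_invGrading]
  constructor
  · intro h
    rw [h, Submodule.map_bot]
  · intro h
    exact Submodule.map_injective_of_injective val_injective (by rw [h, Submodule.map_bot])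

instance (m : ℕ) : FiniteDimensional k (invGrading G m) :=
  Module.Finite.of_injective
    ((LinearEquiv.ofEq _ _ (map_val_invGrading (G := G) m)).toLinearMap ∘ₗ
      (Submodule.equivMapOfInjective _ val_injective (invGrading G m)).toLinearMap)
    ((LinearEquiv.ofEq _ _ (map_val_invGrading (G := G) m)).injective.comp
      (Submodule.equivMapOfInjective _ val_injective (invGrading G m)).injective)

theorem gradedLength_add_finrank (J : Ideal (invariantRing G)) (m : ℕ) :
    gradedLength (invGrading G) J m +
      Module.finrank k (J.restrictScalars k ⊓ invGrading G m : Submodule k (invariantRing G)) =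
      Module.finrank k (invPart G m) := by
  have h := LinearMap.finrank_range_add_finrank_ker (K := k) (V := invGrading G m)
    (V₂ := invariantRing G ⧸ J) ((Ideal.Quotient.mkₐ k J).toLinearMap.domRestrict (invGrading G m))
  rw [LinearMap.range_domRestrict] at h
  rw [← map_val_invGrading, finrank_map_val, ← h, gradedLength]
  congr 1
  have h2 := LinearEquiv.finrank_eq (Submodule.equivMapOfInjective (invGrading G m).subtype
    (invGrading G m).subtype_injective
    (LinearMap.ker ((Ideal.Quotient.mkₐ k J).toLinearMap.domRestrict (invGrading G m))))
  have hmap : (LinearMap.ker ((Ideal.Quotient.mkₐ k J).toLinearMap.domRestrict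
      (invGrading G m))).map (invGrading G m).subtype =
      J.restrictScalars k ⊓ invGrading G m := by
    ext f
    constructor
    · rintro ⟨f, hf, rfl⟩
      exact ⟨Ideal.Quotient.eq_zero_iff_mem.mp hf, f.2⟩
    · rintro ⟨hf, hfm⟩
      exact ⟨⟨f, hfm⟩, Ideal.Quotient.eq_zero_iff_mem.mpr hf, rfl⟩
  rw [h2, hmap]

/-- The Euler characteristic in degree `m` of `0 → Syz → ⨁ S(-dᵢ) → S → S/J → 0`, arranged without
subtraction of natural numbers. -/
theorem gradedLength_span_add (g : Fin 3 → invariantRing G) {d : Fin 3 → ℕ}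
    (hg : ∀ i, g i ∈ invGrading G (d i)) (m : ℕ) :
    gradedLength (invGrading G) (Ideal.span (Set.range g)) m +
        ∑ i, Module.finrank k (shiftedPart (invPart G) (d i) m) =
      Module.finrank k (invPart G m) +
        Module.finrank k (syzPart (invPart G) d (fun i => (g i : MvPolynomial (Fin 2) k)) m) := by
  let θ : (∀ i, shiftedPart (invPart G) (d i) m) →ₗ[k] MvPolynomial (Fin 2) k :=
    { toFun := fun w => ∑ i, (w i : MvPolynomial (Fin 2) k) * g i
      map_add' := fun v w => by simp [add_mul, Finset.sum_add_distrib]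
      map_smul' := fun c w => by simp [Finset.smul_sum] }
  have hθ : ∀ w, θ w = ∑ i, (w i : MvPolynomial (Fin 2) k) * g i := fun _ => rfl
  have h1 := LinearMap.finrank_range_add_finrank_ker θ
  rw [Module.finrank_pi_fintype] at h1
  have hker : Module.finrank k (LinearMap.ker θ) =
      Module.finrank k (syzPart (invPart G) d (fun i => (g i : MvPolynomial (Fin 2) k)) m) := by
    let ψ : (∀ i, shiftedPart (invPart G) (d i) m) →ₗ[k] (Fin 3 → MvPolynomial (Fin 2) k) :=
      LinearMap.pi fun i => (shiftedPart (invPart G) (d i) m).subtype ∘ₗ LinearMap.proj i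
    have hψ : ∀ w i, ψ w i = w i := fun _ _ => rfl
    have hinj : Function.Injective ψ := fun v w h => funext fun i => Subtype.ext (congrFun h i)
    have hmap : (LinearMap.ker θ).map ψ =
        syzPart (invPart G) d (fun i => (g i : MvPolynomial (Fin 2) k)) m := by
      ext w
      constructor
      · rintro ⟨w, hw, rfl⟩
        exact mem_syzPart.mpr ⟨fun i => (w i).2, hw⟩
      · intro hw
        exact ⟨fun i => ⟨w i, hw.1 i⟩, hw.2, rfl⟩
    rw [LinearEquiv.finrank_eq (Submodule.equivMapOfInjective ψ hinj (LinearMap.ker θ)), hmap]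
  have hrange : Module.finrank k (LinearMap.range θ) = Module.finrank k
      ((Ideal.span (Set.range g)).restrictScalars k ⊓ invGrading G m :
        Submodule k (invariantRing G)) := by
    have hmap : LinearMap.range θ = ((Ideal.span (Set.range g)).restrictScalars k ⊓
        invGrading G m).map (invariantRing G).val.toLinearMap := by
      ext f
      constructor
      · rintro ⟨w, rfl⟩
        let v : Fin 3 → invariantRing G :=
          fun i => ⟨w i, mem_invariantRing_of_mem_shiftedPart (w i).2⟩
        have hv : θ w = ((∑ i, v i * g i : invariantRing G) : MvPolynomial (Fin 2) k) := by
          rw [hθ]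
          simp [v]
        refine ⟨∑ i, v i * g i, ⟨?_, ?_⟩, hv.symm⟩
        · exact Submodule.sum_mem _ fun i _ => Ideal.mul_mem_left _ _ (Ideal.subset_span ⟨i, rfl⟩)
        · refine Submodule.sum_mem _ fun i _ => ?_
          rw [mem_invGrading]
          change ((w i : MvPolynomial (Fin 2) k) * g i).IsHomogeneous m
          rcases mem_shiftedPart.mp (w i).2 with ⟨hd, hw⟩ | ⟨hd, hw⟩
          · have := hw.2.mul (hg i)
            rwa [Nat.sub_add_cancel hd] at this
          · rw [hw, zero_mul]
            exact isHomogeneous_zero _ _ _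
      · rintro ⟨f, ⟨hfJ, hfm⟩, rfl⟩
        obtain ⟨c, hc⟩ := (Submodule.mem_span_range_iff_exists_fun _).mp hfJ
        -- As `f` and the `g i` are homogeneous, the coefficients can be cut down to degree `m - d
        -- i`.
        refine ⟨fun i => ⟨if d i ≤ m then
          homogeneousComponent (m - d i) (c i : MvPolynomial (Fin 2) k) else 0, ?_⟩, ?_⟩
        · refine mem_shiftedPart.mpr ?_
          by_cases hd : d i ≤ m
          · rw [if_pos hd]
            exact Or.inl ⟨hd, homogeneousComponent_mem_invariantRing (c i).2 _,
              homogeneousComponent_isHomogeneous _ _⟩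
          · rw [if_neg hd]
            exact Or.inr ⟨hd, rfl⟩
        · rw [hθ]
          change _ = (f : MvPolynomial (Fin 2) k)
          have h2 : (f : MvPolynomial (Fin 2) k) =
              ∑ i, (c i : MvPolynomial (Fin 2) k) * g i := by
            rw [← hc]
            simp
          have h3 := homogeneousComponent_of_mem (m := m) hfm
          rw [if_pos rfl] at h3
          change _ = (f : MvPolynomial (Fin 2) k) at h3
          rw [← h3]
          change _ = homogeneousComponent m (f : MvPolynomial (Fin 2) k)
          rw [h2, map_sum]
          refine Finset.sum_congr rfl fun i _ => ?_
          have hgi : (g i : MvPolynomial (Fin 2) k).IsHomogeneous (d i) := hg i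
          rw [homogeneousComponent_mul_right hgi]
          dsimp only
          rw [ite_mul, zero_mul]
    rw [hmap, finrank_map_val]
  have h2 := gradedLength_add_finrank (Ideal.span (Set.range g)) m
  omega

end Ideals

end HilbertKunz

namespace HilbertKunz

/-! ### Consequences of `S = k[h₁, h₂, h₃]`: the maximal ideal and the degrees that occur. -/

section Generated

variable {k : Type*} [Field k] {G : Subgroup (SpecialLinearGroup (Fin 2) k)}
  {a b h : Fin 3 → MvPolynomial (Fin 2) k} {d : Fin 3 → ℕ} {l : ℕ}

theorem mem_invariantRing_of_eq_adjoin
    (hS : invariantRing G = Algebra.adjoin k (Set.range h)) (i : Fin 3) :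
    h i ∈ invariantRing G := by
  rw [hS]
  exact Algebra.subset_adjoin ⟨i, rfl⟩

theorem adjoin_eq_top (hS : invariantRing G = Algebra.adjoin k (Set.range h)) :
    Algebra.adjoin k (Set.range fun i =>
      (⟨h i, mem_invariantRing_of_eq_adjoin hS i⟩ : invariantRing G)) = ⊤ := by
  apply Subalgebra.map_injective (f := (invariantRing G).val) Subtype.val_injective
  rw [AlgHom.map_adjoin, Algebra.map_top, ← Set.range_comp, Subalgebra.range_val]
  exact hS.symm

/-- The quotient of `S` by the generators consists of constants; this identifies the maximal ideal
here and the residue field in the computation of lengths. -/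
theorem exists_sub_algebraMap_mem_span
    (hS : invariantRing G = Algebra.adjoin k (Set.range h)) (f : invariantRing G) :
    ∃ c : k, f - algebraMap k _ c ∈ Ideal.span (Set.range fun i =>
      (⟨h i, mem_invariantRing_of_eq_adjoin hS i⟩ : invariantRing G)) := by
  have hf : f ∈ Algebra.adjoin k (Set.range fun i =>
    (⟨h i, mem_invariantRing_of_eq_adjoin hS i⟩ : invariantRing G)) := by
    rw [adjoin_eq_top hS]
    exact Algebra.mem_top
  induction hf using Algebra.adjoin_induction with
  | mem x hx => exact ⟨0, by rw [map_zero, sub_zero]; exact Ideal.subset_span hx⟩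
  | algebraMap r => exact ⟨r, by rw [sub_self]; exact Submodule.zero_mem _⟩
  | add x y _ _ hx hy =>
    obtain ⟨c, hc⟩ := hx
    obtain ⟨c', hc'⟩ := hy
    refine ⟨c + c', ?_⟩
    rw [map_add, add_sub_add_comm]
    exact Submodule.add_mem _ hc hc'
  | mul x y _ _ hx hy =>
    obtain ⟨c, hc⟩ := hx
    obtain ⟨c', hc'⟩ := hy
    refine ⟨c * c', ?_⟩
    have : x * y - algebraMap k _ (c * c') =
        y * (x - algebraMap k _ c) + algebraMap k _ c * (y - algebraMap k _ c') := by
      rw [map_mul]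
      ring
    rw [this]
    exact Submodule.add_mem _ (Ideal.mul_mem_left _ _ hc) (Ideal.mul_mem_left _ _ hc')

/-- An element of the irrelevant ideal is a constant modulo the span, and comparison in degree `0`
shows that the constant vanishes. -/
theorem gradedMaximalIdeal_eq_span (hS : invariantRing G = Algebra.adjoin k (Set.range h))
    (hd : ∀ i, 0 < d i) (hh : ∀ i, (h i).IsHomogeneous (d i)) :
    gradedMaximalIdeal G = Ideal.span (Set.range fun i =>
      (⟨h i, mem_invariantRing_of_eq_adjoin hS i⟩ : invariantRing G)) := by
  have hmem : ∀ f : invariantRing G, f ∈ gradedMaximalIdeal G ↔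
      GradedRing.proj (invGrading G) 0 f = 0 := fun f => HomogeneousIdeal.mem_irrelevant_iff _ _
  have hle : Ideal.span (Set.range fun i =>
      (⟨h i, mem_invariantRing_of_eq_adjoin hS i⟩ : invariantRing G)) ≤ gradedMaximalIdeal G := by
    rw [Ideal.span_le]
    rintro _ ⟨i, rfl⟩
    rw [SetLike.mem_coe, hmem, GradedRing.proj_apply]
    exact DirectSum.decompose_of_mem_ne (invGrading G) (i := d i) (hh i) (hd i).ne'
  refine le_antisymm (fun f hf => ?_) hle
  obtain ⟨c, hc⟩ := exists_sub_algebraMap_mem_span hS f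
  have h1 := (hmem _).mp (hle hc)
  rw [map_sub, (hmem f).mp hf, zero_sub, neg_eq_zero, GradedRing.proj_apply,
    DirectSum.decompose_of_mem_same (invGrading G) (SetLike.algebraMap_mem_graded _ c)] at h1
  rwa [h1, sub_zero] at hc

theorem map_gradedMaximalIdeal (hS : invariantRing G = Algebra.adjoin k (Set.range h))
    (hd : ∀ i, 0 < d i) (hh : ∀ i, (h i).IsHomogeneous (d i)) :
    (gradedMaximalIdeal G).map (invariantRing G).val = Ideal.span (Set.range h) := by
  rw [gradedMaximalIdeal_eq_span hS hd hh, Ideal.map_span, ← Set.range_comp]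
  rfl

theorem frobPower_gradedMaximalIdeal (hS : invariantRing G = Algebra.adjoin k (Set.range h))
    (hd : ∀ i, 0 < d i) (hh : ∀ i, (h i).IsHomogeneous (d i)) (p n : ℕ) [Fact p.Prime]
    [CharP k p] :
    frobPower (gradedMaximalIdeal G) (p ^ n) = Ideal.span (Set.range fun i =>
      (⟨h i, mem_invariantRing_of_eq_adjoin hS i⟩ : invariantRing G) ^ p ^ n) := by
  have : CharP (invariantRing G) p :=
    charP_of_injective_algebraMap (R := k) (algebraMap k (invariantRing G)).injective p
  rw [gradedMaximalIdeal_eq_span hS hd hh, frobPower_span]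

/-! ### The greatest common divisor of the degrees -/

theorem dvd_degree_of_coeff_ne_zero (hS : invariantRing G = Algebra.adjoin k (Set.range h))
    (hh : ∀ i, (h i).IsHomogeneous (d i)) {e : ℕ} (he : ∀ i, e ∣ d i)
    {f : MvPolynomial (Fin 2) k} (hf : f ∈ invariantRing G) :
    ∀ c : Fin 2 →₀ ℕ, coeff c f ≠ 0 → e ∣ c.degree := by
  classical
  rw [hS] at hf
  induction hf using Algebra.adjoin_induction with
  | mem x hx =>
    obtain ⟨i, rfl⟩ := hx
    intro c hc
    by_contra hne
    exact hc ((hh i).coeff_eq_zero fun h => hne (h ▸ he i))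
  | algebraMap r =>
    intro c hc
    rw [algebraMap_eq, coeff_C] at hc
    have : c = 0 := by
      by_contra hne
      exact hc (if_neg (Ne.symm hne))
    simp [this]
  | add x y _ _ hx hy =>
    intro c hc
    rw [coeff_add] at hc
    by_cases h0 : coeff c x = 0
    · rw [h0, zero_add] at hc
      exact hy c hc
    · exact hx c h0
  | mul x y _ _ hx hy =>
    intro c hc
    rw [coeff_mul] at hc
    obtain ⟨z, hz, hz0⟩ := Finset.exists_ne_zero_of_sum_ne_zero hc
    rw [← Finset.HasAntidiagonal.mem_antidiagonal.mp hz, map_add]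
    exact (hx _ (left_ne_zero_of_mul hz0)).add (hy _ (right_ne_zero_of_mul hz0))

/-- All degrees of `S` are multiples of `e`, and the `d i` are among them, so the set in the
supremum is the set of divisors of `e`. -/
theorem degreeGCD_eq (hS : invariantRing G = Algebra.adjoin k (Set.range h))
    (hh : ∀ i, (h i).IsHomogeneous (d i)) (h0 : ∀ i, h i ≠ 0) {e : ℕ} (hepos : 0 < e)
    (he : ∀ i, e ∣ d i) (hmax : ∀ x, (∀ i, x ∣ d i) → x ∣ e) :
    degreeGCD (invGrading G) = e := by
  have hset : {x : ℕ | ∀ n, invGrading G n ≠ ⊥ → x ∣ n} = {x | x ∣ e} := by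
    ext x
    constructor
    · intro hx
      refine hmax x fun i => hx (d i) fun hbot => h0 i ?_
      have : (⟨h i, mem_invariantRing_of_eq_adjoin hS i⟩ : invariantRing G) ∈
          invGrading G (d i) := hh i
      rw [hbot, Submodule.mem_bot] at this
      exact congrArg Subtype.val this
    · intro hx n hn
      obtain ⟨f, hf, hf0⟩ := Submodule.exists_mem_ne_zero_of_ne_bot hn
      have hf0' : (f : MvPolynomial (Fin 2) k) ≠ 0 := fun h => hf0 (Subtype.ext h)
      obtain ⟨c, hc⟩ := MvPolynomial.ne_zero_iff.mp hf0'
      have h1 := dvd_degree_of_coeff_ne_zero hS hh he f.2 c hc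
      have h2 : c.degree = n := by
        by_contra hne
        exact hc (IsHomogeneous.coeff_eq_zero hf hne)
      exact dvd_trans hx (h2 ▸ h1)
  rw [degreeGCD, hset]
  exact IsGreatest.csSup_eq ⟨dvd_refl e, fun x hx => Nat.le_of_dvd hepos hx⟩

/-- The numerical semigroup generated by the `d i` contains all large multiples of their greatest
common divisor, and products of the `h i` do not vanish. -/
theorem invPart_ne_bot_of_dvd (hS : invariantRing G = Algebra.adjoin k (Set.range h))
    (hh : ∀ i, (h i).IsHomogeneous (d i)) (h0 : ∀ i, h i ≠ 0) {e : ℕ}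
    (he : ∀ i, e ∣ d i) (hmax : ∀ x, (∀ i, x ∣ d i) → x ∣ e) :
    ∃ T, ∀ t ≥ T, invPart G (e * t) ≠ ⊥ := by
  obtain ⟨T, hT⟩ := Nat.exists_mem_closure_of_ge (s := Set.range d)
  have hgcd : Nat.setGcd (Set.range d) ∣ e :=
    hmax _ fun i => Nat.setGcd_dvd_of_mem ⟨i, rfl⟩
  rcases Nat.eq_zero_or_pos e with rfl | hepos
  · refine ⟨0, fun t _ => ?_⟩
    rw [zero_mul]
    have h1 : (1 : MvPolynomial (Fin 2) k) ∈ invPart G 0 :=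
      ⟨Subalgebra.one_mem _, isHomogeneous_one _ _⟩
    intro hbot
    rw [hbot, Submodule.mem_bot] at h1
    exact one_ne_zero h1
  refine ⟨T, fun t ht => ?_⟩
  have hmem := hT (e * t) (ht.le.trans (Nat.le_mul_of_pos_left _ hepos)) (hgcd.mul_right t)
  have key : ∀ m ∈ AddSubmonoid.closure (Set.range d), ∃ f ∈ invPart G m, f ≠ 0 := by
    intro m hm
    induction hm using AddSubmonoid.closure_induction with
    | mem x hx =>
      obtain ⟨i, rfl⟩ := hx
      exact ⟨h i, ⟨mem_invariantRing_of_eq_adjoin hS i, hh i⟩, h0 i⟩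
    | zero => exact ⟨1, ⟨Subalgebra.one_mem _, isHomogeneous_one _ _⟩, one_ne_zero⟩
    | add x y _ _ hx hy =>
      obtain ⟨f, hf, hf0⟩ := hx
      obtain ⟨g, hg, hg0⟩ := hy
      exact ⟨f * g, ⟨Subalgebra.mul_mem _ hf.1 hg.1, IsHomogeneous.mul hf.2 hg.2⟩,
        mul_ne_zero hf0 hg0⟩
  obtain ⟨f, hf, hf0⟩ := key _ hmem
  intro hbot
  rw [hbot, Submodule.mem_bot] at hf
  exact hf0 hf

theorem dvd_of_invPart_ne_bot (hS : invariantRing G = Algebra.adjoin k (Set.range h))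
    (hh : ∀ i, (h i).IsHomogeneous (d i)) {e : ℕ} (he : ∀ i, e ∣ d i) (m : ℕ)
    (hm : invPart G m ≠ ⊥) : e ∣ m := by
  obtain ⟨f, hf, hf0⟩ := Submodule.exists_mem_ne_zero_of_ne_bot hm
  obtain ⟨c, hc⟩ := MvPolynomial.ne_zero_iff.mp hf0
  have h1 := dvd_degree_of_coeff_ne_zero hS hh he hf.1 c hc
  have h2 : c.degree = m := by
    by_contra hne
    exact hc (IsHomogeneous.coeff_eq_zero hf.2 hne)
  exact h2 ▸ h1

end Generated

end HilbertKunz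

/-! ### Asymptotics of the graded lengths with an error bounded uniformly in `q`. -/

namespace HilbertKunz

/-- The function `y - ∑ (y - d i)₊ + 2 (y - l)₊`, the leading term of the Hilbert function of a
quotient with three generators of degrees `d i` and two syzygies of degree `l`. -/
noncomputable def profile (d : Fin 3 → ℝ) (l y : ℝ) : ℝ :=
  y - ∑ i, max (y - d i) 0 + 2 * max (y - l) 0

theorem profile_mul (d : Fin 3 → ℝ) (l y : ℝ) {q : ℝ} (hq : 0 ≤ q) :
    profile (fun i => d i * q) (l * q) (y * q) = profile d l y * q := by
  have h : ∀ c : ℝ, max (y * q - c * q) 0 = max (y - c) 0 * q := fun c => by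
    rw [← sub_mul, max_mul_of_nonneg _ _ hq, zero_mul]
  simp only [profile, h, ← Finset.sum_mul]
  ring

theorem abs_max_sub_le (x y c : ℝ) : |max (x - c) 0 - max (y - c) 0| ≤ |x - y| := by
  refine (abs_max_sub_max_le_abs _ _ _).trans_eq ?_
  ring_nf

/-- The Lipschitz constant is `1 + 3 + 2`, from the three terms of `profile`. -/
theorem abs_profile_sub_le (d : Fin 3 → ℝ) (l x y : ℝ) :
    |profile d l x - profile d l y| ≤ 6 * |x - y| := by
  have h0 := abs_le.mp (abs_max_sub_le x y (d 0))
  have h1 := abs_le.mp (abs_max_sub_le x y (d 1))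
  have h2 := abs_le.mp (abs_max_sub_le x y (d 2))
  have h3 := abs_le.mp (abs_max_sub_le x y l)
  have h4 := abs_le.mp (le_refl |x - y|)
  simp only [profile, Fin.sum_univ_three]
  rw [abs_le]
  constructor <;> linarith

section Bound

variable {k : Type*} [Field k] {G : Subgroup (SpecialLinearGroup (Fin 2) k)}
  {a b h : Fin 3 → MvPolynomial (Fin 2) k} {d : Fin 3 → ℕ} {l : ℕ}

/-- The dimensions of the graded parts of the ring of invariants. -/
theorem exists_finrank_invPart_bound [Finite G] {n : ℕ} (hn : 0 < n)
    (hdvd : ∀ m, invPart G m ≠ ⊥ → n ∣ m) (hex : ∃ T, ∀ t ≥ T, invPart G (n * t) ≠ ⊥) :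
    ∃ C : ℝ, ∀ t : ℕ,
      |(Nat.card G : ℝ) * Module.finrank k (invPart G (n * t)) - n * (n * t : ℕ)| ≤ C := by
  obtain ⟨C, hC⟩ := exists_block_bounds hn hdvd hex
  have hblock : ∀ t, n * (n * t) ≤ ∑ r ∈ Finset.range n, (n * t + r + 1) ∧
      ∑ r ∈ Finset.range n, (n * t + r + 1) ≤ n * (n * t + n) := by
    intro t
    constructor
    · calc n * (n * t) = ∑ _r ∈ Finset.range n, n * t := by simp
        _ ≤ _ := Finset.sum_le_sum fun r _ => by omega
    · calc _ ≤ ∑ _r ∈ Finset.range n, (n * t + n) := Finset.sum_le_sum fun r hr => by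
            have := Finset.mem_range.mp hr
            omega
        _ = _ := by simp
  -- The generator `0` of degree `0` turns the block bounds into bounds for `S` itself.
  have hC' := fun t => hC Unit (fun _ => 0) (fun _ => 0) (fun _ => Subalgebra.zero_mem _)
    (fun _ => dvd_zero _) t
  simp only [finrank_syzPart_zero, finrank_homogeneousSubmodule] at hC'
  refine ⟨n * (n * C + n), fun t => ?_⟩
  have hup : (Nat.card G : ℝ) * Module.finrank k (invPart G (n * t)) ≤ n * (n * (t + C) + n) := by
    exact_mod_cast (hC' t).1.trans (hblock (t + C)).2
  have hpos : (0 : ℝ) ≤ (Nat.card G : ℝ) * Module.finrank k (invPart G (n * t)) := by positivity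
  have hlow : (n : ℝ) * (n * (t - C)) ≤ Nat.card G * Module.finrank k (invPart G (n * t)) := by
    -- The block bound is used at `t - C`; for `t < C` the left side is not positive.
    by_cases ht : C ≤ t
    · have h1 := (hblock (t - C)).1.trans (hC' (t - C)).2
      rw [Nat.sub_add_cancel ht] at h1
      have h2 : ((n * (n * (t - C)) : ℕ) : ℝ) ≤
          (Nat.card G * Module.finrank k (invPart G (n * t)) : ℕ) := by exact_mod_cast h1
      push_cast [Nat.cast_sub ht] at h2
      exact h2
    · refine le_trans ?_ hpos
      have : (t : ℝ) < C := by exact_mod_cast not_le.mp ht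
      exact mul_nonpos_of_nonneg_of_nonpos (by positivity)
        (mul_nonpos_of_nonneg_of_nonpos (by positivity) (by linarith))
  push_cast
  have hn0 : (0 : ℝ) ≤ (n : ℝ) * n := by positivity
  rw [abs_le]
  constructor <;> nlinarith

/-- The order of the quantifiers matters: one `C` serves every matrix with minors in `S` of degrees
divisible by `n`, in particular all Frobenius powers of a fixed one. -/
theorem exists_finrank_syzPart_bound [Finite G] {n : ℕ} (hn : 0 < n)
    (hdvd : ∀ m, invPart G m ≠ ⊥ → n ∣ m) (hex : ∃ T, ∀ t ≥ T, invPart G (n * t) ≠ ⊥) :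
    ∃ C : ℝ, ∀ (a b h : Fin 3 → MvPolynomial (Fin 2) k) (d : Fin 3 → ℕ) (l : ℕ),
      IsMinors a b h d l → (∀ i, h i ∈ invariantRing G) → (∀ i, n ∣ d i) → ∀ t : ℕ,
      |(Nat.card G : ℝ) * Module.finrank k (syzPart (invPart G) d h (n * t)) -
        n * (2 * max ((n * t : ℕ) - (l : ℝ)) 0)| ≤ C := by
  obtain ⟨C, hC⟩ := exists_block_bounds hn hdvd hex
  refine ⟨n * (2 * (n * C + n)), fun a b h d l H hh hd t => ?_⟩
  obtain ⟨i, j, hij⟩ := H.isRelPrime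
  have hC' := hC (Fin 3) d h hh hd
  simp only [finrank_syzPart_minors H.eq_zero H.eq_one H.eq_two (H.ne_zero i) hij
    (fun i => (H.lt i).le) H.homogeneous_left H.homogeneous_right] at hC'
  -- Truncated subtraction becomes the positive part.
  have hterm : ∀ m : ℕ, ((m + 1 - l : ℕ) : ℝ) = max ((m : ℝ) + 1 - l) 0 := by
    intro m
    by_cases hm : l ≤ m + 1
    · rw [Nat.cast_sub hm, max_eq_left]
      · push_cast
        ring
      · have : (l : ℝ) ≤ (m + 1 : ℕ) := by exact_mod_cast hm
        push_cast at this
        linarith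
    · rw [Nat.sub_eq_zero_of_le (by omega), max_eq_right, Nat.cast_zero]
      have : ((m + 1 : ℕ) : ℝ) ≤ l := by exact_mod_cast (by omega : m + 1 ≤ l)
      push_cast at this
      linarith
  have hterm2 : ∀ m : ℕ, ((2 * (m + 1 - l) : ℕ) : ℝ) = 2 * max ((m : ℝ) + 1 - l) 0 := by
    intro m
    rw [Nat.cast_mul, hterm, Nat.cast_ofNat]
  have hblock : ∀ t : ℕ, (n : ℝ) * (2 * max ((n * t : ℕ) - (l : ℝ)) 0) ≤
      ((∑ r ∈ Finset.range n, 2 * (n * t + r + 1 - l) : ℕ) : ℝ) ∧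
      ((∑ r ∈ Finset.range n, 2 * (n * t + r + 1 - l) : ℕ) : ℝ) ≤
        n * (2 * (max ((n * t : ℕ) - (l : ℝ)) 0 + n)) := by
    intro t
    rw [Nat.cast_sum]
    constructor
    · calc _ = ∑ _r ∈ Finset.range n, 2 * max ((n * t : ℕ) - (l : ℝ)) 0 := by simp
        _ ≤ _ := Finset.sum_le_sum fun r _ => by
          rw [hterm2]
          push_cast
          have : max ((n : ℝ) * t - l) 0 ≤ max ((n : ℝ) * t + r + 1 - l) 0 :=
            max_le_max_right _ (by have : (0 : ℝ) ≤ r := by positivity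
                                   linarith)
          linarith
    · calc _ ≤ ∑ _r ∈ Finset.range n, 2 * (max ((n * t : ℕ) - (l : ℝ)) 0 + n) :=
            Finset.sum_le_sum fun r hr => by
              rw [hterm2]
              push_cast
              have hr' : (r : ℝ) + 1 ≤ n := by exact_mod_cast Finset.mem_range.mp hr
              have : max ((n : ℝ) * t + r + 1 - l) 0 ≤ max ((n : ℝ) * t - l) 0 + n := by
                apply max_le
                · have := le_max_left ((n : ℝ) * t - l) 0
                  linarith
                · positivity
              linarith
        _ = _ := by simp
  have hup : (Nat.card G : ℝ) * Module.finrank k (syzPart (invPart G) d h (n * t)) ≤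
      n * (2 * (max ((n * (t + C) : ℕ) - (l : ℝ)) 0 + n)) :=
    le_trans (by exact_mod_cast (hC' t).1) (hblock (t + C)).2
  have hpos : (0 : ℝ) ≤ Nat.card G * Module.finrank k (syzPart (invPart G) d h (n * t)) := by
    positivity
  have hlow : (n : ℝ) * (2 * max (n * (t - C) - (l : ℝ)) 0) ≤
      Nat.card G * Module.finrank k (syzPart (invPart G) d h (n * t)) := by
    by_cases ht : C ≤ t
    · have h1 := (hblock (t - C)).1
      have h2 := (hC' (t - C)).2
      rw [Nat.sub_add_cancel ht] at h2
      have h3 : ((∑ r ∈ Finset.range n, 2 * (n * (t - C) + r + 1 - l) : ℕ) : ℝ) ≤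
          (Nat.card G * Module.finrank k (syzPart (invPart G) d h (n * t)) : ℕ) := by
        exact_mod_cast h2
      push_cast [Nat.cast_sub ht] at h1 h3
      exact h1.trans h3
    · refine le_trans (le_of_eq ?_) hpos
      have : (t : ℝ) < C := by exact_mod_cast not_le.mp ht
      rw [max_eq_right, mul_zero, mul_zero]
      have h1 : (n : ℝ) * (t - C) ≤ 0 :=
        mul_nonpos_of_nonneg_of_nonpos (by positivity) (by linarith)
      have : (0 : ℝ) ≤ l := by positivity
      linarith
  have e1 : max ((n * (t + C) : ℕ) - (l : ℝ)) 0 ≤ max ((n * t : ℕ) - (l : ℝ)) 0 + n * C := by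
    push_cast
    apply max_le
    · have := le_max_left ((n : ℝ) * t - l) 0
      linarith
    · positivity
  have e2 : max ((n * t : ℕ) - (l : ℝ)) 0 - n * C ≤ max (n * (t - C) - (l : ℝ)) 0 := by
    push_cast
    rw [sub_le_iff_le_add]
    apply max_le
    · have := le_max_left ((n : ℝ) * (t - C) - l) 0
      linarith
    · positivity
  have hn0 : (0 : ℝ) ≤ n := by positivity
  have e3 := mul_le_mul_of_nonneg_left e1 hn0
  have e4 := mul_le_mul_of_nonneg_left e2 hn0
  have hn2 : (0 : ℝ) ≤ (n : ℝ) * n := by positivity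
  rw [abs_le]
  constructor <;> nlinarith

/-- The lengths of the graded parts of `S ⧸ I^[q]`, up to a bounded error. -/
theorem exists_gradedLength_bound [Finite G] (p : ℕ) [Fact p.Prime] [CharP k p]
    (hS : invariantRing G = Algebra.adjoin k (Set.range h)) (H : IsMinors a b h d l)
    {n : ℕ} (hn : 0 < n) (hd : ∀ i, n ∣ d i) (hmax : ∀ x, (∀ i, x ∣ d i) → x ∣ n) :
    ∃ C : ℝ, ∀ N t : ℕ,
      |(Nat.card G : ℝ) *
          gradedLength (invGrading G) (frobPower (gradedMaximalIdeal G) (p ^ N)) (n * t) -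
        n * profile (fun i => d i * (p : ℝ) ^ N) (l * (p : ℝ) ^ N) (n * t : ℕ)| ≤ C := by
  have hdvd := dvd_of_invPart_ne_bot hS H.homogeneous hd
  have hex := invPart_ne_bot_of_dvd hS H.homogeneous H.ne_zero hd hmax
  obtain ⟨C₁, hC₁⟩ := exists_finrank_invPart_bound hn hdvd hex
  obtain ⟨C₂, hC₂⟩ := exists_finrank_syzPart_bound hn hdvd hex
  have hC₁0 : 0 ≤ C₁ := (abs_nonneg _).trans (hC₁ 0)
  refine ⟨C₁ + 3 * C₁ + C₂, fun N t => ?_⟩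
  have hq := H.pow p N
  rw [frobPower_gradedMaximalIdeal hS H.pos H.homogeneous]
  have h1 := gradedLength_span_add (fun i =>
    (⟨h i, mem_invariantRing_of_eq_adjoin hS i⟩ : invariantRing G) ^ p ^ N)
    (fun i => hq.homogeneous i) (n * t)
  have h2 := hC₁ t
  have h3 := hC₂ _ _ _ _ _ hq (fun i => Subalgebra.pow_mem _ (mem_invariantRing_of_eq_adjoin hS i) _)
    (fun i => (hd i).mul_right _) t
  -- As `n` divides `d i * q`, the shift leaves the degree a multiple of `n` and `hC₁` applies
  -- again; below `d i * q` both terms are zero.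
  have h4 : ∀ i, |(Nat.card G : ℝ) *
      Module.finrank k (shiftedPart (invPart G) (d i * p ^ N) (n * t)) -
      n * max ((n * t : ℕ) - (d i * (p : ℝ) ^ N)) 0| ≤ C₁ := by
    intro i
    by_cases hle : d i * p ^ N ≤ n * t
    · obtain ⟨c, hc⟩ : n ∣ d i * p ^ N := (hd i).mul_right _
      have hc' : (d i * (p : ℝ) ^ N) = (n * c : ℕ) := by rw [← hc]; push_cast; ring
      rw [hc] at hle
      have hct : c ≤ t := le_of_mul_le_mul_left hle hn
      rw [hc, shiftedPart_of_le hle, hc', max_eq_left (sub_nonneg.mpr (by exact_mod_cast hle)),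
        ← Nat.mul_sub, ← Nat.cast_sub hle, ← Nat.mul_sub]
      exact hC₁ (t - c)
    · rw [shiftedPart_of_not_le hle, finrank_bot, max_eq_right]
      · simpa using hC₁0
      · have : ((n * t : ℕ) : ℝ) ≤ (d i * p ^ N : ℕ) := by exact_mod_cast (not_le.mp hle).le
        rw [sub_nonpos]
        exact_mod_cast this
  set D : Fin 3 → ℝ := fun i => Module.finrank k (shiftedPart (invPart G) (d i * p ^ N) (n * t))
    with hD
  have h1' : (gradedLength (invGrading G) (Ideal.span (Set.range fun i =>
      (⟨h i, mem_invariantRing_of_eq_adjoin hS i⟩ : invariantRing G) ^ p ^ N)) (n * t) : ℝ) =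
      Module.finrank k (invPart G (n * t)) + Module.finrank k (syzPart (invPart G)
        (fun i => d i * p ^ N) (fun i => h i ^ p ^ N) (n * t)) - (D 0 + D 1 + D 2) := by
    rw [eq_sub_iff_add_eq, ← Fin.sum_univ_three, hD]
    have h1c := congrArg (Nat.cast : ℕ → ℝ) h1
    rw [Nat.cast_add, Nat.cast_add, Nat.cast_sum] at h1c
    exact h1c
  rw [h1']
  have h40 := abs_le.mp (h4 0)
  have h41 := abs_le.mp (h4 1)
  have h42 := abs_le.mp (h4 2)
  have h2' := abs_le.mp h2
  have h3' := abs_le.mp h3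
  rw [Nat.cast_mul l, Nat.cast_pow] at h3'
  simp only [profile, Fin.sum_univ_three]
  change _ ≤ (Nat.card G : ℝ) * D 0 - _ ∧ (Nat.card G : ℝ) * D 0 - _ ≤ _ at h40
  change _ ≤ (Nat.card G : ℝ) * D 1 - _ ∧ (Nat.card G : ℝ) * D 1 - _ ≤ _ at h41
  change _ ≤ (Nat.card G : ℝ) * D 2 - _ ∧ (Nat.card G : ℝ) * D 2 - _ ≤ _ at h42
  rw [abs_le]
  constructor <;> linarith

theorem gradedLength_eq_zero (J : Ideal (invariantRing G))
    (hS : invariantRing G = Algebra.adjoin k (Set.range h)) (H : IsMinors a b h d l)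
    {n m : ℕ} (hd : ∀ i, n ∣ d i) (hm : ¬ n ∣ m) : gradedLength (invGrading G) J m = 0 := by
  have h0 : invGrading G m = ⊥ := by
    by_contra hne
    exact hm (dvd_of_invPart_ne_bot hS H.homogeneous hd m fun h => hne
      (invGrading_eq_bot_iff.mpr h))
  rw [gradedLength, h0, Submodule.map_bot, finrank_bot]

end Bound

end HilbertKunz

namespace HilbertKunz

/-! ### The Krull dimension of `S`. -/

section Dimension

variable {k : Type*} [Field k] (G : Subgroup (SpecialLinearGroup (Fin 2) k))

/-- Lying over and going up lift chains of primes from `A` to `B`; incomparability keeps chains of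
`B` strict when they are contracted to `A`. -/
theorem ringKrullDim_eq_of_isIntegral {A B : Type*} [CommRing A] [CommRing B] [Algebra A B]
    [Algebra.IsIntegral A B] [IsDomain B] [IsDomain A] [FaithfulSMul A B] :
    ringKrullDim A = ringKrullDim B := by
  have hmono : StrictMono (PrimeSpectrum.comap (algebraMap A B)) := by
    intro P Q hPQ
    exact Ideal.IsIntegral.comap_lt_comap hPQ
  have hup : Algebra.HasGoingUp A B := ⟨fun {q} _ P _ hlt => by
    obtain ⟨Q, hQ, hQ', hQq⟩ := Ideal.exists_ideal_over_prime_of_isIntegral_of_isPrime q P hlt.le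
    exact ⟨Q, hQ, hQ', ⟨hQq.symm⟩⟩⟩
  refine le_antisymm ?_ (Order.krullDim_le_of_strictMono _ hmono)
  refine iSup_le fun s => ?_
  obtain ⟨Q, hQ, hQs⟩ := Ideal.exists_ideal_over_prime_of_isIntegral_of_isDomain (S := B)
    (RelSeries.head s).asIdeal (by
      rw [(RingHom.injective_iff_ker_eq_bot _).mp (FaithfulSMul.algebraMap_injective A B)]
      exact bot_le)
  have : Q.LiesOver (RelSeries.head s).asIdeal := ⟨hQs.symm⟩
  obtain ⟨L, hL, -, -⟩ := Ideal.exists_ltSeries_of_hasGoingUp s Q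
  rw [← hL]
  exact Order.LTSeries.length_le_krullDim L

theorem ringKrullDim_invariantRing [Finite G] : ringKrullDim (invariantRing G) = 2 := by
  have := isIntegral_invariantRing G
  rw [ringKrullDim_eq_of_isIntegral (B := MvPolynomial (Fin 2) k),
    MvPolynomial.ringKrullDim_of_isNoetherianRing, ringKrullDim_eq_zero_of_field]
  simp

theorem dim_invariantRing [Finite G] : dim (invariantRing G) = 2 := by
  rw [dim, ringKrullDim_invariantRing]
  rfl

end Dimension

/-! ### Length over `S` as dimension over `k`. -/

section Length

variable {k S : Type*} [Field k] [CommRing S] [Algebra k S]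

theorem length_eq_one_of_smul_eq_zero {M : Type*} [AddCommGroup M] [Module S M] [Module k M]
    [IsScalarTower k S M] {I : Ideal S} (hI : ∀ s : S, ∃ c : k, s - algebraMap k S c ∈ I)
    {v : M} (hv : v ≠ 0) (hIv : ∀ s ∈ I, s • v = 0) :
    Module.length S (Submodule.span S {v}) = 1 ∧ Module.finrank k (Submodule.span S {v}) = 1 := by
  have hs : ∀ s : S, ∃ c : k, s • v = c • v := by
    intro s
    obtain ⟨c, hc⟩ := hI s
    refine ⟨c, ?_⟩
    have := hIv _ hc
    rwa [sub_smul, sub_eq_zero, algebraMap_smul] at this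
  let v' : Submodule.span S {v} := ⟨v, Submodule.mem_span_singleton_self v⟩
  have hv' : v' ≠ 0 := fun h => hv (congrArg Subtype.val h)
  have hgen : ∀ w : Submodule.span S {v}, ∃ c : k, c • v' = w := by
    rintro ⟨w, hw⟩
    obtain ⟨s, rfl⟩ := Submodule.mem_span_singleton.mp hw
    obtain ⟨c, hc⟩ := hs s
    exact ⟨c, Subtype.ext hc.symm⟩
  refine ⟨?_, finrank_eq_one v' hv' hgen⟩
  rw [Module.length_eq_one_iff, isSimpleModule_iff_toSpanSingleton_surjective]
  refine ⟨⟨v', 0, hv'⟩, fun w hw u => ?_⟩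
  obtain ⟨c, rfl⟩ := hgen w
  obtain ⟨c', rfl⟩ := hgen u
  have hc : c ≠ 0 := by
    rintro rfl
    exact hw (zero_smul _ _)
  refine ⟨algebraMap k S (c' * c⁻¹), ?_⟩
  rw [LinearMap.toSpanSingleton_apply, algebraMap_smul, smul_smul, inv_mul_cancel_right₀ hc]

theorem finrank_quotient_add_finrank_restrictScalars {M : Type*} [AddCommGroup M] [Module S M]
    [Module k M] [IsScalarTower k S M] [FiniteDimensional k M] (N : Submodule S M) :
    FiniteDimensional k (M ⧸ N) ∧
      Module.finrank k (M ⧸ N) + Module.finrank k N = Module.finrank k M := by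
  let f : M →ₗ[k] M ⧸ N := N.mkQ.restrictScalars k
  have hf : Function.Surjective f := N.mkQ_surjective
  have hker : LinearMap.ker f = N.restrictScalars k := by
    ext x
    exact Submodule.Quotient.mk_eq_zero N
  refine ⟨Module.Finite.of_surjective f hf, ?_⟩
  have h := LinearMap.finrank_range_add_finrank_ker f
  rw [LinearMap.range_eq_top.mpr hf, finrank_top, hker] at h
  exact h

/-- Every scalar acts on a vector killed by `I` as a constant of `k`, so the vector spans a simple
module of dimension one, and induction splits it off. The lemma links the length over `S` in the
multiplicity to the dimensions over `k` in the density. -/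
theorem length_eq_finrank_of_pow_smul_eq_zero {I : Ideal S}
    (hI : ∀ s : S, ∃ c : k, s - algebraMap k S c ∈ I) (d : ℕ) :
    ∀ (M : Type*) [AddCommGroup M] [Module S M] [Module k M] [IsScalarTower k S M]
      [FiniteDimensional k M], (∃ n : ℕ, ∀ s ∈ I ^ n, ∀ v : M, s • v = 0) →
      Module.finrank k M = d → Module.length S M = d := by
  induction d with
  | zero =>
    intro M _ _ _ _ _ _ h
    have := Module.finrank_zero_iff.mp h
    rw [Module.length_eq_zero, Nat.cast_zero]
  | succ d ih =>
    intro M _ _ _ _ _ hn h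
    have : Nontrivial M := Module.nontrivial_of_finrank_pos (R := k) (by omega)
    -- For the least `n` such that `I ^ n` kills `M`, any non-zero `s • v` with `s ∈ I ^ (n - 1)` is
    -- killed by `I`.
    obtain ⟨v, hv, hIv⟩ : ∃ v : M, v ≠ 0 ∧ ∀ s ∈ I, s • v = 0 := by
      classical
      have hpos : Nat.find hn ≠ 0 := by
        intro h0
        have h1 := Nat.find_spec hn
        rw [h0, pow_zero] at h1
        obtain ⟨v, hv⟩ := exists_ne (0 : M)
        exact hv (by simpa using h1 1 (by rw [Ideal.one_eq_top]; exact Submodule.mem_top) v)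
      have h1 := Nat.find_min hn (Nat.sub_one_lt hpos)
      push Not at h1
      obtain ⟨s, hs, v, hsv⟩ := h1
      refine ⟨s • v, hsv, fun r hr => ?_⟩
      rw [smul_smul]
      refine Nat.find_spec hn _ ?_ v
      have : Nat.find hn = 1 + (Nat.find hn - 1) := by omega
      rw [this, pow_add, pow_one]
      exact Ideal.mul_mem_mul hr hs
    obtain ⟨h1, h2⟩ := length_eq_one_of_smul_eq_zero (k := k) hI hv hIv
    have h3 := Module.length_eq_add_of_exact (Submodule.span S {v}).subtype
      (Submodule.span S {v}).mkQ (Submodule.subtype_injective _) (Submodule.mkQ_surjective _)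
      (LinearMap.exact_subtype_mkQ _)
    obtain ⟨_, h4⟩ := finrank_quotient_add_finrank_restrictScalars (k := k) (Submodule.span S {v})
    have h5 : Module.length S (M ⧸ Submodule.span S {v}) = d := by
      refine ih _ ?_ ?_
      · obtain ⟨n, hn⟩ := hn
        refine ⟨n, fun s hs w => ?_⟩
        obtain ⟨w, rfl⟩ := Submodule.mkQ_surjective _ w
        rw [← map_smul, hn s hs, map_zero]
      · omega
    rw [h3, h1, h5, add_comm]
    norm_cast

theorem length_quotient_eq_finrank {I J : Ideal S} [FiniteDimensional k (S ⧸ J)]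
    (hI : ∀ s : S, ∃ c : k, s - algebraMap k S c ∈ I) (hfg : I.FG) (hIJ : I ≤ J.radical) :
    Module.length S (S ⧸ J) = Module.finrank k (S ⧸ J) := by
  obtain ⟨r, hr⟩ := Ideal.exists_pow_le_of_le_radical_of_fg hIJ hfg
  refine length_eq_finrank_of_pow_smul_eq_zero hI _ _ ⟨r, fun s hs v => ?_⟩ rfl
  obtain ⟨v, rfl⟩ := Ideal.Quotient.mk_surjective v
  exact Ideal.Quotient.eq_zero_iff_mem.mpr (J.mul_mem_right v (hr hs))

end Length

/-! ### Graded quotients and a bound for the top degree of `S ⧸ I^[q]`. -/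

section Graded

variable {k S : Type*} [Field k] [CommRing S] [Algebra k S] (𝒜 : ℕ → Submodule k S)
  [GradedAlgebra 𝒜]

theorem finrank_quotient_eq_sum_gradedLength [∀ m, FiniteDimensional k (𝒜 m)] {J : Ideal S}
    (hJ : J.IsHomogeneous 𝒜) {B : ℕ} (hB : ∀ m, B ≤ m → ∀ s ∈ 𝒜 m, s ∈ J) :
    FiniteDimensional k (S ⧸ J) ∧
      Module.finrank k (S ⧸ J) = ∑ m ∈ Finset.range B, gradedLength 𝒜 J m := by
  classical
  let V : Fin B → Submodule k (S ⧸ J) := fun m =>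
    (𝒜 m).map (Ideal.Quotient.mkₐ k J).toLinearMap
  let Φ : (∀ m, V m) →ₗ[k] S ⧸ J := ∑ m, (V m).subtype ∘ₗ LinearMap.proj m
  have hΦ : ∀ w, Φ w = ∑ m, (w m : S ⧸ J) := fun w => by simp [Φ]
  have hinj : Function.Injective Φ := by
    rw [injective_iff_map_eq_zero]
    intro w hw
    choose s hs hsw using fun m => (w m).2
    have h1 : ∑ m, s m ∈ J := by
      rw [← Ideal.Quotient.eq_zero_iff_mem, map_sum, ← hw, hΦ]
      exact Finset.sum_congr rfl fun m _ => hsw m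
    ext m
    rw [← hsw m]
    refine Ideal.Quotient.eq_zero_iff_mem.mpr ?_
    have h2 := hJ m h1
    rw [DirectSum.decompose_sum, DFinsupp.finsetSum_apply, AddSubmonoidClass.coe_finsetSum,
      Finset.sum_eq_single m] at h2
    · rwa [DirectSum.decompose_of_mem_same 𝒜 (hs m)] at h2
    · intro j _ hj
      exact DirectSum.decompose_of_mem_ne 𝒜 (hs j) fun h => hj (Fin.ext h)
    · exact fun h => absurd (Finset.mem_univ m) h
  have hsurj : Function.Surjective Φ := by
    intro x
    obtain ⟨s, rfl⟩ := Ideal.Quotient.mk_surjective x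
    have h0 : ∀ s : S, Ideal.Quotient.mk J s ∈ LinearMap.range Φ := by
      intro s
      rw [← DirectSum.sum_support_decompose 𝒜 s, map_sum]
      refine Submodule.sum_mem _ fun m _ => ?_
      by_cases hm : m < B
      · refine ⟨Pi.single ⟨m, hm⟩ ⟨_, ⟨_, (DirectSum.decompose 𝒜 s m).2, rfl⟩⟩, ?_⟩
        rw [hΦ, Finset.sum_eq_single ⟨m, hm⟩]
        · rw [Pi.single_eq_same]
          rfl
        · intro j _ hj
          rw [Pi.single_eq_of_ne hj]
          rfl
        · exact fun h => absurd (Finset.mem_univ _) h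
      · rw [Ideal.Quotient.eq_zero_iff_mem.mpr (hB m (not_lt.mp hm) _ (Subtype.prop _))]
        exact Submodule.zero_mem _
    exact h0 s
  refine ⟨Module.Finite.of_surjective Φ hsurj, ?_⟩
  rw [← (LinearEquiv.ofBijective Φ ⟨hinj, hsurj⟩).finrank_eq, Module.finrank_pi_fintype,
    Finset.sum_range]
  rfl

end Graded

section Quotient

variable {k : Type*} [Field k] {G : Subgroup (SpecialLinearGroup (Fin 2) k)}
  {h : Fin 3 → MvPolynomial (Fin 2) k} {d : Fin 3 → ℕ}

/-- Pigeonhole: a monomial in the `h i` with all exponents below `q` has degree below `q * ∑ d i`.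
-/
theorem mem_span_pow_of_degree_ge (hS : invariantRing G = Algebra.adjoin k (Set.range h))
    (hh : ∀ i, (h i).IsHomogeneous (d i)) {q m : ℕ}
    (hm : q * (d 0 + d 1 + d 2) ≤ m) (hd : ∀ i, 0 < d i) (s : invariantRing G)
    (hs : s ∈ invGrading G m) :
    s ∈ Ideal.span (Set.range fun i =>
      (⟨h i, mem_invariantRing_of_eq_adjoin hS i⟩ : invariantRing G) ^ q) := by
  set g : Fin 3 → invariantRing G := fun i => ⟨h i, mem_invariantRing_of_eq_adjoin hS i⟩ with hg
  have htop : s ∈ Algebra.adjoin k (Set.range g) := by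
    rw [hg, adjoin_eq_top hS]
    exact Algebra.mem_top
  rw [Algebra.adjoin_range_eq_range_aeval] at htop
  obtain ⟨F, rfl⟩ := htop
  have hmon : ∀ c : Fin 3 →₀ ℕ, ∏ i, g i ^ c i ∈ invGrading G (∑ i, c i * d i) := by
    intro c
    exact SetLike.prod_pow_mem_graded (invGrading G) (i := d) (g := g) c fun i _ => hh i
  have hF : aeval g F = ∑ c ∈ F.support, coeff c F • ∏ i, g i ^ c i := by
    rw [aeval_def, eval₂_eq']
    simp only [Algebra.smul_def]
  have h1 := DirectSum.decompose_of_mem_same (invGrading G) hs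
  change ((DirectSum.decompose (invGrading G) (aeval g F)) m : invariantRing G) = _ at h1
  change aeval g F ∈ _
  rw [← show _ = aeval g F from h1, hF, DirectSum.decompose_sum, DFinsupp.finsetSum_apply,
    AddSubmonoidClass.coe_finsetSum]
  refine Submodule.sum_mem _ fun c _ => ?_
  have hc := Submodule.smul_mem _ (coeff c F) (hmon c)
  by_cases hcm : ∑ i, c i * d i = m
  · rw [hcm] at hc
    rw [DirectSum.decompose_of_mem_same (invGrading G) hc]
    have hex : ∃ i, q ≤ c i := by
      by_contra! hlt
      rw [Fin.sum_univ_three] at hcm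
      have e0 := Nat.mul_lt_mul_of_pos_right (hlt 0) (hd 0)
      have e1 := Nat.mul_lt_mul_of_pos_right (hlt 1) (hd 1)
      have e2 := Nat.mul_lt_mul_of_pos_right (hlt 2) (hd 2)
      have : q * (d 0 + d 1 + d 2) = q * d 0 + q * d 1 + q * d 2 := by ring
      omega
    obtain ⟨i, hi⟩ := hex
    refine Submodule.smul_of_tower_mem _ _ ?_
    rw [← Finset.mul_prod_erase _ _ (Finset.mem_univ i), ← Nat.sub_add_cancel hi, pow_add]
    exact Ideal.mul_mem_right _ _ (Ideal.mul_mem_left _ _ (Ideal.subset_span ⟨i, rfl⟩))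
  · rw [DirectSum.decompose_of_mem_ne (invGrading G) hc hcm]
    exact Submodule.zero_mem _

end Quotient

end HilbertKunz

namespace HilbertKunz

/-! ### Passage to the limit: density function and multiplicity. -/

section Limit

variable {k : Type*} [Field k] {G : Subgroup (SpecialLinearGroup (Fin 2) k)}
  {a b h : Fin 3 → MvPolynomial (Fin 2) k} {d : Fin 3 → ℕ} {l : ℕ}

/-- Only `j = 0` contributes, since `S` lives in degrees divisible by `n`; the exponent `dim S - 1`
is `1`. -/
theorem stepDensity_eq [Finite G] (p : ℕ)
    (hS : invariantRing G = Algebra.adjoin k (Set.range h)) (H : IsMinors a b h d l)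
    {n : ℕ} (hn : 0 < n) (hd : ∀ i, n ∣ d i) (hmax : ∀ x, (∀ i, x ∣ d i) → x ∣ n)
    (N : ℕ) (x : ℝ) :
    stepDensity (invGrading G) (gradedMaximalIdeal G) p N x =
      gradedLength (invGrading G) (frobPower (gradedMaximalIdeal G) (p ^ N))
        (n * ⌊x * (p : ℝ) ^ N⌋₊) / (p : ℝ) ^ N := by
  rw [stepDensity, degreeGCD_eq hS H.homogeneous H.ne_zero hn hd hmax, dim_invariantRing,
    Finset.sum_eq_single_of_mem 0 (Finset.mem_range.mpr hn), add_zero, mul_comm n]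
  · norm_num
  · intro j hj hj0
    rw [gradedLength_eq_zero _ hS H hd, Nat.cast_zero]
    rw [Nat.dvd_add_right (dvd_mul_left _ _)]
    exact fun h => absurd (Nat.le_of_dvd (Nat.pos_of_ne_zero hj0) h)
      (not_le.mpr (Finset.mem_range.mp hj))

/-- Replacing `⌊x q⌋` by `x q` moves the degree by at most `n`, hence the profile by at most `6 n`,
and the profile carries a factor `n`. -/
theorem exists_stepDensity_bound [Finite G] (p : ℕ) [Fact p.Prime] [CharP k p]
    (hS : invariantRing G = Algebra.adjoin k (Set.range h)) (H : IsMinors a b h d l)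
    {n : ℕ} (hn : 0 < n) (hd : ∀ i, n ∣ d i) (hmax : ∀ x, (∀ i, x ∣ d i) → x ∣ n) :
    ∃ C : ℝ, ∀ (N : ℕ) (x : ℝ), 0 ≤ x →
      |stepDensity (invGrading G) (gradedMaximalIdeal G) p N x -
        n / Nat.card G * profile (fun i => d i) l (n * x)| ≤ C / (p : ℝ) ^ N := by
  obtain ⟨C, hC⟩ := exists_gradedLength_bound p hS H hn hd hmax
  refine ⟨(C + n * (6 * n)) / Nat.card G, fun N x hx => ?_⟩
  have hq : (0 : ℝ) < (p : ℝ) ^ N := by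
    have := (Fact.out : p.Prime).pos
    positivity
  have hG : (0 : ℝ) < Nat.card G := by exact_mod_cast Nat.card_pos
  rw [stepDensity_eq p hS H hn hd hmax]
  set q : ℝ := (p : ℝ) ^ N
  have h1 := hC N ⌊x * q⌋₊
  set L : ℝ := ((gradedLength (invGrading G) (frobPower (gradedMaximalIdeal G) (p ^ N))
    (n * ⌊x * q⌋₊) : ℕ) : ℝ)
  have h2 := abs_profile_sub_le (fun i => d i * q) (l * q) (n * ⌊x * q⌋₊ : ℕ) (n * x * q)
  rw [profile_mul _ _ _ hq.le] at h2
  have h3 : |((n * ⌊x * q⌋₊ : ℕ) : ℝ) - n * x * q| ≤ n := by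
    have e1 := Nat.floor_le (mul_nonneg hx hq.le)
    have e2 := (Nat.lt_floor_add_one (x * q)).le
    have hn0 : (0 : ℝ) ≤ n := by positivity
    push_cast
    rw [abs_le]
    constructor <;> nlinarith
  have h4 : |(Nat.card G : ℝ) * L - n * (profile (fun i => d i) l (n * x) * q)| ≤
      C + n * (6 * n) := by
    have e := abs_le.mp (h2.trans (mul_le_mul_of_nonneg_left h3 (by norm_num)))
    have e' := abs_le.mp h1
    have hn0 : (0 : ℝ) ≤ n := by positivity
    have e1 := mul_le_mul_of_nonneg_left e.1 hn0
    have e2 := mul_le_mul_of_nonneg_left e.2 hn0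
    rw [abs_le]
    constructor <;> linarith
  have h5 : L / q - n / Nat.card G * profile (fun i => d i) l (n * x) =
      ((Nat.card G : ℝ) * L - n * (profile (fun i => d i) l (n * x) * q)) / (Nat.card G * q) := by
    field_simp
  rw [h5, abs_div, abs_of_pos (mul_pos hG hq), div_div]
  gcongr

/-- The Hilbert–Kunz density function of a ring of invariants generated by the maximal minors of a
`2 × 3` matrix. -/
theorem isHKDensity_profile [Finite G] (p : ℕ) [Fact p.Prime] [CharP k p]
    (hS : invariantRing G = Algebra.adjoin k (Set.range h)) (H : IsMinors a b h d l)
    {n : ℕ} (hn : 0 < n) (hd : ∀ i, n ∣ d i) (hmax : ∀ x, (∀ i, x ∣ d i) → x ∣ n) :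
    IsHKDensity (invGrading G) (gradedMaximalIdeal G) p
      (fun x => n / Nat.card G * profile (fun i => d i) l (n * x)) := by
  obtain ⟨C, hC⟩ := exists_stepDensity_bound p hS H hn hd hmax
  have hp : (1 : ℝ) < p := by exact_mod_cast (Fact.out : p.Prime).one_lt
  -- The second summand is due to the right node `x + 1 / q`: it moves the argument of the profile
  -- by `n / q`, hence its value by at most `6 n / q`.
  have hlim : Tendsto (fun N : ℕ => (C + n / Nat.card G * (6 * n)) / (p : ℝ) ^ N) atTop (𝓝 0) :=
    tendsto_const_nhds.div_atTop (tendsto_pow_atTop_atTop_of_one_lt hp)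
  rw [IsHKDensity, Metric.tendstoUniformlyOn_iff]
  intro ε hε
  filter_upwards [hlim.eventually_lt_const hε] with N hN x hx
  refine lt_of_le_of_lt ?_ hN
  have hx : 0 ≤ x := hx
  have hq : (0 : ℝ) < (p : ℝ) ^ N := by positivity
  rw [dist_comm, Real.dist_eq, interpDensity]
  have h1 := abs_le.mp (hC N x hx)
  have h2 := abs_le.mp (hC N (x + 1 / (p : ℝ) ^ N) (by positivity))
  have h3 := abs_profile_sub_le (fun i => d i) l (n * (x + 1 / (p : ℝ) ^ N)) (n * x)
  rw [show (n : ℝ) * (x + 1 / (p : ℝ) ^ N) - n * x = n / (p : ℝ) ^ N by ring,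
    abs_of_nonneg (a := (n : ℝ) / (p : ℝ) ^ N) (by positivity)] at h3
  have hc : (0 : ℝ) ≤ n / Nat.card G := by positivity
  have h4 := abs_le.mp h3
  have h5 := mul_le_mul_of_nonneg_left h4.1 hc
  have h6 := mul_le_mul_of_nonneg_left h4.2 hc
  rw [mul_sub, mul_neg] at h5
  rw [mul_sub] at h6
  set θ := Int.fract (x * (p : ℝ) ^ N)
  have hθ0 : 0 ≤ θ := Int.fract_nonneg _
  have hθ1 : 0 ≤ 1 - θ := sub_nonneg.mpr (Int.fract_lt_one _).le
  have e0 : (C + n / Nat.card G * (6 * n)) / (p : ℝ) ^ N =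
      C / (p : ℝ) ^ N + n / Nat.card G * (6 * (n / (p : ℝ) ^ N)) := by ring
  rw [e0]
  have e2 : (0 : ℝ) ≤ n / Nat.card G * (6 * (n / (p : ℝ) ^ N)) := by positivity
  generalize C / (p : ℝ) ^ N = c at *
  generalize (n : ℝ) / Nat.card G * (6 * (n / (p : ℝ) ^ N)) = c' at *
  generalize stepDensity (invGrading G) (gradedMaximalIdeal G) p N x = A at *
  generalize stepDensity (invGrading G) (gradedMaximalIdeal G) p N (x + 1 / (p : ℝ) ^ N) = B at *
  generalize (n : ℝ) / Nat.card G * profile (fun i => d i) l (n * x) = u at *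
  generalize (n : ℝ) / Nat.card G * profile (fun i => d i) l (n * (x + 1 / (p : ℝ) ^ N)) = v at *
  have i1 : |A - u| ≤ c + c' := abs_le.mpr ⟨by linarith, by linarith⟩
  have i2 : |B - u| ≤ c + c' := abs_le.mpr ⟨by linarith, by linarith⟩
  -- The interpolation is a convex combination of the values at the two nodes, so it inherits their
  -- common error bound.
  calc |(1 - θ) * A + θ * B - u| = |(1 - θ) * (A - u) + θ * (B - u)| := by ring_nf
    _ ≤ |(1 - θ) * (A - u)| + |θ * (B - u)| := abs_add_le _ _
    _ = (1 - θ) * |A - u| + θ * |B - u| := by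
      rw [abs_mul, abs_mul, abs_of_nonneg hθ1, abs_of_nonneg hθ0]
    _ ≤ (1 - θ) * (c + c') + θ * (c + c') := by gcongr
    _ = c + c' := by ring

/-- The sum is compared with the integral `(M - x)₊² / 2`; each further term changes the difference
by at most `1`. -/
theorem abs_sum_max_sub_le {x : ℝ} (hx : 0 ≤ x) (M : ℕ) :
    |∑ t ∈ Finset.range M, max ((t : ℝ) - x) 0 - max ((M : ℝ) - x) 0 ^ 2 / 2| ≤ (M : ℝ) := by
  induction M with
  | zero =>
    rw [Nat.cast_zero, zero_sub, max_eq_right (neg_nonpos.mpr hx)]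
    simp
  | succ M ih =>
    rw [Finset.sum_range_succ]
    push_cast
    have h := abs_le.mp ih
    have key : |max ((M : ℝ) - x) 0 + max (M - x) 0 ^ 2 / 2 - max (M + 1 - x) 0 ^ 2 / 2| ≤ 1 := by
      rw [abs_le]
      rcases le_total (M - x) 0 with h1 | h1
      · rw [max_eq_right h1]
        rcases le_total (M + 1 - x) 0 with h2 | h2
        · rw [max_eq_right h2]
          norm_num
        · rw [max_eq_left h2]
          constructor <;> nlinarith
      · rw [max_eq_left h1, max_eq_left (by linarith)]
        constructor <;> nlinarith
    have h' := abs_le.mp key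
    rw [abs_le]
    constructor <;> linarith

/-- Every term of the profile is a positive part, `y` being `max (y - 0) 0` for `y ≥ 0`, so the
preceding estimate applies to each of them. The errors add up with weights `1 + 3 + 2`. -/
theorem abs_sum_profile_sub_le (n : ℕ) {M : ℕ} {d : Fin 3 → ℝ} {l : ℝ}
    (hd : ∀ i, 0 ≤ d i) (hl : 0 ≤ l) (hdM : ∀ i, d i ≤ n * M) (hlM : l ≤ n * M) (hn : 0 < n) :
    |∑ t ∈ Finset.range M, (n : ℝ) * profile d l (n * t : ℕ) -
      (((n : ℝ) * M) ^ 2 / 2 - ∑ i, ((n : ℝ) * M - d i) ^ 2 / 2 + ((n : ℝ) * M - l) ^ 2)| ≤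
      6 * (n : ℝ) ^ 2 * M := by
  have hn' : (0 : ℝ) < n := by exact_mod_cast hn
  have key : ∀ c : ℝ, 0 ≤ c → c ≤ n * M →
      |∑ t ∈ Finset.range M, (n : ℝ) * max (((n * t : ℕ) : ℝ) - c) 0 -
        ((n : ℝ) * M - c) ^ 2 / 2| ≤ (n : ℝ) ^ 2 * M := by
    intro c hc hcM
    have h1 := abs_sum_max_sub_le (div_nonneg hc hn'.le) M
    have hcM' : c / n ≤ M := by
      rw [div_le_iff₀ hn']
      linarith
    rw [max_eq_left (sub_nonneg.mpr hcM')] at h1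
    have h2 : ∀ t : ℕ, n * max (((n * t : ℕ) : ℝ) - c) 0 = n ^ 2 * max ((t : ℝ) - c / n) 0 := by
      intro t
      have h3 : ((n * t : ℕ) : ℝ) - c = n * (t - c / n) := by
        push_cast
        field_simp
      have h4 := mul_max_of_nonneg ((t : ℝ) - c / n) 0 hn'.le
      rw [mul_zero] at h4
      rw [h3, ← h4]
      ring
    simp only [h2, ← Finset.mul_sum]
    have h3 : (n * M - c) ^ 2 / 2 = (n : ℝ) ^ 2 * ((M - c / n) ^ 2 / 2) := by
      field_simp
    rw [h3, ← mul_sub, abs_mul, abs_of_nonneg (by positivity : (0 : ℝ) ≤ n ^ 2)]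
    gcongr
  have k0 := abs_le.mp (key _ (hd 0) (hdM 0))
  have k1 := abs_le.mp (key _ (hd 1) (hdM 1))
  have k2 := abs_le.mp (key _ (hd 2) (hdM 2))
  have k3 := abs_le.mp (key _ hl hlM)
  have k4 := abs_le.mp (key 0 le_rfl (by positivity))
  have hsum : ∑ t ∈ Finset.range M, (n : ℝ) * profile d l (n * t : ℕ) =
      ∑ t ∈ Finset.range M, (n : ℝ) * max ((n * t : ℕ) - (0 : ℝ)) 0
      - ∑ t ∈ Finset.range M, (n : ℝ) * max ((n * t : ℕ) - d 0) 0
      - ∑ t ∈ Finset.range M, (n : ℝ) * max ((n * t : ℕ) - d 1) 0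
      - ∑ t ∈ Finset.range M, (n : ℝ) * max ((n * t : ℕ) - d 2) 0
      + 2 * ∑ t ∈ Finset.range M, (n : ℝ) * max ((n * t : ℕ) - l) 0 := by
    rw [Finset.mul_sum, ← Finset.sum_sub_distrib, ← Finset.sum_sub_distrib,
      ← Finset.sum_sub_distrib, ← Finset.sum_add_distrib]
    refine Finset.sum_congr rfl fun t _ => ?_
    rw [profile, Fin.sum_univ_three, sub_zero, max_eq_left (Nat.cast_nonneg (n * t))]
    ring
  rw [hsum, Fin.sum_univ_three, abs_le]
  rw [sub_zero] at k4
  constructor <;> linarith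

/-- Everything of degree at least `q * ∑ d i = 2 l q` lies in `I^[q]`, so the length is a sum of
`O(q)` graded lengths, each known up to a bounded error. The total error `O(q)` vanishes after
division by `q ^ 2`. The limit is obtained directly, not by integrating the density. -/
theorem isHKMultiplicity_of_isMinors [Finite G] (p : ℕ) [Fact p.Prime] [CharP k p]
    (hS : invariantRing G = Algebra.adjoin k (Set.range h)) (H : IsMinors a b h d l)
    {n : ℕ} (hn : 0 < n) (hd : ∀ i, n ∣ d i) (hmax : ∀ x, (∀ i, x ∣ d i) → x ∣ n) :
    IsHKMultiplicity (gradedMaximalIdeal G) p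
      ((2 * l ^ 2 - ∑ i, (d i : ℝ) ^ 2) / (2 * Nat.card G)) := by
  have hppos : 0 < p := (Fact.out : p.Prime).pos
  -- `c = 2 l / n`, so the degrees `n * t` with `t < c * q` are the multiples of `n` below `2 l q`.
  obtain ⟨c, hc⟩ : n ∣ 2 * l := by
    rw [← H.sum_eq]
    exact dvd_add (dvd_add (hd 0) (hd 1)) (hd 2)
  have key : ∀ N : ℕ, Module.length (invariantRing G)
      (invariantRing G ⧸ frobPower (gradedMaximalIdeal G) (p ^ N)) =
      ((∑ t ∈ Finset.range (c * p ^ N), gradedLength (invGrading G)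
        (frobPower (gradedMaximalIdeal G) (p ^ N)) (n * t) : ℕ) : ℕ∞) := by
    intro N
    set J := frobPower (gradedMaximalIdeal G) (p ^ N) with hJdef
    have hJ : J = Ideal.span (Set.range fun i =>
        (⟨h i, mem_invariantRing_of_eq_adjoin hS i⟩ : invariantRing G) ^ p ^ N) :=
      frobPower_gradedMaximalIdeal hS H.pos H.homogeneous p N
    have hhom : J.IsHomogeneous (invGrading G) := by
      rw [hJ]
      refine Ideal.homogeneous_span _ _ ?_
      rintro _ ⟨i, rfl⟩
      exact ⟨_, SetLike.pow_mem_graded (A := invGrading G) (p ^ N) (i := d i) (H.homogeneous i)⟩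
    have hvan : ∀ m, n * (c * p ^ N) ≤ m → ∀ s ∈ invGrading G m, s ∈ J := by
      intro m hm s hs
      rw [hJ]
      refine mem_span_pow_of_degree_ge hS H.homogeneous (le_trans (le_of_eq ?_) hm) H.pos s hs
      rw [H.sum_eq, hc]
      ring
    obtain ⟨hfin, hrank⟩ := finrank_quotient_eq_sum_gradedLength (invGrading G) hhom hvan
    have hres : ∀ s : invariantRing G, ∃ e : k,
        s - algebraMap k (invariantRing G) e ∈ gradedMaximalIdeal G := by
      rw [gradedMaximalIdeal_eq_span hS H.pos H.homogeneous]
      exact exists_sub_algebraMap_mem_span hS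
    have hfg : (gradedMaximalIdeal G).FG := by
      rw [gradedMaximalIdeal_eq_span hS H.pos H.homogeneous]
      exact ⟨(Set.finite_range _).toFinset, by rw [Set.Finite.coe_toFinset]⟩
    rw [length_quotient_eq_finrank (k := k) (I := gradedMaximalIdeal G) (J := J) hres hfg (fun s hs =>
      ⟨p ^ N, Ideal.subset_span ⟨s, hs, rfl⟩⟩), hrank]
    norm_cast
    -- Degrees not divisible by `n` contribute nothing.
    rw [← Finset.sum_subset_zero_on_sdiff (s₁ := (Finset.range (c * p ^ N)).image (n * ·))
      (f := fun m => gradedLength (invGrading G) J m) ?_ ?_ (fun _ _ => rfl)]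
    · exact Finset.sum_image fun x _ y _ hxy => Nat.eq_of_mul_eq_mul_left hn hxy
    · intro m hm
      obtain ⟨t, ht, rfl⟩ := Finset.mem_image.mp hm
      exact Finset.mem_range.mpr (Nat.mul_lt_mul_of_pos_left (Finset.mem_range.mp ht) hn)
    · intro m hm
      rw [Finset.mem_sdiff, Finset.mem_range] at hm
      refine gradedLength_eq_zero _ hS H hd ?_
      rintro ⟨t, rfl⟩
      exact hm.2 (Finset.mem_image.mpr ⟨t, Finset.mem_range.mpr
        (lt_of_mul_lt_mul_left hm.1 n.zero_le), rfl⟩)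
  refine ⟨fun N => ?_, ?_⟩
  · rw [key]
    exact ENat.natCast_ne_top _
  have hp : (1 : ℝ) < p := by exact_mod_cast (Fact.out : p.Prime).one_lt
  have hG : (0 : ℝ) < Nat.card G := by exact_mod_cast Nat.card_pos
  obtain ⟨C, hC⟩ := exists_gradedLength_bound p hS H hn hd hmax
  have hlim : Tendsto (fun N : ℕ => ((C * c + 6 * n ^ 2 * c) / Nat.card G) / (p : ℝ) ^ N) atTop
      (𝓝 0) :=
    tendsto_const_nhds.div_atTop (tendsto_pow_atTop_atTop_of_one_lt hp)
  rw [tendsto_iff_dist_tendsto_zero]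
  refine squeeze_zero (fun _ => dist_nonneg) (fun N => ?_) hlim
  rw [key, ENat.toNat_natCast, dim_invariantRing, Real.dist_eq]
  have hq : (0 : ℝ) < (p : ℝ) ^ N := by positivity
  set q : ℝ := (p : ℝ) ^ N with hqdef
  have hcast : ((c * p ^ N : ℕ) : ℝ) = c * q := by
    push_cast
    rfl
  have hc' : (n : ℝ) * (c * q) = 2 * l * q := by
    rw [← mul_assoc]
    congr 1
    exact_mod_cast hc.symm
  have hdl : ∀ i, (d i : ℝ) ≤ l := fun i => by exact_mod_cast (H.lt i).le
  have hl0 : (0 : ℝ) ≤ l := by positivity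
  have h1 := abs_sum_profile_sub_le n (M := c * p ^ N) (d := fun i => d i * q) (l := l * q)
    (fun i => by positivity) (by positivity)
    (fun i => by
      rw [hcast, hc']
      exact mul_le_mul_of_nonneg_right (by linarith [hdl i]) hq.le)
    (by rw [hcast, hc']; exact mul_le_mul_of_nonneg_right (by linarith) hq.le) hn
  rw [hcast, hc', Fin.sum_univ_three] at h1
  push_cast
  set Λ : ℕ → ℝ := fun t => ((gradedLength (invGrading G)
    (frobPower (gradedMaximalIdeal G) (p ^ N)) (n * t) : ℕ) : ℝ)
  have h2 : |(Nat.card G : ℝ) * ∑ t ∈ Finset.range (c * p ^ N), Λ t -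
      ∑ t ∈ Finset.range (c * p ^ N), (n : ℝ) * profile (fun i => d i * q) (l * q) (n * t : ℕ)| ≤
      c * q * C := by
    rw [Finset.mul_sum, ← Finset.sum_sub_distrib]
    refine (Finset.abs_sum_le_sum_abs _ _).trans ?_
    refine (Finset.sum_le_card_nsmul _ _ C fun t _ => hC N t).trans_eq ?_
    rw [Finset.card_range, nsmul_eq_mul, hcast]
  have hsum : (d 0 : ℝ) + d 1 + d 2 = 2 * l := by exact_mod_cast H.sum_eq
  -- The terms linear in the `d i` are evaluated by `∑ d i = 2 l`.
  have h3 : (2 * l * q) ^ 2 / 2 - ((2 * l * q - d 0 * q) ^ 2 / 2 + (2 * l * q - d 1 * q) ^ 2 / 2 +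
      (2 * l * q - d 2 * q) ^ 2 / 2) + (2 * l * q - l * q) ^ 2 =
      (2 * l ^ 2 - (d 0 ^ 2 + d 1 ^ 2 + d 2 ^ 2)) / 2 * q ^ 2 := by
    linear_combination (2 * l * q ^ 2) * hsum
  rw [h3] at h1
  have h4 : |(Nat.card G : ℝ) * ∑ t ∈ Finset.range (c * p ^ N), Λ t -
      (2 * l ^ 2 - (d 0 ^ 2 + d 1 ^ 2 + d 2 ^ 2)) / 2 * q ^ 2| ≤ (C * c + 6 * n ^ 2 * c) * q := by
    have e1 := abs_le.mp h1
    have e2 := abs_le.mp h2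
    rw [abs_le]
    constructor <;> nlinarith
  have h5 : (∑ t ∈ Finset.range (c * p ^ N), Λ t) / q ^ 2 -
      (2 * l ^ 2 - ∑ i, (d i : ℝ) ^ 2) / (2 * Nat.card G) =
      (Nat.card G * ∑ t ∈ Finset.range (c * p ^ N), Λ t -
      (2 * l ^ 2 - (d 0 ^ 2 + d 1 ^ 2 + d 2 ^ 2)) / 2 * q ^ 2) / (Nat.card G * q ^ 2) := by
    rw [Fin.sum_univ_three]
    field_simp
  rw [h5, abs_div, abs_of_pos (by positivity : (0 : ℝ) < Nat.card G * q ^ 2)]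
  refine (div_le_div_of_nonneg_right h4 (by positivity)).trans_eq ?_
  field_simp

end Limit

end HilbertKunz

namespace HilbertKunz

/-! ### The integral of the density function. -/

section Integral

theorem continuous_profile (d : Fin 3 → ℝ) (l : ℝ) : Continuous (profile d l) := by
  unfold profile
  fun_prop

/-- From `l` on all positive parts are active, and what remains is `∑ d i - 2 l = 0`. -/
theorem profile_eq_zero_of_ge {d : Fin 3 → ℝ} {l y : ℝ} (hd : ∀ i, d i ≤ l)
    (hsum : d 0 + d 1 + d 2 = 2 * l) (hy : l ≤ y) : profile d l y = 0 := by
  have h : ∀ i, max (y - d i) 0 = y - d i := fun i =>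
    max_eq_left (sub_nonneg.mpr ((hd i).trans hy))
  rw [profile, Fin.sum_univ_three, h, h, h, max_eq_left (sub_nonneg.mpr hy)]
  linarith

theorem integral_max_sub {c B : ℝ} (hc : 0 ≤ c) (hcB : c ≤ B) :
    ∫ y in (0 : ℝ)..B, max (y - c) 0 = (B - c) ^ 2 / 2 := by
  have hcont : Continuous fun y : ℝ => max (y - c) 0 := by fun_prop
  rw [← intervalIntegral.integral_add_adjacent_intervals (hcont.intervalIntegrable 0 c)
    (hcont.intervalIntegrable c B)]
  have h1 : ∫ y in (0 : ℝ)..c, max (y - c) 0 = ∫ _y in (0 : ℝ)..c, (0 : ℝ) := by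
    refine intervalIntegral.integral_congr fun y hy => ?_
    rw [Set.uIcc_of_le hc] at hy
    exact max_eq_right (sub_nonpos.mpr hy.2)
  have h2 : ∫ y in c..B, max (y - c) 0 = ∫ y in c..B, (y - c) := by
    refine intervalIntegral.integral_congr fun y hy => ?_
    rw [Set.uIcc_of_le hcB] at hy
    exact max_eq_left (sub_nonneg.mpr hy.1)
  rw [h1, h2, intervalIntegral.integral_zero, zero_add, intervalIntegral.integral_comp_sub_right
    (fun y => y), sub_self, integral_id]
  ring

/-- Each positive part integrates to half a square, and `∑ d i = 2 l` removes the mixed terms.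
Divided by `|G|`, this is the limit in `isHKMultiplicity_of_isMinors`. -/
theorem integral_profile {d : Fin 3 → ℝ} {l : ℝ} (hd0 : ∀ i, 0 ≤ d i) (hl : 0 ≤ l)
    (hd : ∀ i, d i ≤ l) (hsum : d 0 + d 1 + d 2 = 2 * l) :
    ∫ y in (0 : ℝ)..l, profile d l y = (2 * l ^ 2 - ∑ i, d i ^ 2) / 2 := by
  have hint : ∀ c : ℝ, IntervalIntegrable (fun y : ℝ => max (y - c) 0) MeasureTheory.volume 0 l :=
    fun c => (by fun_prop : Continuous fun y : ℝ => max (y - c) 0).intervalIntegrable _ _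
  have h0 : IntervalIntegrable (fun y : ℝ => y) MeasureTheory.volume 0 l :=
    continuous_id.intervalIntegrable _ _
  simp only [profile, Fin.sum_univ_three]
  rw [intervalIntegral.integral_add (h0.sub (((hint _).add (hint _)).add (hint _)))
      ((hint _).const_mul _),
    intervalIntegral.integral_sub h0 (((hint _).add (hint _)).add (hint _)),
    intervalIntegral.integral_add ((hint _).add (hint _)) (hint _),
    intervalIntegral.integral_add (hint _) (hint _), intervalIntegral.integral_const_mul,
    integral_max_sub (hd0 0) (hd 0), integral_max_sub (hd0 1) (hd 1),
    integral_max_sub (hd0 2) (hd 2), integral_max_sub hl le_rfl, integral_id]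
  linear_combination l * hsum

theorem integral_density {f : ℝ → ℝ} {d : Fin 3 → ℝ} {l n c : ℝ} (hn : 0 < n)
    (hf : ∀ x, 0 ≤ x → f x = n / c * profile d l (n * x))
    (hd0 : ∀ i, 0 ≤ d i) (hl : 0 ≤ l) (hd : ∀ i, d i ≤ l) (hsum : d 0 + d 1 + d 2 = 2 * l) :
    MeasureTheory.IntegrableOn f (Set.Ioi 0) ∧
      ∫ x in Set.Ioi (0 : ℝ), f x = (2 * l ^ 2 - ∑ i, d i ^ 2) / (2 * c) := by
  have hln : 0 ≤ l / n := by positivity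
  have hcont : Continuous fun x => n / c * profile d l (n * x) :=
    ((continuous_profile d l).comp (continuous_const.mul continuous_id)).const_mul _
  have hI1 : MeasureTheory.IntegrableOn f (Set.Ioc 0 (l / n)) := by
    refine ((hcont.intervalIntegrable 0 (l / n)).1).congr_fun (fun x hx => ?_) measurableSet_Ioc
    exact (hf x hx.1.le).symm
  have hz : ∀ x ∈ Set.Ioi (l / n), f x = 0 := by
    intro x hx
    have hx' : l / n < x := hx
    rw [hf x (hln.trans hx'.le), profile_eq_zero_of_ge hd hsum, mul_zero]
    rw [div_lt_iff₀ hn] at hx'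
    linarith
  have hI2 : MeasureTheory.IntegrableOn f (Set.Ioi (l / n)) := by
    refine MeasureTheory.integrableOn_zero.congr_fun (fun x hx => ?_) measurableSet_Ioi
    exact (hz x hx).symm
  refine ⟨?_, ?_⟩
  · rw [← Set.Ioc_union_Ioi_eq_Ioi hln]
    exact hI1.union hI2
  · rw [← Set.Ioc_union_Ioi_eq_Ioi hln, MeasureTheory.setIntegral_union
      (Set.Ioc_disjoint_Ioi le_rfl) measurableSet_Ioi hI1 hI2,
      MeasureTheory.setIntegral_congr_fun measurableSet_Ioi (g := fun _ => (0 : ℝ)) hz,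
      MeasureTheory.integral_zero, add_zero,
      MeasureTheory.setIntegral_congr_fun measurableSet_Ioc
        (g := fun x => n / c * profile d l (n * x)) (fun x hx => hf x hx.1.le),
      ← intervalIntegral.integral_of_le hln, intervalIntegral.integral_const_mul,
      intervalIntegral.integral_comp_mul_left _ hn.ne', mul_zero, mul_div_cancel₀ _ hn.ne',
      integral_profile hd0 hl hd hsum, smul_eq_mul]
    field_simp

end Integral

end HilbertKunz

/-! ### Numerical data of the types: degrees, multiplicity and shape of the density. -/

namespace KleinType

open HilbertKunz

/-- The greatest common divisor of the degrees of the generators. -/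
def degreeStep : KleinType → ℕ
  | A n => if Even n then 2 else 1
  | _ => 2

theorem degreeStep_pos (t : KleinType) : 0 < t.degreeStep := by
  cases t <;> simp only [degreeStep] <;> (try split_ifs) <;> norm_num

theorem degreeStep_dvd (t : KleinType) (i : Fin 3) : t.degreeStep ∣ t.degrees i := by
  cases t with
  | A n =>
    simp only [degreeStep, degrees]
    split_ifs with h
    · fin_cases i
      · exact dvd_rfl
      · exact h.two_dvd
      · exact h.two_dvd
    · exact one_dvd _
  | D n =>
    fin_cases i
    · exact ⟨2, rfl⟩
    · exact dvd_mul_right _ _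
    · exact ⟨n + 1, by simp [degrees, degreeStep]; ring⟩
  | E6 => revert i; decide
  | E7 => revert i; decide
  | E8 => revert i; decide

/-- Outside type `A` the step is an integer combination of the degrees: `(2n + 2) - 2n`, `8 - 6`,
`18 - (8 + 8)` and `(12 + 20) - 30`. -/
theorem dvd_degreeStep (t : KleinType) (x : ℕ) (hx : ∀ i, x ∣ t.degrees i) :
    x ∣ t.degreeStep := by
  have h0 := hx 0
  have h1 := hx 1
  have h2 := hx 2
  cases t with
  | A n =>
    simp only [degrees, degreeStep, cons_val_zero, cons_val_one] at h0 h1 ⊢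
    split_ifs with h
    · exact h0
    · have := Nat.dvd_gcd h0 h1
      rwa [Nat.Coprime.gcd_eq_one (Nat.coprime_two_left.mpr (Nat.not_even_iff_odd.mp h))] at this
  | D n =>
    have h3 := Nat.dvd_sub h2 h1
    simpa [degrees, degreeStep] using h3
  | E6 => simpa [degrees, degreeStep] using Nat.dvd_sub h1 h0
  | E7 => simpa [degrees, degreeStep] using (Nat.dvd_sub h2 (dvd_add h0 h0))
  | E8 => simpa [degrees, degreeStep] using (Nat.dvd_sub (dvd_add h0 h2) h1)

theorem sum_degrees (t : KleinType) :
    t.degrees 0 + t.degrees 1 + t.degrees 2 = 2 * t.syzygyDegree := by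
  cases t <;> simp [degrees, syzygyDegree] <;> ring

theorem degrees_pos {t : KleinType} (ht : t.IsValid) (i : Fin 3) : 0 < t.degrees i := by
  cases t with
  | A n =>
    have ht : 2 ≤ n := ht
    fin_cases i <;> simp [degrees] <;> omega
  | D n =>
    have ht : 2 ≤ n := ht
    fin_cases i <;> simp [degrees]
    omega
  | E6 => revert i; decide
  | E7 => revert i; decide
  | E8 => revert i; decide

theorem degrees_lt {t : KleinType} (ht : t.IsValid) (i : Fin 3) :
    t.degrees i < t.syzygyDegree := by
  cases t with
  | A n =>
    have ht : 2 ≤ n := ht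
    fin_cases i <;> simp [degrees, syzygyDegree]
    omega
  | D n =>
    have ht : 2 ≤ n := ht
    fin_cases i <;> simp [degrees, syzygyDegree]
    omega
  | E6 => revert i; decide
  | E7 => revert i; decide
  | E8 => revert i; decide

/-- In every type `2 l² - ∑ dᵢ² = 4 |G| - 2`. -/
theorem multiplicity_eq {t : KleinType} (ht : t.IsValid) :
    (2 * (t.syzygyDegree : ℝ) ^ 2 - ∑ i, (t.degrees i : ℝ) ^ 2) / (2 * t.order) =
      2 - 1 / t.order := by
  rw [Fin.sum_univ_three]
  cases t with
  | A n =>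
    have ht : 2 ≤ n := ht
    have : (n : ℝ) ≠ 0 := by
      have : n ≠ 0 := by omega
      exact_mod_cast this
    simp [degrees, syzygyDegree, order]
    field_simp
    ring
  | D n =>
    have ht : 2 ≤ n := ht
    have : (n : ℝ) ≠ 0 := by
      have : n ≠ 0 := by omega
      exact_mod_cast this
    simp [degrees, syzygyDegree, order]
    field_simp
    ring
  | E6 =>
    simp only [degrees, syzygyDegree, order, cons_val_zero, cons_val_one, cons_val]
    norm_num
  | E7 =>
    simp only [degrees, syzygyDegree, order, cons_val_zero, cons_val_one, cons_val]
    norm_num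
  | E8 =>
    simp only [degrees, syzygyDegree, order, cons_val_zero, cons_val_one, cons_val]
    norm_num

set_option maxHeartbeats 1000000 in
-- The break points solve `n₀ x = dᵢ` and `n₀ x = l`. Once the signs of these differences are fixed,
-- both sides are affine in `x`; the sign patterns that contradict the chosen interval are
-- discarded.
theorem density_eq {t : KleinType} (ht : t.IsValid) (x : ℝ) :
    t.density x = t.degreeStep / t.order *
      profile (fun i => t.degrees i) t.syzygyDegree (t.degreeStep * x) := by
  have hmax : ∀ u : ℝ, (0 ≤ u ∧ max u 0 = u) ∨ (u ≤ 0 ∧ max u 0 = 0) := fun u =>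
    (le_total 0 u).imp (fun h => ⟨h, max_eq_left h⟩) fun h => ⟨h, max_eq_right h⟩
  simp only [profile, Fin.sum_univ_three]
  cases t with
  | A n =>
    have ht : 2 ≤ n := ht
    have ht' : (2 : ℝ) ≤ n := by exact_mod_cast ht
    have hn : (n : ℝ) ≠ 0 := by positivity
    simp only [density, degrees, degreeStep, syzygyDegree, order, cons_val_zero, cons_val_one,
      cons_val]
    by_cases he : Even n
    · simp only [if_pos he]
      push_cast
      rcases hmax (2 * x - 2) with ⟨h0, e0⟩ | ⟨h0, e0⟩ <;>
      rcases hmax (2 * x - n) with ⟨h1, e1⟩ | ⟨h1, e1⟩ <;>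
      rcases hmax (2 * x - (n + 1)) with ⟨h2, e2⟩ | ⟨h2, e2⟩ <;>
      rw [e0, e1, e2] <;>
      split_ifs <;> first | (exfalso; linarith) | (field_simp; linarith)
    · simp only [if_neg he]
      push_cast
      rcases hmax (1 * x - 2) with ⟨h0, e0⟩ | ⟨h0, e0⟩ <;>
      rcases hmax (1 * x - n) with ⟨h1, e1⟩ | ⟨h1, e1⟩ <;>
      rcases hmax (1 * x - (n + 1)) with ⟨h2, e2⟩ | ⟨h2, e2⟩ <;>
      rw [e0, e1, e2] <;>
      split_ifs <;> first | (exfalso; linarith) | (field_simp; linarith)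
  | D n =>
    have ht : 2 ≤ n := ht
    have ht' : (2 : ℝ) ≤ n := by exact_mod_cast ht
    have hn : (n : ℝ) ≠ 0 := by positivity
    simp only [density, degrees, degreeStep, syzygyDegree, order, cons_val_zero, cons_val_one,
      cons_val]
    push_cast
    rcases hmax (2 * x - 4) with ⟨h0, e0⟩ | ⟨h0, e0⟩ <;>
    rcases hmax (2 * x - 2 * n) with ⟨h1, e1⟩ | ⟨h1, e1⟩ <;>
    rcases hmax (2 * x - (2 * n + 2)) with ⟨h2, e2⟩ | ⟨h2, e2⟩ <;>
    rcases hmax (2 * x - (2 * n + 3)) with ⟨h3, e3⟩ | ⟨h3, e3⟩ <;>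
    rw [e0, e1, e2, e3] <;>
    split_ifs <;> first | (exfalso; linarith) | (field_simp; linarith)
  | E6 =>
    simp only [density, degrees, degreeStep, syzygyDegree, order, cons_val_zero, cons_val_one,
      cons_val]
    push_cast
    rcases hmax (2 * x - 6) with ⟨h0, e0⟩ | ⟨h0, e0⟩ <;>
    rcases hmax (2 * x - 8) with ⟨h1, e1⟩ | ⟨h1, e1⟩ <;>
    rcases hmax (2 * x - 12) with ⟨h2, e2⟩ | ⟨h2, e2⟩ <;>
    rcases hmax (2 * x - 13) with ⟨h3, e3⟩ | ⟨h3, e3⟩ <;>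
    rw [e0, e1, e2, e3] <;>
    split_ifs <;> linarith
  | E7 =>
    simp only [density, degrees, degreeStep, syzygyDegree, order, cons_val_zero, cons_val_one,
      cons_val]
    push_cast
    rcases hmax (2 * x - 8) with ⟨h0, e0⟩ | ⟨h0, e0⟩ <;>
    rcases hmax (2 * x - 12) with ⟨h1, e1⟩ | ⟨h1, e1⟩ <;>
    rcases hmax (2 * x - 18) with ⟨h2, e2⟩ | ⟨h2, e2⟩ <;>
    rcases hmax (2 * x - 19) with ⟨h3, e3⟩ | ⟨h3, e3⟩ <;>
    rw [e0, e1, e2, e3] <;>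
    split_ifs <;> linarith
  | E8 =>
    simp only [density, degrees, degreeStep, syzygyDegree, order, cons_val_zero, cons_val_one,
      cons_val]
    push_cast
    rcases hmax (2 * x - 12) with ⟨h0, e0⟩ | ⟨h0, e0⟩ <;>
    rcases hmax (2 * x - 30) with ⟨h1, e1⟩ | ⟨h1, e1⟩ <;>
    rcases hmax (2 * x - 20) with ⟨h2, e2⟩ | ⟨h2, e2⟩ <;>
    rcases hmax (2 * x - 31) with ⟨h3, e3⟩ | ⟨h3, e3⟩ <;>
    rw [e0, e1, e2, e3] <;>
    split_ifs <;> linarith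

end KleinType

namespace KleinType

open HilbertKunz

variable {k : Type*} [Field k]

/-! ### Conjugation -/

/-- The conjugate `P g P⁻¹`. -/
noncomputable def conj (P : GL (Fin 2) k) (g : SpecialLinearGroup (Fin 2) k) :
    SpecialLinearGroup (Fin 2) k :=
  ⟨P.val * g * P⁻¹.val, by
    rw [det_mul, det_mul, g.det_coe, mul_one, ← det_mul, Units.mul_inv, det_one]⟩

theorem conj_coe (P : GL (Fin 2) k) (g : SpecialLinearGroup (Fin 2) k) :
    (conj P g : Matrix (Fin 2) (Fin 2) k) = P.val * g * P⁻¹.val := rfl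

theorem conj_injective (P : GL (Fin 2) k) : Function.Injective (conj P) := by
  intro g g' h
  have h1 := congrArg (fun x : SpecialLinearGroup (Fin 2) k => P⁻¹.val * x.val * P.val) h
  simp only [conj_coe] at h1
  apply Subtype.ext
  simpa [Matrix.mul_assoc] using h1

theorem card_eq_of_conj {G H : Subgroup (SpecialLinearGroup (Fin 2) k)} {P : GL (Fin 2) k}
    (hGH : ∀ g : SpecialLinearGroup (Fin 2) k, g ∈ G ↔
      ∃ h ∈ H, (g : Matrix (Fin 2) (Fin 2) k) = P.val * h * P⁻¹.val) :
    Nat.card G = Nat.card H := by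
  refine (Nat.card_congr (Equiv.ofBijective (fun h : H =>
    (⟨conj P h, (hGH _).mpr ⟨h, h.2, rfl⟩⟩ : G)) ⟨fun h h' hh => ?_, fun g => ?_⟩)).symm
  · exact Subtype.ext (conj_injective P (congrArg Subtype.val hh))
  · obtain ⟨h, hh, hg⟩ := (hGH g).mp g.2
    exact ⟨⟨h, hh⟩, Subtype.ext (Subtype.ext hg.symm)⟩

theorem subst_inv_subst (P : GL (Fin 2) k) (f : MvPolynomial (Fin 2) k) :
    subst P⁻¹.val (subst P.val f) = f := by
  rw [subst_subst, ← Units.val_mul, mul_inv_cancel, Units.val_one, subst_one]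

theorem subst_subst_inv (P : GL (Fin 2) k) (f : MvPolynomial (Fin 2) k) :
    subst P.val (subst P⁻¹.val f) = f := by
  rw [subst_subst, ← Units.val_mul, inv_mul_cancel, Units.val_one, subst_one]

/-- Substitutions compose in reverse order, so applying `subst P⁻¹` and then `subst (P h P⁻¹)` is
the same as applying `subst h` and then `subst P⁻¹`. -/
theorem invariantRing_eq_map_of_conj {G H : Subgroup (SpecialLinearGroup (Fin 2) k)}
    {P : GL (Fin 2) k} (hGH : ∀ g : SpecialLinearGroup (Fin 2) k, g ∈ G ↔
      ∃ h ∈ H, (g : Matrix (Fin 2) (Fin 2) k) = P.val * h * P⁻¹.val) :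
    invariantRing G = (invariantRing H).map (subst P⁻¹.val) := by
  have key : ∀ (h : SpecialLinearGroup (Fin 2) k) (f : MvPolynomial (Fin 2) k),
      subst (P.val * h.val * P⁻¹.val) (subst P⁻¹.val f) = subst P⁻¹.val (subst h.val f) := by
    intro h f
    rw [subst_subst, subst_subst, ← Matrix.mul_assoc, ← Matrix.mul_assoc, ← Units.val_mul,
      inv_mul_cancel, Units.val_one, Matrix.one_mul]
  ext f
  rw [Subalgebra.mem_map]
  constructor
  · intro hf
    refine ⟨subst P.val f, fun h hh => ?_, subst_inv_subst P f⟩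
    have h1 := hf (conj P h) ((hGH _).mpr ⟨h, hh, rfl⟩)
    rw [conj_coe, ← subst_inv_subst P f, key] at h1
    have h2 := congrArg (subst P.val) h1
    rwa [subst_subst_inv, subst_subst_inv] at h2
  · rintro ⟨f, hf, rfl⟩ g hg
    obtain ⟨h, hh, hgh⟩ := (hGH g).mp hg
    rw [hgh, key, hf h hh]

theorem ker_aeval_subst (P : GL (Fin 2) k) (v : Fin 3 → MvPolynomial (Fin 2) k) :
    RingHom.ker (aeval (fun i => subst P.val (v i)) :
      MvPolynomial (Fin 3) k →ₐ[k] MvPolynomial (Fin 2) k) =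
      RingHom.ker (aeval v : MvPolynomial (Fin 3) k →ₐ[k] MvPolynomial (Fin 2) k) := by
  have h : ∀ f : MvPolynomial (Fin 3) k, aeval (fun i => subst P.val (v i)) f =
      substEquiv P (aeval v f) := by
    intro f
    have : (aeval (fun i => subst P.val (v i)) : MvPolynomial (Fin 3) k →ₐ[k] _) =
        (substEquiv P).toAlgHom.comp (aeval v) := by
      ext i : 1
      simp [substEquiv_apply]
    exact DFunLike.congr_fun this f
  ext f
  rw [RingHom.mem_ker, RingHom.mem_ker, h, map_eq_zero_iff _ (substEquiv P).injective]

end KleinType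

namespace HilbertKunz

/-! ### Orbits of lines: generators of rings of invariants and orders of groups. -/

section Lines

variable {k : Type*} [Field k]

theorem eval_smul_of_isHomogeneous {f : MvPolynomial (Fin 2) k} {m : ℕ} (hf : f.IsHomogeneous m)
    (c : k) (v : Fin 2 → k) : eval (c • v) f = c ^ m * eval v f := by
  rw [eval_eq', eval_eq', Finset.mul_sum]
  refine Finset.sum_congr rfl fun d hd => ?_
  have h1 : d 0 + d 1 = m := by
    rw [← degree_eq]
    by_contra h
    exact mem_support_iff.mp hd (hf.coeff_eq_zero h)
  rw [Fin.prod_univ_two, Fin.prod_univ_two, ← h1]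
  simp only [Pi.smul_apply, smul_eq_mul]
  ring

/-- Vanishing at `(1, 0)` excludes the only monomial of degree `m` that does not contain `X 1`. -/
theorem X_one_dvd_of_eval_eq_zero {f : MvPolynomial (Fin 2) k} {m : ℕ} (hf : f.IsHomogeneous m)
    (h0 : eval ![1, 0] f = 0) : X 1 ∣ f := by
  have h1 : ∀ d ∈ f.support, d 1 = 0 → d = expo m 0 := by
    intro d hd hd1
    have h2 : d 0 + d 1 = m := by
      rw [← degree_eq]
      by_contra h
      exact mem_support_iff.mp hd (hf.coeff_eq_zero h)
    rw [eq_expo d, hd1]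
    congr 1
    omega
  have h2 : coeff (expo m 0) f = 0 := by
    rw [eval_eq'] at h0
    by_contra hne
    rw [Finset.sum_eq_single_of_mem _ (mem_support_iff.mpr hne)] at h0
    · rw [Fin.prod_univ_two] at h0
      simp at h0
      exact hne h0
    · intro d hd hne
      have : d 1 ≠ 0 := fun h => hne (h1 d hd h)
      rw [Fin.prod_univ_two]
      simp [this]
  rw [f.as_sum]
  refine Finset.dvd_sum fun d hd => ?_
  rw [X_dvd_monomial]
  by_contra! h
  exact h.1 (by rw [h1 d hd h.2, h2])

theorem coe_inv_eq (M : SpecialLinearGroup (Fin 2) k) :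
    ((M⁻¹ : SpecialLinearGroup (Fin 2) k) : Matrix (Fin 2) (Fin 2) k) =
      !![M 1 1, -M 0 1; -M 1 0, M 0 0] := by
  rw [Matrix.SpecialLinearGroup.coe_inv, adjugate_fin_two]

/-- The linear form that vanishes at the first column of `M`. -/
noncomputable def lineForm (M : SpecialLinearGroup (Fin 2) k) : MvPolynomial (Fin 2) k :=
  subst ((M⁻¹ : SpecialLinearGroup (Fin 2) k) : Matrix (Fin 2) (Fin 2) k) (X 1)

theorem lineForm_eq (M : SpecialLinearGroup (Fin 2) k) :
    lineForm M = C (-M 1 0) * X 0 + C (M 0 0) * X 1 := by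
  rw [lineForm, subst_X, coe_inv_eq]
  simp

theorem eval_lineForm (M : SpecialLinearGroup (Fin 2) k) (u : Fin 2 → k) :
    eval u (lineForm M) = M 0 0 * u 1 - M 1 0 * u 0 := by
  rw [lineForm_eq]
  simp
  ring

theorem subst_inv_self (M : SpecialLinearGroup (Fin 2) k) (f : MvPolynomial (Fin 2) k) :
    subst ((M⁻¹ : SpecialLinearGroup (Fin 2) k) : Matrix (Fin 2) (Fin 2) k) (subst (M : Matrix (Fin 2) (Fin 2) k) f) = f := by
  rw [subst_subst, ← Matrix.SpecialLinearGroup.coe_mul, mul_inv_cancel, Matrix.SpecialLinearGroup.coe_one,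
    subst_one]

theorem subst_self_inv (M : SpecialLinearGroup (Fin 2) k) (f : MvPolynomial (Fin 2) k) :
    subst (M : Matrix (Fin 2) (Fin 2) k) (subst ((M⁻¹ : SpecialLinearGroup (Fin 2) k) : Matrix (Fin 2) (Fin 2) k) f) = f := by
  rw [subst_subst, ← Matrix.SpecialLinearGroup.coe_mul, inv_mul_cancel, Matrix.SpecialLinearGroup.coe_one,
    subst_one]

theorem lineForm_dvd {f : MvPolynomial (Fin 2) k} {m : ℕ} (hf : f.IsHomogeneous m)
    (M : SpecialLinearGroup (Fin 2) k) (h0 : eval ((M : Matrix (Fin 2) (Fin 2) k) *ᵥ ![1, 0]) f = 0) :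
    lineForm M ∣ f := by
  rw [← eval_subst] at h0
  have h := map_dvd (subst ((M⁻¹ : SpecialLinearGroup (Fin 2) k) : Matrix (Fin 2) (Fin 2) k))
    (X_one_dvd_of_eval_eq_zero (subst_isHomogeneous _ hf) h0)
  rwa [subst_inv_self] at h

theorem isHomogeneous_lineForm (M : SpecialLinearGroup (Fin 2) k) :
    (lineForm M).IsHomogeneous 1 :=
  subst_isHomogeneous _ (isHomogeneous_X _ _)

theorem lineForm_ne_zero (M : SpecialLinearGroup (Fin 2) k) : lineForm M ≠ 0 := by
  intro h
  have h1 := congrArg (subst (M : Matrix (Fin 2) (Fin 2) k)) h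
  rw [lineForm, subst_self_inv, map_zero] at h1
  exact X_ne_zero _ h1

theorem irreducible_lineForm (M : SpecialLinearGroup (Fin 2) k) : Irreducible (lineForm M) := by
  let e : MvPolynomial (Fin 2) k ≃ₐ[k] MvPolynomial (Fin 2) k :=
    AlgEquiv.ofAlgHom (subst ((M⁻¹ : SpecialLinearGroup (Fin 2) k) : Matrix (Fin 2) (Fin 2) k)) (subst (M : Matrix (Fin 2) (Fin 2) k))
      (AlgHom.ext (subst_inv_self M)) (AlgHom.ext (subst_self_inv M))
  exact (MulEquiv.irreducible_iff e.toMulEquiv).mpr (X_prime (i := (1 : Fin 2))).irreducible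

/-- At the first column of `M` the first form vanishes, while the second one takes minus the value
of the given determinant. -/
theorem isRelPrime_lineForm {M N : SpecialLinearGroup (Fin 2) k}
    (h : M 0 0 * N 1 0 - M 1 0 * N 0 0 ≠ 0) :
    IsRelPrime (lineForm M) (lineForm N) := by
  rw [(irreducible_lineForm M).isRelPrime_iff_not_dvd]
  rintro ⟨g, hg⟩
  have h1 := congrArg (eval ((M : Matrix (Fin 2) (Fin 2) k) *ᵥ ![1, 0])) hg
  rw [map_mul, eval_lineForm, eval_lineForm] at h1
  simp only [Matrix.mulVec, dotProduct, Fin.sum_univ_two, cons_val_zero, cons_val_one, mul_one,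
    mul_zero, add_zero] at h1
  refine h ?_
  linear_combination -h1

variable {H : Subgroup (SpecialLinearGroup (Fin 2) k)} {L : Type*} [Fintype L]
  {Z : L → SpecialLinearGroup (Fin 2) k}

theorem eval_mulVec_of_mem {f : MvPolynomial (Fin 2) k} (hf : f ∈ invariantRing H)
    {M : SpecialLinearGroup (Fin 2) k} (hM : M ∈ H) (u : Fin 2 → k) :
    eval ((M : Matrix (Fin 2) (Fin 2) k) *ᵥ u) f = eval u f := by
  rw [← eval_subst, hf M hM]

/-- An invariant that vanishes at `(1, 0)` vanishes on the whole orbit of this line, and the forms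
of different lines are coprime. -/
theorem prod_lineForm_dvd (hZ : ∀ l, Z l ∈ H) (hind : ∀ l l', l ≠ l' →
      Z l 0 0 * Z l' 1 0 - Z l 1 0 * Z l' 0 0 ≠ 0)
    {f : MvPolynomial (Fin 2) k} {m : ℕ} (hf : f.IsHomogeneous m) (hfH : f ∈ invariantRing H)
    (h0 : eval ![1, 0] f = 0) : ∏ l, lineForm (Z l) ∣ f := by
  refine Finset.prod_dvd_of_isRelPrime (fun l _ l' _ hne => isRelPrime_lineForm (hind l l' hne))
    fun l _ => lineForm_dvd hf _ ?_
  rw [eval_mulVec_of_mem hfH (hZ l), h0]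

theorem exists_eq_C_mul_prod_lineForm (hZ : ∀ l, Z l ∈ H) (hind : ∀ l l', l ≠ l' →
      Z l 0 0 * Z l' 1 0 - Z l 1 0 * Z l' 0 0 ≠ 0)
    {f : MvPolynomial (Fin 2) k} (hf : f.IsHomogeneous (Fintype.card L))
    (hfH : f ∈ invariantRing H) (h0 : eval ![1, 0] f = 0) (hne : f ≠ 0) :
    ∃ c : k, c ≠ 0 ∧ f = C c * ∏ l, lineForm (Z l) := by
  obtain ⟨g, hg⟩ := prod_lineForm_dvd hZ hind hf hfH h0
  have hprod : (∏ l, lineForm (Z l)).IsHomogeneous (Fintype.card L) := by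
    have := IsHomogeneous.prod Finset.univ (fun l => lineForm (Z l)) (fun _ => 1)
      fun l _ => isHomogeneous_lineForm (Z l)
    simpa using this
  have hprod0 : ∏ l, lineForm (Z l) ≠ 0 := Finset.prod_ne_zero_iff.mpr fun l _ => lineForm_ne_zero _
  have hg0 : g ≠ 0 := by
    rintro rfl
    exact hne (by rw [hg, mul_zero])
  have h1 := totalDegree_mul_of_isDomain hprod0 hg0
  rw [← hg, hf.totalDegree hne, hprod.totalDegree hprod0] at h1
  have h2 := totalDegree_eq_zero_iff_eq_C.mp (show g.totalDegree = 0 by omega)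
  refine ⟨coeff 0 g, fun h => hg0 ?_, ?_⟩
  · rw [h2, h, C_0]
  · rw [← h2, mul_comm, hg]

theorem exists_eval_eq_zero_iff (hZ : ∀ l, Z l ∈ H) (hind : ∀ l l', l ≠ l' →
      Z l 0 0 * Z l' 1 0 - Z l 1 0 * Z l' 0 0 ≠ 0)
    {f : MvPolynomial (Fin 2) k} (hf : f.IsHomogeneous (Fintype.card L))
    (hfH : f ∈ invariantRing H) (h0 : eval ![1, 0] f = 0) (hne : f ≠ 0) {u : Fin 2 → k}
    (hu : eval u f = 0) : ∃ l, Z l 0 0 * u 1 - Z l 1 0 * u 0 = 0 := by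
  obtain ⟨c, hc, h⟩ := exists_eq_C_mul_prod_lineForm hZ hind hf hfH h0 hne
  rw [h, map_mul, eval_C, map_prod, mul_eq_zero, Finset.prod_eq_zero_iff] at hu
  obtain ⟨l, -, hl⟩ := hu.resolve_left hc
  exact ⟨l, by rwa [eval_lineForm] at hl⟩

/-- Three invariants `θ`, `A`, `B` generate the ring of invariants if `θ` is the product of the
linear forms that vanish on the orbit of a line, and if the invariants that do not vanish on this
orbit have the degrees of the monomials in `A` and `B`. -/
theorem invariantRing_eq_adjoin_of_lines (hZ : ∀ l, Z l ∈ H) (hind : ∀ l l', l ≠ l' →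
      Z l 0 0 * Z l' 1 0 - Z l 1 0 * Z l' 0 0 ≠ 0) [Nonempty L]
    {θ A B : MvPolynomial (Fin 2) k} {a b : ℕ} (hθ : θ.IsHomogeneous (Fintype.card L))
    (hA : A.IsHomogeneous a) (hB : B.IsHomogeneous b) (hθH : θ ∈ invariantRing H)
    (hAH : A ∈ invariantRing H) (hBH : B ∈ invariantRing H) (hθ0 : eval ![1, 0] θ = 0)
    (hA0 : eval ![1, 0] A ≠ 0) (hB0 : eval ![1, 0] B ≠ 0) (hne : θ ≠ 0)
    (hdeg : ∀ m f, f ∈ invariantRing H → f.IsHomogeneous m → eval ![1, 0] f ≠ 0 →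
      ∃ i j, m = i * a + j * b) :
    invariantRing H = Algebra.adjoin k {θ, A, B} := by
  have hθS : θ ∈ Algebra.adjoin k {θ, A, B} := Algebra.subset_adjoin (by simp)
  have hAS : A ∈ Algebra.adjoin k {θ, A, B} := Algebra.subset_adjoin (by simp)
  have hBS : B ∈ Algebra.adjoin k {θ, A, B} := Algebra.subset_adjoin (by simp)
  -- The quotient by `θ` has smaller degree and is again invariant, because `θ` is invariant and can
  -- be cancelled.
  have hvan : ∀ m, (∀ m' < m, ∀ f ∈ invariantRing H, f.IsHomogeneous m' →
      f ∈ Algebra.adjoin k {θ, A, B}) → ∀ f ∈ invariantRing H, f.IsHomogeneous m →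
      eval ![1, 0] f = 0 → f ∈ Algebra.adjoin k {θ, A, B} := by
    intro m ih f hfH hf h0
    obtain ⟨c, hc, hθc⟩ := exists_eq_C_mul_prod_lineForm hZ hind hθ hθH hθ0 hne
    obtain ⟨g, hg⟩ := prod_lineForm_dvd hZ hind hf hfH h0
    have hfg : f = (C c⁻¹ * g) * θ := by
      rw [hg, hθc, mul_mul_mul_comm, ← C_mul, inv_mul_cancel₀ hc, C_1, one_mul, mul_comm]
    have h1 := homogeneousComponent_of_mem (m := m) hf
    rw [if_pos rfl, hfg, homogeneousComponent_mul_right hθ] at h1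
    split_ifs at h1 with hle
    · rw [hfg, ← h1]
      refine Subalgebra.mul_mem _ (ih _ (Nat.sub_lt_self Fintype.card_pos hle) _ ?_
        (homogeneousComponent_isHomogeneous _ _)) hθS
      intro M hM
      refine mul_right_cancel₀ hne ?_
      rw [h1, ← hfg]
      have h2 := hθH M hM
      generalize homogeneousComponent (m - Fintype.card L) (C c⁻¹ * g) = u at h1 ⊢
      have h3 := hfH M hM
      rwa [hfg, ← h1, map_mul, h2, h1, ← hfg] at h3
    · rw [hfg, ← h1]
      exact Subalgebra.zero_mem _
  have hhom : ∀ m, ∀ f ∈ invariantRing H, f.IsHomogeneous m →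
      f ∈ Algebra.adjoin k {θ, A, B} := by
    intro m
    induction m using Nat.strong_induction_on with
    | _ m ih =>
      intro f hfH hf
      by_cases h0 : eval ![1, 0] f = 0
      · exact hvan m ih f hfH hf h0
      · obtain ⟨i, j, rfl⟩ := hdeg m f hfH hf h0
        -- Neither `A` nor `B` vanishes at `(1, 0)`, so a multiple of `A ^ i * B ^ j` takes the same
        -- value there as `f`, and the difference falls under `hvan`.
        set c := eval ![1, 0] f / (eval ![1, 0] A ^ i * eval ![1, 0] B ^ j)
        have h1 : f - C c * (A ^ i * B ^ j) ∈ Algebra.adjoin k {θ, A, B} := by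
          refine hvan _ ih _ ?_ ?_ ?_
          · exact Subalgebra.sub_mem _ hfH (Subalgebra.mul_mem _ (Subalgebra.algebraMap_mem _ c)
              (Subalgebra.mul_mem _ (Subalgebra.pow_mem _ hAH _) (Subalgebra.pow_mem _ hBH _)))
          · refine hf.sub ?_
            have := (isHomogeneous_C (Fin 2) c).mul ((hA.pow i).mul (hB.pow j))
            rwa [zero_add, mul_comm a, mul_comm b] at this
          · simp only [map_sub, map_mul, map_pow, eval_C, c]
            field_simp
            ring
        have h2 : C c * (A ^ i * B ^ j) ∈ Algebra.adjoin k {θ, A, B} :=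
          Subalgebra.mul_mem _ (Subalgebra.algebraMap_mem _ c)
            (Subalgebra.mul_mem _ (Subalgebra.pow_mem _ hAS _) (Subalgebra.pow_mem _ hBS _))
        have h3 := Subalgebra.add_mem _ h1 h2
        rwa [sub_add_cancel] at h3
  refine le_antisymm (fun f hf => ?_) ?_
  · rw [← sum_homogeneousComponent f]
    exact Subalgebra.sum_mem _ fun i _ => hhom i _ (homogeneousComponent_mem_invariantRing hf i)
      (homogeneousComponent_isHomogeneous _ _)
  · rw [Algebra.adjoin_le_iff]
    rintro _ (rfl | rfl | rfl)
    exacts [hθH, hAH, hBH]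

/-- Here `(1, 0)` is an eigenvector of `g` with eigenvalue `g 0 0`, and `f` takes the same non-zero
value at it and at its image. -/
theorem pow_eq_one_of_upper {f : MvPolynomial (Fin 2) k} {m : ℕ} (hf : f.IsHomogeneous m)
    (hfH : f ∈ invariantRing H) (h0 : eval ![1, 0] f ≠ 0) {g : SpecialLinearGroup (Fin 2) k}
    (hg : g ∈ H) (h10 : g 1 0 = 0) : g 0 0 ^ m = 1 := by
  have h1 := eval_mulVec_of_mem hfH hg ![1, 0]
  have h2 : (g : Matrix (Fin 2) (Fin 2) k) *ᵥ ![1, 0] = g 0 0 • ![1, 0] := by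
    ext i
    fin_cases i <;> simp [Matrix.mulVec, dotProduct, Fin.sum_univ_two, h10]
  rw [h2, eval_smul_of_isHomogeneous hf] at h1
  exact mul_right_cancel₀ h0 (by rw [h1, one_mul])

/-- Restriction to the points `(1, T)`. For `f` homogeneous of degree `m` the derivatives of the two
sides at `T = 0` differ by `m * g 0 1 * f(1, 0)`. So an invariant with `m` invertible and `f(1, 0) ≠
0` excludes non-trivial unipotent elements from the stabilizer of the line. -/
theorem aeval_unipotent_eq {f : MvPolynomial (Fin 2) k} (hfH : f ∈ invariantRing H)
    {g : SpecialLinearGroup (Fin 2) k} (hg : g ∈ H) (h10 : g 1 0 = 0) (h00 : g 0 0 = 1) :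
    aeval ![1 + Polynomial.C (g 0 1) * Polynomial.X, Polynomial.X] f =
      aeval ![1, (Polynomial.X : Polynomial k)] f := by
  have h1 := g.det_coe
  rw [det_fin_two, h10, h00, mul_zero, sub_zero, one_mul] at h1
  have h2 := aeval_subst ![1, (Polynomial.X : Polynomial k)] (g : Matrix (Fin 2) (Fin 2) k) f
  rw [hfH g hg] at h2
  rw [h2]
  congr 2
  funext i
  fin_cases i <;> simp [h10, h00, h1]

/-- The order of a group that permutes lines `Z l`, if the stabilizer of a line is cyclic of order
`r`. -/
theorem card_eq_of_lines (hZ : ∀ l, Z l ∈ H) (hind : ∀ l l', l ≠ l' →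
      Z l 0 0 * Z l' 1 0 - Z l 1 0 * Z l' 0 0 ≠ 0)
    (hcover : ∀ g ∈ H, ∃ l, Z l 0 0 * g 1 0 - Z l 1 0 * g 0 0 = 0)
    {r : ℕ} [NeZero r] {ζ : k} (hζ : IsPrimitiveRoot ζ r) {D : SpecialLinearGroup (Fin 2) k}
    (hD : D ∈ H) (hDζ : (D : Matrix (Fin 2) (Fin 2) k) = !![ζ, 0; 0, ζ⁻¹])
    (heig : ∀ g ∈ H, g 1 0 = 0 → g 0 0 ^ r = 1)
    (hstab : ∀ g ∈ H, g 1 0 = 0 → g 0 0 = 1 → g 0 1 = 0) :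
    Nat.card H = Fintype.card L * r := by
  have hDpow : ∀ j : ℕ, ((D ^ j : SpecialLinearGroup (Fin 2) k) : Matrix (Fin 2) (Fin 2) k) = !![ζ ^ j, 0; 0, ζ⁻¹ ^ j] := by
    intro j
    induction j with
    | zero => ext i j; fin_cases i <;> fin_cases j <;> simp
    | succ j ih =>
      rw [pow_succ, Matrix.SpecialLinearGroup.coe_mul, ih, hDζ]
      ext i j
      fin_cases i <;> fin_cases j <;> simp [pow_succ]
  have hζ0 : ζ ≠ 0 := hζ.ne_zero (NeZero.ne r)
  have hentry : ∀ (M : SpecialLinearGroup (Fin 2) k) (j : ℕ) (i : Fin 2),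
      (M * D ^ j) i 0 = M i 0 * ζ ^ j := by
    intro M j i
    rw [Matrix.SpecialLinearGroup.coe_mul, hDpow]
    simp [Matrix.mul_apply, Fin.sum_univ_two]
  have hcol : ∀ M : SpecialLinearGroup (Fin 2) k, M 0 0 ≠ 0 ∨ M 1 0 ≠ 0 := by
    intro M
    by_contra! h
    have := M.det_coe
    rw [det_fin_two, h.1, h.2] at this
    simp at this
  -- Orbit and stabilizer: `Z l` reaches the line `l`, and the powers of `D` exhaust the stabilizer
  -- of the line through `(1, 0)`.
  let φ : L × Fin r → H := fun x =>
    ⟨Z x.1 * D ^ (x.2 : ℕ), H.mul_mem (hZ _) (H.pow_mem hD _)⟩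
  have hφ : Function.Bijective φ := by
    constructor
    · rintro ⟨l, j⟩ ⟨l', j'⟩ h
      have h1 : Z l * D ^ (j : ℕ) = Z l' * D ^ (j' : ℕ) := congrArg Subtype.val h
      have h2 : ∀ i, Z l i 0 * ζ ^ (j : ℕ) = Z l' i 0 * ζ ^ (j' : ℕ) := by
        intro i
        rw [← hentry, ← hentry, h1]
      have hl : l = l' := by
        by_contra hne
        refine hind l l' hne ?_
        have h3 : (Z l 0 0 * Z l' 1 0 - Z l 1 0 * Z l' 0 0) *
            ζ ^ (j : ℕ) = 0 := by
          linear_combination Z l' 1 0 * h2 0 - Z l' 0 0 * h2 1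
        exact (mul_eq_zero.mp h3).resolve_right (pow_ne_zero _ hζ0)
      subst hl
      have h3 : ζ ^ (j : ℕ) = ζ ^ (j' : ℕ) := by
        rcases hcol (Z l) with h4 | h4
        · exact mul_left_cancel₀ h4 (h2 0)
        · exact mul_left_cancel₀ h4 (h2 1)
      rw [Fin.ext (hζ.pow_inj j.2 j'.2 h3)]
    · rintro ⟨g, hg⟩
      obtain ⟨l, hl⟩ := hcover g hg
      -- `(Z l)⁻¹ * g` fixes the line through `(1, 0)` with an eigenvalue `ζ ^ j`. Dividing by `D ^
      -- j` leaves a unipotent element, which `hstab` shows to be trivial.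
      have hq : (Z l)⁻¹ * g ∈ H := H.mul_mem (H.inv_mem (hZ l)) hg
      have hq10 : ((Z l)⁻¹ * g : SpecialLinearGroup (Fin 2) k) 1 0 = 0 := by
        rw [Matrix.SpecialLinearGroup.coe_mul, coe_inv_eq]
        simp [Matrix.mul_apply, Fin.sum_univ_two]
        linear_combination hl
      obtain ⟨j, hj, hjq⟩ := hζ.eq_pow_of_pow_eq_one (heig _ hq hq10)
      have hs : (D ^ j)⁻¹ * ((Z l)⁻¹ * g) ∈ H := H.mul_mem (H.inv_mem (H.pow_mem hD j)) hq
      set q := (Z l)⁻¹ * g with hqdef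
      have hinv : (((D ^ j)⁻¹ : SpecialLinearGroup (Fin 2) k) : Matrix (Fin 2) (Fin 2) k) = !![ζ⁻¹ ^ j, 0; 0, ζ ^ j] := by
        rw [coe_inv_eq, hDpow]
        simp
      have e10 : ((D ^ j)⁻¹ * q) 1 0 = 0 := by
        rw [Matrix.SpecialLinearGroup.coe_mul, hinv]
        simp [Matrix.mul_apply, Fin.sum_univ_two, hq10]
      have e00 : ((D ^ j)⁻¹ * q) 0 0 = 1 := by
        rw [Matrix.SpecialLinearGroup.coe_mul, hinv]
        simp [Matrix.mul_apply, Fin.sum_univ_two, hq10, ← hjq, hζ0]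
      have e01 := hstab _ hs e10 e00
      have e11 : ((D ^ j)⁻¹ * q) 1 1 = 1 := by
        have := ((D ^ j)⁻¹ * q).det_coe
        rwa [det_fin_two, e10, e00, mul_zero, sub_zero, one_mul] at this
      have hone : (D ^ j)⁻¹ * q = 1 := by
        apply Subtype.ext
        ext a b
        fin_cases a <;> fin_cases b
        · simpa using e00
        · simpa using e01
        · simpa using e10
        · simpa using e11
      refine ⟨(l, ⟨j, hj⟩), Subtype.ext ?_⟩
      change Z l * D ^ j = g
      rw [inv_mul_eq_one] at hone
      rw [hone, hqdef, mul_inv_cancel_left]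
  rw [← Nat.card_congr (Equiv.ofBijective φ hφ), Nat.card_prod, Nat.card_eq_fintype_card,
    Nat.card_eq_fintype_card, Fintype.card_fin]

end Lines

end HilbertKunz

namespace HilbertKunz

/-! ### Homogeneity of explicit polynomials; diagonal and antidiagonal substitutions. -/

section Tools

variable {k : Type*} [Field k]

/-- The homomorphism `x ↦ x T` to `k[x₁, x₂][T]`. -/
noncomputable def homogenize : MvPolynomial (Fin 2) k →ₐ[k] Polynomial (MvPolynomial (Fin 2) k) :=
  aeval fun i => Polynomial.C (X i) * Polynomial.X

theorem coeff_homogenize (f : MvPolynomial (Fin 2) k) (m : ℕ) :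
    (homogenize f).coeff m = homogeneousComponent m f := by
  induction f using MvPolynomial.induction_on' with
  | monomial d c =>
    have h1 : homogenize (monomial d c) =
        Polynomial.C (monomial d c) * Polynomial.X ^ (d 0 + d 1) := by
      rw [homogenize, aeval_monomial, Finsupp.prod_fintype _ _ (fun _ => pow_zero _),
        Fin.prod_univ_two, mul_pow, mul_pow, mul_mul_mul_comm, ← pow_add, ← mul_assoc,
        monomial_eq, Finsupp.prod_fintype _ _ (fun _ => pow_zero _), Fin.prod_univ_two,
        Polynomial.algebraMap_apply, algebraMap_eq]
      simp only [map_mul, map_pow, mul_assoc]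
    rw [h1, Polynomial.coeff_C_mul, Polynomial.coeff_X_pow,
      homogeneousComponent_of_mem (isHomogeneous_monomial c (degree_eq d))]
    split_ifs <;> simp
  | add f g hf hg => rw [map_add, Polynomial.coeff_add, hf, hg, map_add]

/-- Homogeneity of an explicit polynomial becomes an identity that `ring` can decide. -/
theorem isHomogeneous_of_homogenize {f : MvPolynomial (Fin 2) k} {m : ℕ}
    (h : homogenize f = Polynomial.C f * Polynomial.X ^ m) : f.IsHomogeneous m := by
  have h1 := coeff_homogenize f m
  rw [h, Polynomial.coeff_C_mul, Polynomial.coeff_X_pow, if_pos rfl, mul_one] at h1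
  rw [h1]
  exact homogeneousComponent_isHomogeneous _ _

@[simp] theorem homogenize_X (i : Fin 2) :
    homogenize (X i : MvPolynomial (Fin 2) k) = Polynomial.C (X i) * Polynomial.X := by
  rw [homogenize, aeval_X]

theorem subst_diag_X_zero (a b : k) : subst !![a, 0; 0, b] (X 0) = C a * X 0 := by
  simp [subst_X]

theorem subst_diag_X_one (a b : k) : subst !![a, 0; 0, b] (X 1) = C b * X 1 := by
  simp [subst_X]

theorem subst_anti_X_zero (a b : k) : subst !![0, a; b, 0] (X 0) = C a * X 1 := by
  simp [subst_X]

theorem subst_anti_X_one (a b : k) : subst !![0, a; b, 0] (X 1) = C b * X 0 := by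
  simp [subst_X]

theorem coeff_subst_diag (a b : k) (f : MvPolynomial (Fin 2) k) (d : Fin 2 →₀ ℕ) :
    coeff d (subst !![a, 0; 0, b] f) = a ^ d 0 * b ^ d 1 * coeff d f := by
  classical
  induction f using MvPolynomial.induction_on' with
  | monomial e c =>
    have h1 : subst !![a, 0; 0, b] (monomial e c) = C (a ^ e 0 * b ^ e 1) * monomial e c := by
      rw [monomial_eq, Finsupp.prod_fintype _ _ (fun _ => pow_zero _), Fin.prod_univ_two,
        map_mul, map_mul, map_pow, map_pow, subst_C, subst_diag_X_zero, subst_diag_X_one,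
        mul_pow, mul_pow, C_mul, C_pow, C_pow]
      ring
    rw [h1, coeff_C_mul, coeff_monomial]
    split_ifs with h
    · rw [h]
    · rw [mul_zero, mul_zero]
  | add f g hf hg => rw [map_add, coeff_add, hf, hg, coeff_add, mul_add]

end Tools

end HilbertKunz

namespace KleinType

open HilbertKunz

/-! ### Invariants of a group given by generators, and extension by a sign change. -/

section Generated

variable {k : Type*} [Field k]

theorem mem_generated {s : Set (Matrix (Fin 2) (Fin 2) k)} {g : SpecialLinearGroup (Fin 2) k}
    (hg : (g : Matrix (Fin 2) (Fin 2) k) ∈ s) : g ∈ generated s :=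
  Subgroup.subset_closure hg

theorem mem_invariantRing_generated {s : Set (Matrix (Fin 2) (Fin 2) k)}
    {f : MvPolynomial (Fin 2) k} (h : ∀ M ∈ s, subst M f = f) :
    f ∈ invariantRing (generated s) := by
  intro g hg
  induction hg using Subgroup.closure_induction with
  | mem x hx => exact h _ hx
  | one => exact subst_one f
  | mul x y _ _ hx hy =>
    rw [Matrix.SpecialLinearGroup.coe_mul, ← subst_subst, hx, hy]
  | inv x _ hx =>
    have h1 := subst_inv_self x f
    rwa [hx] at h1

theorem subst_eq_of_mem_invariantRing_generated {s : Set (Matrix (Fin 2) (Fin 2) k)}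
    {f : MvPolynomial (Fin 2) k} (hf : f ∈ invariantRing (generated s))
    {M : Matrix (Fin 2) (Fin 2) k} (hM : M ∈ s) (hdet : M.det = 1) : subst M f = f :=
  hf ⟨M, hdet⟩ (mem_generated hM)

/-- If `u ∈ S + e₁ S + e₂ S` is fixed by an endomorphism that fixes `S` and maps `eᵢ` to `-eᵢ`,
then `u ∈ S`. -/
theorem mem_of_mem_double_cover {R : Type*} [CommRing R] [Algebra k R] (h2 : (2 : k) ≠ 0)
    {S : Subalgebra k R} {e₁ e₂ : R} (h11 : e₁ * e₁ ∈ S) (h12 : e₁ * e₂ ∈ S) (h22 : e₂ * e₂ ∈ S)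
    (τ : R →ₐ[k] R) (hτ : ∀ s ∈ S, τ s = s) (hτ₁ : τ e₁ = -e₁) (hτ₂ : τ e₂ = -e₂)
    {T : Set R} (hT : ∀ x ∈ T, ∃ a ∈ S, ∃ b ∈ S, ∃ c ∈ S, x = a + b * e₁ + c * e₂)
    {u : R} (hu : u ∈ Algebra.adjoin k T) (hτu : τ u = u) : u ∈ S := by
  -- `S + e₁ S + e₂ S` is closed under products because all `eᵢ eⱼ` lie in `S`.
  have key : ∃ a ∈ S, ∃ b ∈ S, ∃ c ∈ S, u = a + b * e₁ + c * e₂ := by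
    clear hτu
    induction hu using Algebra.adjoin_induction with
    | mem x hx => exact hT x hx
    | algebraMap r =>
      exact ⟨_, S.algebraMap_mem r, 0, S.zero_mem, 0, S.zero_mem, by ring⟩
    | add x y _ _ hx hy =>
      obtain ⟨a, ha, b, hb, c, hc, rfl⟩ := hx
      obtain ⟨a', ha', b', hb', c', hc', rfl⟩ := hy
      exact ⟨_, S.add_mem ha ha', _, S.add_mem hb hb', _, S.add_mem hc hc', by ring⟩
    | mul x y _ _ hx hy =>
      obtain ⟨a, ha, b, hb, c, hc, rfl⟩ := hx
      obtain ⟨a', ha', b', hb', c', hc', rfl⟩ := hy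
      refine ⟨a * a' + b * b' * (e₁ * e₁) + (b * c' + c * b') * (e₁ * e₂) + c * c' * (e₂ * e₂),
        ?_, a * b' + b * a', ?_, a * c' + c * a', ?_, by ring⟩
      · exact S.add_mem (S.add_mem (S.add_mem (S.mul_mem ha ha') (S.mul_mem (S.mul_mem hb hb') h11))
          (S.mul_mem (S.add_mem (S.mul_mem hb hc') (S.mul_mem hc hb')) h12))
          (S.mul_mem (S.mul_mem hc hc') h22)
      · exact S.add_mem (S.mul_mem ha hb') (S.mul_mem hb ha')
      · exact S.add_mem (S.mul_mem ha hc') (S.mul_mem hc ha')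
  obtain ⟨a, ha, b, hb, c, hc, rfl⟩ := key
  simp only [map_add, map_mul, hτ a ha, hτ b hb, hτ c hc, hτ₁, hτ₂] at hτu
  -- `τ` reverses the sign of the part in `e₁`, `e₂`, so twice this part is zero.
  have h3 : algebraMap k R 2 * (b * e₁ + c * e₂) = 0 := by
    rw [map_ofNat]
    linear_combination -hτu
  have h4 : b * e₁ + c * e₂ = 0 := by
    have h5 := congrArg (algebraMap k R 2⁻¹ * ·) h3
    simp only [← mul_assoc, ← map_mul, inv_mul_cancel₀ h2, map_one, one_mul, mul_zero] at h5
    exact h5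
  rw [add_assoc, h4, add_zero]
  exact ha

end Generated

/-! ### The cyclic groups -/

section Cyclic

variable {k : Type*} [Field k] {n : ℕ} {ε : k}

theorem det_diag_inv {a : k} (ha : a ≠ 0) : (!![a, 0; 0, a⁻¹]).det = 1 := by
  simp [det_fin_two, ha]

theorem gens_A_mem (hε : IsPrimitiveRoot ε n) (hn : n ≠ 0) (i : Fin 3) :
    gens k (A n) i ∈ invariantRing (generated {!![ε, 0; 0, ε⁻¹]}) := by
  have hε0 := hε.ne_zero hn
  have h1 : ε⁻¹ ^ n = 1 := by rw [inv_pow, hε.pow_eq_one, inv_one]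
  refine mem_invariantRing_generated ?_
  rintro _ rfl
  fin_cases i
  · simp only [gens, Fin.zero_eta, cons_val_zero, map_mul, subst_diag_X_zero, subst_diag_X_one]
    rw [mul_mul_mul_comm, ← C_mul, mul_inv_cancel₀ hε0, C_1, one_mul]
  · change subst _ (X 0 ^ n) = X 0 ^ n
    rw [map_pow, subst_diag_X_zero, mul_pow, ← C_pow, hε.pow_eq_one, C_1, one_mul]
  · simp only [gens, Fin.reduceFinMk, cons_val, map_pow, subst_diag_X_one, mul_pow]
    rw [← C_pow, h1, C_1, one_mul]

/-- Split off `x₁ x₂` to the power of the smaller exponent; the rest is a power of `x₁ⁿ` or of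
`x₂ⁿ`. -/
theorem monomial_mem_adjoin {n : ℕ} (d : Fin 2 →₀ ℕ) (c : k)
    (h : (n : ℤ) ∣ (d 0 : ℤ) - d 1) :
    monomial d c ∈ Algebra.adjoin k (Set.range (gens k (A n))) := by
  have h0 : ∀ i, gens k (A n) i ∈ Algebra.adjoin k (Set.range (gens k (A n))) := fun i =>
    Algebra.subset_adjoin ⟨i, rfl⟩
  have hx : ∀ q : ℕ, (X 0 : MvPolynomial (Fin 2) k) ^ (n * q) ∈
      Algebra.adjoin k (Set.range (gens k (A n))) := fun q => by
    rw [pow_mul]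
    exact Subalgebra.pow_mem _ (h0 1) _
  have hy : ∀ q : ℕ, (X 1 : MvPolynomial (Fin 2) k) ^ (n * q) ∈
      Algebra.adjoin k (Set.range (gens k (A n))) := fun q => by
    rw [pow_mul]
    exact Subalgebra.pow_mem _ (h0 2) _
  rw [monomial_eq, Finsupp.prod_fintype _ _ (fun _ => pow_zero _), Fin.prod_univ_two]
  refine Subalgebra.mul_mem _ (Subalgebra.algebraMap_mem _ c) ?_
  rcases le_total (d 1) (d 0) with hle | hle
  · rw [← Nat.cast_sub hle, Int.natCast_dvd_natCast] at h
    obtain ⟨q, hq⟩ := h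
    have : (X 0 : MvPolynomial (Fin 2) k) ^ d 0 * X 1 ^ d 1 =
        (X 0 * X 1) ^ d 1 * X 0 ^ (n * q) := by
      rw [← hq, ← Nat.sub_add_cancel hle, Nat.add_sub_cancel, pow_add, mul_pow]
      ring
    rw [this]
    exact Subalgebra.mul_mem _ (Subalgebra.pow_mem _ (h0 0) _) (hx q)
  · rw [← dvd_neg, neg_sub, ← Nat.cast_sub hle, Int.natCast_dvd_natCast] at h
    obtain ⟨q, hq⟩ := h
    have : (X 0 : MvPolynomial (Fin 2) k) ^ d 0 * X 1 ^ d 1 =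
        (X 0 * X 1) ^ d 0 * X 1 ^ (n * q) := by
      rw [← hq, ← Nat.sub_add_cancel hle, Nat.add_sub_cancel, pow_add, mul_pow]
      ring
    rw [this]
    exact Subalgebra.mul_mem _ (Subalgebra.pow_mem _ (h0 0) _) (hy q)

/-- The substitution multiplies each monomial by `ε ^ (d 0 - d 1)`, so invariance is a condition on
each exponent separately. -/
theorem mem_adjoin_of_subst_diag (hε : IsPrimitiveRoot ε n) (hn : n ≠ 0)
    {f : MvPolynomial (Fin 2) k} (hf : subst !![ε, 0; 0, ε⁻¹] f = f) :
    f ∈ Algebra.adjoin k (Set.range (gens k (A n))) := by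
  have hε0 := hε.ne_zero hn
  rw [f.as_sum]
  refine Subalgebra.sum_mem _ fun d hd => monomial_mem_adjoin d _ ?_
  have h1 := coeff_subst_diag ε ε⁻¹ f d
  rw [hf] at h1
  have h2 : ε ^ d 0 * ε⁻¹ ^ d 1 = 1 :=
    mul_right_cancel₀ (mem_support_iff.mp hd) (by rw [← h1, one_mul])
  rw [← hε.zpow_eq_one_iff_dvd, zpow_sub₀ hε0, zpow_natCast, zpow_natCast, ← h2, inv_pow,
    div_eq_mul_inv]

theorem invariantRing_A (hε : IsPrimitiveRoot ε n) (hn : n ≠ 0) :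
    invariantRing (generated {!![ε, 0; 0, ε⁻¹]}) =
      Algebra.adjoin k (Set.range (gens k (A n))) := by
  refine le_antisymm (fun f hf => mem_adjoin_of_subst_diag hε hn ?_) ?_
  · exact subst_eq_of_mem_invariantRing_generated hf (Set.mem_singleton _)
      (det_diag_inv (hε.ne_zero hn))
  · rw [Algebra.adjoin_le_iff]
    rintro _ ⟨i, rfl⟩
    exact gens_A_mem hε hn i

/-- As `x₂ⁿ` is invariant, the line through `(1, 0)` is its own orbit; the factor `n` comes from the
stabilizer. -/
theorem card_A (hε : IsPrimitiveRoot ε n) (hn : n ≠ 0) (hnk : (n : k) ≠ 0) :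
    Nat.card (generated {!![ε, 0; 0, ε⁻¹]}) = n := by
  have hne : NeZero n := ⟨hn⟩
  have h2 := gens_A_mem hε hn 2
  have h1 := gens_A_mem hε hn 1
  have hX : (X 0 ^ n : MvPolynomial (Fin 2) k).IsHomogeneous n := isHomogeneous_X_pow 0 n
  have hD : (⟨!![ε, 0; 0, ε⁻¹], det_diag_inv (hε.ne_zero hn)⟩ : SpecialLinearGroup (Fin 2) k) ∈
      generated {!![ε, 0; 0, ε⁻¹]} := mem_generated (Set.mem_singleton _)
  have h := card_eq_of_lines (L := Unit) (Z := fun _ => 1) (fun _ => Subgroup.one_mem _)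
    (fun l l' h => absurd (Subsingleton.elim l l') h) (fun g hg => ⟨(), ?_⟩) hε hD rfl
    (fun g hg h10 => pow_eq_one_of_upper hX h1 (by simp) hg h10) (fun g hg h10 h00 => ?_)
  · rw [h, Fintype.card_unit, one_mul]
  · have h3 := eval_mulVec_of_mem h2 hg ![1, 0]
    simp [gens, hn] at h3
    simp [h3]
  · have h3 := aeval_unipotent_eq h1 hg h10 h00
    have h4 := congrArg (fun q => (Polynomial.derivative q).eval 0) h3
    simpa [gens, Polynomial.derivative_pow, hnk] using h4

end Cyclic

end KleinType

namespace KleinType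

open HilbertKunz

/-! ### The binary dihedral groups -/

section Dihedral

variable {k : Type*} [Field k] {n : ℕ} {ε i : k}

theorem det_anti {i : k} (hi : i ^ 2 = -1) : (!![0, i; i, 0]).det = 1 := by
  rw [det_fin_two]
  simp
  linear_combination -hi

theorem C_sq_eq {i : k} (hi : i ^ 2 = -1) : (C i : MvPolynomial (Fin 2) k) ^ 2 = -1 := by
  rw [← C_pow, hi, C_neg, C_1]

theorem neg_one_pow_mul_self {R : Type*} [CommRing R] (n : ℕ) :
    ((-1) ^ n * (-1) ^ n : R) = 1 := by
  rw [← mul_pow]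
  simp

theorem C_mul_pow_two_mul {i : k} (hi : i ^ 2 = -1) (n : ℕ) (j : Fin 2) :
    (C i * X j : MvPolynomial (Fin 2) k) ^ (2 * n) = (-1) ^ n * X j ^ (2 * n) := by
  rw [mul_pow, pow_mul (C i), C_sq_eq hi]

theorem gens_D_mem (hε : IsPrimitiveRoot ε (2 * n)) (hn : n ≠ 0) (hi : i ^ 2 = -1) (j : Fin 3) :
    gens k (D n) j ∈ invariantRing (generated {!![ε, 0; 0, ε⁻¹], !![0, i; i, 0]}) := by
  have h2n : 2 * n ≠ 0 := by omega
  have hε0 := hε.ne_zero h2n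
  have h1 : ε⁻¹ ^ (2 * n) = 1 := by rw [inv_pow, hε.pow_eq_one, inv_one]
  have hεC : (C ε * C ε⁻¹ : MvPolynomial (Fin 2) k) = 1 := by
    rw [← C_mul, mul_inv_cancel₀ hε0, C_1]
  have hx : (C ε * X 0 : MvPolynomial (Fin 2) k) ^ (2 * n) = X 0 ^ (2 * n) := by
    rw [mul_pow, ← C_pow, hε.pow_eq_one, C_1, one_mul]
  have hy : (C ε⁻¹ * X 1 : MvPolynomial (Fin 2) k) ^ (2 * n) = X 1 ^ (2 * n) := by
    rw [mul_pow, ← C_pow, h1, C_1, one_mul]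
  have hs := neg_one_pow_mul_self (R := MvPolynomial (Fin 2) k) n
  have hi' := C_sq_eq hi
  refine mem_invariantRing_generated ?_
  rintro _ (rfl | rfl)
  · fin_cases j
    · change subst _ (-2 * X 0 ^ 2 * X 1 ^ 2) = -2 * X 0 ^ 2 * X 1 ^ 2
      simp only [map_mul, map_pow, map_neg, map_ofNat, subst_diag_X_zero, subst_diag_X_one]
      linear_combination -2 * X 0 ^ 2 * X 1 ^ 2 * (C ε * C ε⁻¹ + 1) * hεC
    · change subst _ (X 0 ^ (2 * n) + (-1) ^ n * X 1 ^ (2 * n)) = _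
      simp only [map_mul, map_pow, map_neg, map_add, map_one, subst_diag_X_zero,
        subst_diag_X_one, hx, hy]
      rfl
    · change subst _ (X 0 * X 1 * (X 0 ^ (2 * n) - (-1) ^ n * X 1 ^ (2 * n))) =
        X 0 * X 1 * (X 0 ^ (2 * n) - (-1) ^ n * X 1 ^ (2 * n))
      simp only [map_mul, map_pow, map_neg, map_sub, map_one, subst_diag_X_zero,
        subst_diag_X_one, hx, hy]
      linear_combination X 0 * X 1 * (X 0 ^ (2 * n) - (-1) ^ n * X 1 ^ (2 * n)) * hεC
  · fin_cases j
    · change subst _ (-2 * X 0 ^ 2 * X 1 ^ 2) = -2 * X 0 ^ 2 * X 1 ^ 2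
      simp only [map_mul, map_pow, map_neg, map_ofNat, subst_anti_X_zero, subst_anti_X_one]
      linear_combination -2 * X 0 ^ 2 * X 1 ^ 2 * (C i ^ 2 - 1) * hi'
    · change subst _ (X 0 ^ (2 * n) + (-1) ^ n * X 1 ^ (2 * n)) =
        X 0 ^ (2 * n) + (-1) ^ n * X 1 ^ (2 * n)
      simp only [map_mul, map_pow, map_neg, map_add, map_one, subst_anti_X_zero,
        subst_anti_X_one, C_mul_pow_two_mul hi]
      linear_combination X 0 ^ (2 * n) * hs
    · change subst _ (X 0 * X 1 * (X 0 ^ (2 * n) - (-1) ^ n * X 1 ^ (2 * n))) =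
        X 0 * X 1 * (X 0 ^ (2 * n) - (-1) ^ n * X 1 ^ (2 * n))
      simp only [map_mul, map_pow, map_neg, map_sub, map_one, subst_anti_X_zero,
        subst_anti_X_one, C_mul_pow_two_mul hi]
      linear_combination -X 0 * X 1 * C i ^ 2 * X 0 ^ (2 * n) * hs +
        X 0 * X 1 * ((-1) ^ n * X 1 ^ (2 * n) - X 0 ^ (2 * n)) * hi'

/-- The diagonal generator leaves `k[x₁x₂, x₁²ⁿ, x₂²ⁿ]`. On this ring the antidiagonal one changes
the signs of `x₁x₂` and of `x₁²ⁿ - (-1)ⁿ x₂²ⁿ`, whose products with each other and with themselves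
are polynomials in the generators of type `D n`. -/
theorem invariantRing_D (hε : IsPrimitiveRoot ε (2 * n)) (hn : n ≠ 0) (hi : i ^ 2 = -1)
    (h2 : (2 : k) ≠ 0) :
    invariantRing (generated {!![ε, 0; 0, ε⁻¹], !![0, i; i, 0]}) =
      Algebra.adjoin k (Set.range (gens k (D n))) := by
  have h2n : 2 * n ≠ 0 := by omega
  refine le_antisymm (fun f hf => ?_) ?_
  · have hd : subst !![ε, 0; 0, ε⁻¹] f = f :=
      subst_eq_of_mem_invariantRing_generated hf (Set.mem_insert _ _)
        (det_diag_inv (hε.ne_zero h2n))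
    have hK : subst !![0, i; i, 0] f = f :=
      subst_eq_of_mem_invariantRing_generated hf (by simp) (det_anti hi)
    have hfA := mem_adjoin_of_subst_diag hε h2n hd
    have hS : ∀ j, gens k (D n) j ∈ Algebra.adjoin k (Set.range (gens k (D n))) := fun j =>
      Algebra.subset_adjoin ⟨j, rfl⟩
    have hC : ∀ c : k, C c ∈ Algebra.adjoin k (Set.range (gens k (D n))) :=
      Subalgebra.algebraMap_mem _
    have hs := neg_one_pow_mul_self (R := MvPolynomial (Fin 2) k) n
    have hC2 : (C 2⁻¹ * 2 : MvPolynomial (Fin 2) k) = 1 := by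
      have : (2 : MvPolynomial (Fin 2) k) = C 2 := (map_ofNat C 2).symm
      rw [this, ← C_mul, inv_mul_cancel₀ h2, C_1]
    have hsC : ((-1) ^ n : MvPolynomial (Fin 2) k) = C ((-1) ^ n) := by simp
    have g0 : gens k (D n) 0 = -2 * X 0 ^ 2 * X 1 ^ 2 := rfl
    have g1 : gens k (D n) 1 = X 0 ^ (2 * n) + (-1) ^ n * X 1 ^ (2 * n) := rfl
    have g2 : gens k (D n) 2 = X 0 * X 1 * (X 0 ^ (2 * n) - (-1) ^ n * X 1 ^ (2 * n)) := rfl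
    have h11 : X 0 * X 1 * (X 0 * X 1) ∈ Algebra.adjoin k (Set.range (gens k (D n))) := by
      have : X 0 * X 1 * (X 0 * X 1) = C (-2⁻¹) * gens k (D n) 0 := by
        rw [g0, C_neg]
        linear_combination -X 0 ^ 2 * X 1 ^ 2 * hC2
      rw [this]
      exact Subalgebra.mul_mem _ (hC _) (hS 0)
    refine mem_of_mem_double_cover h2 (e₁ := X 0 * X 1)
      (e₂ := X 0 ^ (2 * n) - (-1) ^ n * X 1 ^ (2 * n)) h11 ?_ ?_ (subst !![0, i; i, 0])
      (fun s hs => ?_) ?_ ?_ ?_ hfA hK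
    · rw [← g2]
      exact hS 2
    · have : (X 0 ^ (2 * n) - (-1) ^ n * X 1 ^ (2 * n)) *
          (X 0 ^ (2 * n) - (-1) ^ n * X 1 ^ (2 * n)) = gens k (D n) 1 ^ 2 -
          C (4 * (-1) ^ n) * (X 0 * X 1 * (X 0 * X 1)) ^ n := by
        have h4 : (C (4 * (-1) ^ n) : MvPolynomial (Fin 2) k) = 4 * (-1) ^ n := by
          rw [C_mul, ← hsC]
          rw [show (C 4 : MvPolynomial (Fin 2) k) = 4 from map_ofNat C 4]
        rw [g1, h4, show (X 0 * X 1 * (X 0 * X 1) : MvPolynomial (Fin 2) k) ^ n =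
          X 0 ^ (2 * n) * X 1 ^ (2 * n) by rw [pow_mul, pow_mul, ← mul_pow]; ring]
        ring
      rw [this]
      exact Subalgebra.sub_mem _ (Subalgebra.pow_mem _ (hS 1) 2)
        (Subalgebra.mul_mem _ (hC _) (Subalgebra.pow_mem _ h11 n))
    · have hle : Algebra.adjoin k (Set.range (gens k (D n))) ≤
          invariantRing (generated {!![ε, 0; 0, ε⁻¹], !![0, i; i, 0]}) := by
        rw [Algebra.adjoin_le_iff]
        rintro _ ⟨j, rfl⟩
        exact gens_D_mem hε hn hi j
      exact subst_eq_of_mem_invariantRing_generated (hle hs) (by simp) (det_anti hi)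
    · rw [map_mul, subst_anti_X_zero, subst_anti_X_one]
      linear_combination X 0 * X 1 * C_sq_eq hi
    · simp only [map_mul, map_pow, map_neg, map_sub, map_one, subst_anti_X_zero,
        subst_anti_X_one, C_mul_pow_two_mul hi]
      linear_combination -X 0 ^ (2 * n) * hs
    -- `x₁²ⁿ` is half the sum of the second generator and `e₂`, and `(-1)ⁿ x₂²ⁿ` is half their
    -- difference.
    · rintro _ ⟨j, rfl⟩
      fin_cases j
      · exact ⟨0, Subalgebra.zero_mem _, 1, Subalgebra.one_mem _, 0, Subalgebra.zero_mem _, by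
          simp [gens]⟩
      · refine ⟨C 2⁻¹ * gens k (D n) 1, Subalgebra.mul_mem _ (hC _) (hS 1), 0,
          Subalgebra.zero_mem _, C 2⁻¹, hC _, ?_⟩
        rw [g1]
        change X 0 ^ (2 * n) = _
        linear_combination -X 0 ^ (2 * n) * hC2
      · refine ⟨C ((-1) ^ n) * (C 2⁻¹ * gens k (D n) 1),
          Subalgebra.mul_mem _ (hC _) (Subalgebra.mul_mem _ (hC _) (hS 1)), 0,
          Subalgebra.zero_mem _, C ((-1) ^ n) * -C 2⁻¹,
          Subalgebra.mul_mem _ (hC _) (Subalgebra.neg_mem _ (hC _)), ?_⟩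
        rw [g1, ← hsC]
        change X 1 ^ (2 * n) = _
        linear_combination -X 1 ^ (2 * n) * hC2 - C 2⁻¹ * 2 * X 1 ^ (2 * n) * hs
  · rw [Algebra.adjoin_le_iff]
    rintro _ ⟨j, rfl⟩
    exact gens_D_mem hε hn hi j

theorem ne_zero_of_sq {i : k} (hi : i ^ 2 = -1) : i ≠ 0 := by
  rintro rfl
  norm_num at hi

/-- The orbit consists of the two coordinate axes, because `-2 x₁² x₂²` is invariant; the stabilizer
is cyclic of order `2n`. -/
theorem card_D (hε : IsPrimitiveRoot ε (2 * n)) (hn : n ≠ 0) (hi : i ^ 2 = -1)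
    (h2 : (2 : k) ≠ 0) (hnk : (n : k) ≠ 0) :
    Nat.card (generated {!![ε, 0; 0, ε⁻¹], !![0, i; i, 0]}) = 4 * n := by
  have h2n : 2 * n ≠ 0 := by omega
  have hne : NeZero (2 * n) := ⟨h2n⟩
  have hi0 := ne_zero_of_sq hi
  have h0 := gens_D_mem hε hn hi 0
  have h1 := gens_D_mem hε hn hi 1
  have hX : (X 0 ^ (2 * n) + (-1) ^ n * X 1 ^ (2 * n) : MvPolynomial (Fin 2) k).IsHomogeneous
      (2 * n) := by
    refine isHomogeneous_of_homogenize ?_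
    simp only [map_add, map_mul, map_pow, map_neg, map_one, homogenize_X]
    ring
  have hD : (⟨!![ε, 0; 0, ε⁻¹], det_diag_inv (hε.ne_zero h2n)⟩ : SpecialLinearGroup (Fin 2) k) ∈
      generated {!![ε, 0; 0, ε⁻¹], !![0, i; i, 0]} := mem_generated (Set.mem_insert _ _)
  have hK : (⟨!![0, i; i, 0], det_anti hi⟩ : SpecialLinearGroup (Fin 2) k) ∈
      generated {!![ε, 0; 0, ε⁻¹], !![0, i; i, 0]} := mem_generated (by simp)
  have h := card_eq_of_lines (L := Fin 2) (Z := ![1, ⟨!![0, i; i, 0], det_anti hi⟩])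
    (fun l => ?_) (fun l l' hl => ?_) (fun g hg => ?_) hε hD rfl
    (fun g hg h10 => pow_eq_one_of_upper hX h1 (by simp [hn]) hg h10) (fun g hg h10 h00 => ?_)
  · rw [h, Fintype.card_fin]
    ring
  · fin_cases l
    · exact Subgroup.one_mem _
    · exact hK
  · fin_cases l <;> fin_cases l' <;> simp [hi0] at hl ⊢
  · have h3 := eval_mulVec_of_mem h0 hg ![1, 0]
    simp [gens, h2] at h3
    rcases h3 with h3 | h3
    · exact ⟨1, by simp [h3]⟩
    · exact ⟨0, by simp [h3]⟩
  · have h3 := aeval_unipotent_eq h1 hg h10 h00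
    have h4 := congrArg (fun q => (Polynomial.derivative q).eval 0) h3
    simpa [gens, Polynomial.derivative_pow, hnk, h2] using h4

end Dihedral

end KleinType

namespace HilbertKunz

/-! ### Values of homogeneous invariants along an orbit. -/

section Homogeneous

variable {k : Type*} [Field k]

theorem eval_eq_sum_of_isHomogeneous {f : MvPolynomial (Fin 2) k} {m : ℕ}
    (hf : f.IsHomogeneous m) (u : Fin 2 → k) :
    eval u f = ∑ j ∈ Finset.range (m + 1), coeff (expo (m - j) j) f * (u 0 ^ (m - j) * u 1 ^ j) := by
  have hdeg : ∀ d ∈ f.support, d 0 + d 1 = m := by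
    intro d hd
    rw [← degree_eq]
    by_contra h
    exact mem_support_iff.mp hd (hf.coeff_eq_zero h)
  rw [eval_eq']
  have hinj : Set.InjOn (fun d : Fin 2 →₀ ℕ => d 1) f.support := by
    intro d hd e he h
    have h1 := hdeg d hd
    have h2 := hdeg e he
    change d 1 = e 1 at h
    rw [eq_expo d, eq_expo e, h, show d 0 = e 0 by omega]
  rw [← Finset.sum_subset (s₁ := f.support.image fun d => d 1)]
  · rw [Finset.sum_image hinj]
    refine Finset.sum_congr rfl fun d hd => ?_
    rw [Fin.prod_univ_two, ← hdeg d hd, Nat.add_sub_cancel, ← eq_expo d]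
  · intro j hj
    obtain ⟨d, hd, rfl⟩ := Finset.mem_image.mp hj
    have := hdeg d hd
    exact Finset.mem_range.mpr (by omega)
  · intro j _ hj
    have : coeff (expo (m - j) j) f = 0 := by
      by_contra h
      exact hj (Finset.mem_image.mpr ⟨_, mem_support_iff.mpr h, by simp [expo]⟩)
    rw [this, zero_mul]

/-- Matrices with non-proportional first columns. -/
theorem independent_of_columns {L : Type*} {Z : L → SpecialLinearGroup (Fin 2) k} {v w : L → k}
    (hcol : ∀ l, ∃ c, c ≠ 0 ∧ Z l 0 0 = c * v l ∧ Z l 1 0 = c * w l)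
    (hvw : ∀ l l', l ≠ l' → v l * w l' - w l * v l' ≠ 0) (l l' : L) (h : l ≠ l') :
    Z l 0 0 * Z l' 1 0 - Z l 1 0 * Z l' 0 0 ≠ 0 := by
  obtain ⟨c, hc, h0, h1⟩ := hcol l
  obtain ⟨c', hc', h0', h1'⟩ := hcol l'
  have : Z l 0 0 * Z l' 1 0 - Z l 1 0 * Z l' 0 0 = c * c' * (v l * w l' - w l * v l') := by
    rw [h0, h1, h0', h1']
    ring
  rw [this]
  exact mul_ne_zero (mul_ne_zero hc hc') (hvw l l' h)

theorem mul_entry (M N : SpecialLinearGroup (Fin 2) k) (i j : Fin 2) :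
    (M * N) i j = M i 0 * N 0 j + M i 1 * N 1 j := by
  rw [Matrix.SpecialLinearGroup.coe_mul, Matrix.mul_apply, Fin.sum_univ_two]

/-- The value at `(1, 0)` determines the value at each representative of a line of the orbit, with a
factor that depends on the scaling `c`. -/
theorem eval_eq_of_column {H : Subgroup (SpecialLinearGroup (Fin 2) k)}
    {f : MvPolynomial (Fin 2) k} {m : ℕ} (hf : f.IsHomogeneous m) (hfH : f ∈ invariantRing H)
    {g : SpecialLinearGroup (Fin 2) k} (hg : g ∈ H) {c : k} {v w : k} (h0 : g 0 0 = c * v)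
    (h1 : g 1 0 = c * w) : c ^ m * eval ![v, w] f = eval ![1, 0] f := by
  rw [← eval_mulVec_of_mem hfH hg ![1, 0], ← eval_smul_of_isHomogeneous hf]
  congr 2
  ext i
  fin_cases i <;> simp [h0, h1]

end Homogeneous

end HilbertKunz

namespace KleinType

open HilbertKunz

/-! ### The binary tetrahedral group and the forms `t`, `W`, `χ`. -/

section Octahedral

variable {k : Type*} [Field k]

theorem isHomogeneous_octaT : (octaT k).IsHomogeneous 6 := by
  refine isHomogeneous_of_homogenize ?_
  simp only [octaT, map_sub, map_mul, map_pow, homogenize_X]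
  ring

theorem isHomogeneous_octaW : (octaW k).IsHomogeneous 8 := by
  refine isHomogeneous_of_homogenize ?_
  simp only [octaW, map_add, map_mul, map_pow, map_ofNat, homogenize_X]
  ring

theorem isHomogeneous_octaX : (octaX k).IsHomogeneous 12 := by
  refine isHomogeneous_of_homogenize ?_
  simp only [octaX, map_add, map_sub, map_mul, map_pow, map_ofNat, homogenize_X]
  ring

theorem octaX_sq : octaX k ^ 2 = octaW k ^ 3 - 108 * octaT k ^ 4 := by
  rw [octaX, octaW, octaT]
  ring

theorem octaT_ne_zero : octaT k ≠ 0 := by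
  intro h
  have h1 := congrArg (aeval ![(Polynomial.X : Polynomial k), 1]) h
  simp only [octaT, map_sub, map_mul, map_pow, aeval_X, map_zero] at h1
  have h2 := congrArg (fun q => Polynomial.coeff q 1) h1
  simp [Polynomial.coeff_X_pow] at h2

variable {i : k}

theorem det_tetra (hi : i ^ 2 = -1) (h2 : (2 : k) ≠ 0) :
    (!![(1 - i) / 2, (1 - i) / 2; (-1 - i) / 2, (1 + i) / 2]).det = 1 := by
  rw [det_fin_two]
  simp
  field_simp
  linear_combination -2 * hi

theorem det_diag_neg (hi : i ^ 2 = -1) : (!![i, 0; 0, -i]).det = 1 := by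
  rw [det_fin_two]
  simp
  linear_combination -hi

/-- `W` and `χ` are polynomials in `x₁⁴`, `x₂⁴`, and `t = x₁x₂ (x₁⁴ - x₂⁴)`, so fourth powers are
nearly all that matters. The third generator is `x₁ ↦ a (x₁ + x₂)`, `x₂ ↦ -i a (x₁ - x₂)` with `a =
(1 - i) / 2`, for which `4 a⁴ = -1`. -/
theorem octa_mem_invariantRing (hi : i ^ 2 = -1) (h2 : (2 : k) ≠ 0) :
    octaT k ∈ invariantRing (generated (tetrahedralGens i)) ∧
    octaW k ∈ invariantRing (generated (tetrahedralGens i)) ∧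
    octaX k ∈ invariantRing (generated (tetrahedralGens i)) := by
  have hI := C_sq_eq hi
  set I : MvPolynomial (Fin 2) k := C i with hIdef
  set a : MvPolynomial (Fin 2) k := C ((1 - i) / 2) with ha
  have hC2 : (C 2 : MvPolynomial (Fin 2) k) = 2 := map_ofNat C 2
  have ha2 : 2 * a = 1 - I := by
    rw [ha, hIdef, ← hC2, ← C_mul, ← C_1, ← C_sub]
    congr 1
    field_simp
  have ha3 : 2 * a ^ 2 = -I := by
    rw [ha, hIdef, ← hC2, ← C_pow, ← C_mul, ← C_neg]
    congr 1
    field_simp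
    linear_combination hi
  have ha4 : 4 * a ^ 4 = -1 := by
    linear_combination (2 * a ^ 2 - I) * ha3 + hI
  have hI4 : I ^ 4 = 1 := by linear_combination (I ^ 2 - 1) * hI
  have hB0 : subst !![(1 - i) / 2, (1 - i) / 2; (-1 - i) / 2, (1 + i) / 2] (X 0) =
      a * (X 0 + X 1) := by
    rw [subst_X]
    simp [ha]
    ring
  have hB1 : subst !![(1 - i) / 2, (1 - i) / 2; (-1 - i) / 2, (1 + i) / 2] (X 1) =
      -(I * a) * (X 0 - X 1) := by
    have e1 : (-1 - i) / 2 = -(i * ((1 - i) / 2)) := by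
      field_simp
      linear_combination -hi
    have e2 : (1 + i) / 2 = i * ((1 - i) / 2) := by
      field_simp
      linear_combination hi
    rw [subst_X, e1, e2]
    simp [ha, hIdef]
    ring
  have hB04 : (a * (X 0 + X 1)) ^ 4 = a ^ 4 * (X 0 + X 1) ^ 4 := by ring
  have hB14 : (-(I * a) * (X 0 - X 1)) ^ 4 = a ^ 4 * (X 0 - X 1) ^ 4 := by
    linear_combination a ^ 4 * (X 0 - X 1) ^ 4 * hI4
  have hT : octaT k = X 0 * X 1 * (X 0 ^ 4 - X 1 ^ 4) := by rw [octaT]; ring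
  have hW : octaW k = (X 0 ^ 4) ^ 2 + 14 * X 0 ^ 4 * X 1 ^ 4 + (X 1 ^ 4) ^ 2 := by rw [octaW]; ring
  have hX : octaX k = (X 0 ^ 4) ^ 3 - 33 * (X 0 ^ 4) ^ 2 * X 1 ^ 4 - 33 * X 0 ^ 4 * (X 1 ^ 4) ^ 2
      + (X 1 ^ 4) ^ 3 := by rw [octaX]; ring
  have hD0 : (I * X 0) ^ 4 = X 0 ^ 4 := by rw [mul_pow, hI4, one_mul]
  have hD1 : (I * X 1) ^ 4 = X 1 ^ 4 := by rw [mul_pow, hI4, one_mul]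
  have hD1' : (-I * X 1) ^ 4 = X 1 ^ 4 := by linear_combination X 1 ^ 4 * hI4
  refine ⟨mem_invariantRing_generated ?_, mem_invariantRing_generated ?_,
    mem_invariantRing_generated ?_⟩ <;> rintro _ (rfl | rfl | rfl)
  · rw [hT]
    simp only [map_mul, map_sub, map_pow, subst_diag_X_zero, subst_diag_X_one, C_neg, ← hIdef, hD0,
      hD1']
    linear_combination -X 0 * X 1 * (X 0 ^ 4 - X 1 ^ 4) * hI
  · rw [hT]
    simp only [map_mul, map_sub, map_pow, subst_anti_X_zero, subst_anti_X_one, ← hIdef, hD0, hD1]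
    linear_combination -X 0 * X 1 * (X 0 ^ 4 - X 1 ^ 4) * hI
  · rw [hT]
    simp only [map_mul, map_sub, map_pow, hB0, hB1, hB04, hB14]
    linear_combination X 0 * X 1 * (X 0 ^ 4 - X 1 ^ 4) *
      (-I * (2 * a ^ 2 * ha4 - ha3) - hI)
  · rw [hW]
    simp only [map_mul, map_add, map_pow, map_ofNat, subst_diag_X_zero, subst_diag_X_one, C_neg,
      ← hIdef, hD0, hD1']
  · rw [hW]
    simp only [map_mul, map_add, map_pow, map_ofNat, subst_anti_X_zero, subst_anti_X_one,
      ← hIdef, hD0, hD1]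
    ring
  · rw [hW]
    simp only [map_mul, map_add, map_pow, map_ofNat, hB0, hB1, hB04, hB14]
    generalize a ^ 4 = q at ha4
    linear_combination (X 0 ^ 8 + 14 * X 0 ^ 4 * X 1 ^ 4 + X 1 ^ 8) * (4 * q - 1) * ha4
  · rw [hX]
    simp only [map_mul, map_add, map_sub, map_pow, map_ofNat, subst_diag_X_zero, subst_diag_X_one,
      C_neg, ← hIdef, hD0, hD1']
  · rw [hX]
    simp only [map_mul, map_add, map_sub, map_pow, map_ofNat, subst_anti_X_zero, subst_anti_X_one,
      ← hIdef, hD0, hD1]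
    ring
  · rw [hX]
    simp only [map_mul, map_add, map_sub, map_pow, map_ofNat, hB0, hB1, hB04, hB14]
    generalize a ^ 4 = q at ha4
    linear_combination -(X 0 ^ 12 - 33 * X 0 ^ 8 * X 1 ^ 4 - 33 * X 0 ^ 4 * X 1 ^ 8 + X 1 ^ 12) *
      (16 * q ^ 2 - 4 * q + 1) * ha4

/-- The orbit of the line through `(1, 0)` is the zero set of `t`, the slopes being `0`, `∞`, `±i`,
`±1`: the vertices of an octahedron. The scaling condition `4 c⁴ = -1` on the last four is needed to
exclude invariants of degree `4`. -/
theorem exists_tetra_lines (hi : i ^ 2 = -1) (h2 : (2 : k) ≠ 0) :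
    ∃ Z : Fin 6 → SpecialLinearGroup (Fin 2) k,
      (∀ l, Z l ∈ generated (tetrahedralGens i)) ∧
      ∀ l, ∃ c, (c ≠ 0 ∧ (2 ≤ l → 4 * c ^ 4 = -1)) ∧ Z l 0 0 = c * ![1, 0, 1, 1, 1, 1] l ∧
        Z l 1 0 = c * ![0, 1, -i, i, 1, -1] l := by
  have hi0 := ne_zero_of_sq hi
  set d : SpecialLinearGroup (Fin 2) k := ⟨!![i, 0; 0, -i], det_diag_neg hi⟩ with hd
  set K : SpecialLinearGroup (Fin 2) k := ⟨!![0, i; i, 0], det_anti hi⟩ with hK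
  set B : SpecialLinearGroup (Fin 2) k :=
    ⟨!![(1 - i) / 2, (1 - i) / 2; (-1 - i) / 2, (1 + i) / 2], det_tetra hi h2⟩ with hB
  have hdm : d ∈ generated (tetrahedralGens i) := mem_generated (by simp [tetrahedralGens, hd])
  have hKm : K ∈ generated (tetrahedralGens i) := mem_generated (by simp [tetrahedralGens, hK])
  have hBm : B ∈ generated (tetrahedralGens i) := mem_generated (by simp [tetrahedralGens, hB])
  have hm := fun x y => Subgroup.mul_mem (generated (tetrahedralGens i)) (x := x) (y := y)
  have hc4 : ∀ {c : k} {l : Fin 6}, 4 * c ^ 4 = -1 → c ≠ 0 ∧ (2 ≤ l → 4 * c ^ 4 = -1) := by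
    intro c l hc
    refine ⟨?_, fun _ => hc⟩
    rintro rfl
    norm_num at hc
  refine ⟨![1, K, B, d * B, B * B, d * (B * B)], fun l => ?_, fun l => ?_⟩
  · fin_cases l
    exacts [Subgroup.one_mem _, hKm, hBm, hm _ _ hdm hBm, hm _ _ hBm hBm,
      hm _ _ hdm (hm _ _ hBm hBm)]
  · have h4 : ((1 - i) / 2) ^ 4 * 4 = -1 := by
      field_simp
      linear_combination (4 * i ^ 2 - 16 * i + 20) * hi
    have h4' : ((-1 - i) / 2) ^ 4 * 4 = -1 := by
      field_simp
      linear_combination (4 * i ^ 2 + 16 * i + 20) * hi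
    have hi4 : i ^ 4 = 1 := by linear_combination (i ^ 2 - 1) * hi
    fin_cases l
    · exact ⟨1, ⟨one_ne_zero, by simp⟩, by simp, by simp⟩
    · exact ⟨i, ⟨hi0, by simp⟩, by simp [hK], by simp [hK]⟩
    · refine ⟨(1 - i) / 2, hc4 (by linear_combination h4), ?_, ?_⟩
      · simp [hB]
      · simp [hB]
        field_simp
        linear_combination -hi
    · refine ⟨i * ((1 - i) / 2), hc4 (by linear_combination h4 + ((1 - i) / 2) ^ 4 * 4 * hi4),
        ?_, ?_⟩
      · change (d * B) 0 0 = _ * 1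
        rw [mul_entry]
        simp [hB, hd]
      · change (d * B) 1 0 = _ * i
        rw [mul_entry]
        simp [hB, hd]
        field_simp
        linear_combination hi
    · refine ⟨(-1 - i) / 2, hc4 (by linear_combination h4'), ?_, ?_⟩
      · change (B * B) 0 0 = _ * 1
        rw [mul_entry]
        simp [hB]
        field_simp
        linear_combination 2 * hi
      · change (B * B) 1 0 = _ * 1
        rw [mul_entry]
        simp [hB]
        field_simp
        ring
    · refine ⟨i * ((-1 - i) / 2), hc4 (by linear_combination h4' + ((-1 - i) / 2) ^ 4 * 4 * hi4),
        ?_, ?_⟩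
      · change (d * (B * B)) 0 0 = _ * 1
        rw [mul_entry, mul_entry, mul_entry]
        simp [hB, hd]
        field_simp
        exact Or.inl (by linear_combination 2 * hi)
      · change (d * (B * B)) 1 0 = _ * -1
        rw [mul_entry, mul_entry, mul_entry]
        simp [hB, hd]
        field_simp
        exact Or.inl (by ring)

theorem tetra_independent (hi : i ^ 2 = -1) (h2 : (2 : k) ≠ 0) (l l' : Fin 6) (h : l ≠ l') :
    (![1, 0, 1, 1, 1, 1] l : k) * ![0, 1, -i, i, 1, -1] l' -
      ![0, 1, -i, i, 1, -1] l * ![1, 0, 1, 1, 1, 1] l' ≠ 0 := by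
  have hi0 := ne_zero_of_sq hi
  have h2i : 2 * i ≠ 0 := mul_ne_zero h2 hi0
  have e1 : 1 - i ≠ 0 := fun h => h2 (by linear_combination (1 + i) * h + hi)
  have e2 : 1 + i ≠ 0 := fun h => h2 (by linear_combination (1 - i) * h + hi)
  fin_cases l <;> fin_cases l' <;> simp at h ⊢ <;> first
    | assumption
    | (intro h'; exact h2i (by linear_combination h'))
    | (intro h'; exact h2i (by linear_combination -h'))
    | (intro h'; exact h2 (by linear_combination h'))
    | (intro h'; exact h2 (by linear_combination -h'))
    | (intro h'; exact e1 (by linear_combination h'))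
    | (intro h'; exact e1 (by linear_combination -h'))
    | (intro h'; exact e2 (by linear_combination h'))
    | (intro h'; exact e2 (by linear_combination -h'))

theorem isPrimitiveRoot_four (hi : i ^ 2 = -1) (h2 : (2 : k) ≠ 0) : IsPrimitiveRoot i 4 := by
  refine IsPrimitiveRoot.mk_of_lt i (by norm_num) (by linear_combination (i ^ 2 - 1) * hi) ?_
  intro l hl0 hl4 h
  interval_cases l
  · exact h2 (by linear_combination -(i + 1) * h + hi)
  · exact h2 (by linear_combination hi - h)
  · exact h2 (by linear_combination (i - 1) * h + (i - i ^ 2 + 1) * hi)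

/-- The element `diag(i, -i)` forces `4 ∣ m`, and every multiple of `4` other than `4` itself has
the form `8 a + 12 b`. Degree `4` is excluded by the values of `f` on the six lines. -/
theorem degree_of_eval_ne_zero_tetra (hi : i ^ 2 = -1) (h6 : (6 : k) ≠ 0) {m : ℕ}
    {f : MvPolynomial (Fin 2) k} (hfH : f ∈ invariantRing (generated (tetrahedralGens i)))
    (hf : f.IsHomogeneous m) (h0 : eval ![1, 0] f ≠ 0) : ∃ a b, m = a * 8 + b * 12 := by
  have h2 : (2 : k) ≠ 0 := fun h => h6 (by linear_combination 3 * h)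
  have hd : (⟨!![i, 0; 0, -i], det_diag_neg hi⟩ : SpecialLinearGroup (Fin 2) k) ∈
      generated (tetrahedralGens i) := mem_generated (by simp [tetrahedralGens])
  have h4 : 4 ∣ m := (isPrimitiveRoot_four hi h2).dvd_of_pow_eq_one _
    (by simpa using pow_eq_one_of_upper hf hfH h0 hd (by simp))
  have hm : m ≠ 4 := by
    rintro rfl
    obtain ⟨Z, hZ, hcol⟩ := exists_tetra_lines hi h2
    have hv : ∀ l : Fin 6, 2 ≤ l → eval ![![1, 0, 1, 1, 1, 1] l, ![0, 1, -i, i, 1, -1] l] f =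
        -4 * eval ![1, 0] f := by
      intro l hl
      obtain ⟨c, ⟨-, hc⟩, hc0, hc1⟩ := hcol l
      have := eval_eq_of_column hf hfH (hZ l) hc0 hc1
      rw [← this]
      linear_combination eval ![![1, 0, 1, 1, 1, 1] l, ![0, 1, -i, i, 1, -1] l] f * hc hl
    have hv1 : eval ![0, 1] f = eval ![1, 0] f := by
      have hK : (⟨!![0, i; i, 0], det_anti hi⟩ : SpecialLinearGroup (Fin 2) k) ∈
        generated (tetrahedralGens i) := mem_generated (by simp [tetrahedralGens])
      have := eval_eq_of_column hf hfH hK (c := i) (v := 0) (w := 1) (by simp) (by simp)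
      linear_combination this - eval ![0, 1] f * (i ^ 2 - 1) * hi
    have e2 := hv 2 (by decide)
    have e3 := hv 3 (by decide)
    have e4 := hv 4 (by decide)
    have e5 := hv 5 (by decide)
    have h24 : (2 * 2 * 6 : k) ≠ 0 := mul_ne_zero (mul_ne_zero h2 h2) h6
    rw [eval_eq_sum_of_isHomogeneous hf] at e2 e3 e4 e5 hv1 h0
    rw [eval_eq_sum_of_isHomogeneous hf] at e2 e3 e4 e5 hv1
    simp [Finset.sum_range_succ] at e2 e3 e4 e5 hv1 h0
    refine mul_ne_zero h24 h0 ?_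
    -- Summing over `(1, ±1)` and `(1, ±i)` leaves four times the two outer coefficients, both equal
    -- to `v = f(1, 0)`, while each of the four values is `-4 v`. So `8 v = -16 v`, that is `24 v =
    -- 0`.
    linear_combination e2 + e3 + e4 + e5 - 4 * hv1 - 2 * coeff (expo 2 2) f * hi -
      2 * coeff (expo 0 4) f * (i ^ 2 - 1) * hi
  obtain ⟨q, rfl⟩ := h4
  have : q ≠ 1 := by rintro rfl; exact hm rfl
  rcases Nat.even_or_odd' q with ⟨r, rfl | rfl⟩
  · exact ⟨r, 0, by omega⟩
  · exact ⟨r - 1, 1, by omega⟩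

/-- The orbit of six lines under a group of type `E₆` or `E₇`. -/
theorem exists_octa_lines (hi : i ^ 2 = -1) (h2 : (2 : k) ≠ 0)
    {H : Subgroup (SpecialLinearGroup (Fin 2) k)} (hH : generated (tetrahedralGens i) ≤ H) :
    ∃ Z : Fin 6 → SpecialLinearGroup (Fin 2) k, (∀ l, Z l ∈ H) ∧
      ∀ l l', l ≠ l' → Z l 0 0 * Z l' 1 0 - Z l 1 0 * Z l' 0 0 ≠ 0 := by
  obtain ⟨Z, hZ, hcol⟩ := exists_tetra_lines hi h2
  refine ⟨Z, fun l => hH (hZ l), independent_of_columns (fun l => ?_) (tetra_independent hi h2)⟩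
  obtain ⟨c, ⟨hc, -⟩, h0, h1⟩ := hcol l
  exact ⟨c, hc, h0, h1⟩

theorem range_gens_E6 : Set.range (gens k E6) = {octaT k, octaW k, octaX k} := by
  change Set.range ![octaT k, octaW k, octaX k] = _
  rw [Matrix.range_cons, Matrix.range_cons, Matrix.range_cons, Matrix.range_empty,
    Set.union_empty, Set.singleton_union, Set.singleton_union]

theorem eval_octaT : eval ![1, 0] (octaT k) = 0 := by simp [octaT]

theorem eval_octaW : eval ![1, 0] (octaW k) = 1 := by simp [octaW]

theorem eval_octaX : eval ![1, 0] (octaX k) = 1 := by simp [octaX]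

theorem invariantRing_E6 (hi : i ^ 2 = -1) (h6 : (6 : k) ≠ 0) :
    invariantRing (generated (tetrahedralGens i)) = Algebra.adjoin k (Set.range (gens k E6)) := by
  have h2 : (2 : k) ≠ 0 := fun h => h6 (by linear_combination 3 * h)
  obtain ⟨Z, hZ, hind⟩ := exists_octa_lines hi h2 le_rfl
  obtain ⟨hT, hW, hX⟩ := octa_mem_invariantRing hi h2
  rw [range_gens_E6]
  exact invariantRing_eq_adjoin_of_lines hZ hind (a := 8) (b := 12) isHomogeneous_octaT
    isHomogeneous_octaW isHomogeneous_octaX hT hW hX eval_octaT (by simp [eval_octaW])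
    (by simp [eval_octaX]) octaT_ne_zero
    fun m f hfH hf h0 => degree_of_eval_ne_zero_tetra hi h6 hfH hf h0

/-- Covers `E₆` with `e = 1` and `E₇` with `e = 2`, where only `t²` is invariant. The zeros of `t`
confine the orbit to the six lines, and `W`, of the invertible degree `8`, excludes unipotent
elements. -/
theorem card_of_octaT_pow (hi : i ^ 2 = -1) (h2 : (2 : k) ≠ 0)
    {H : Subgroup (SpecialLinearGroup (Fin 2) k)} (hH : generated (tetrahedralGens i) ≤ H)
    {r e : ℕ} [NeZero r] {ζ : k} (hζ : IsPrimitiveRoot ζ r) {D : SpecialLinearGroup (Fin 2) k}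
    (hD : D ∈ H) (hDζ : (D : Matrix (Fin 2) (Fin 2) k) = !![ζ, 0; 0, ζ⁻¹])
    (hT : octaT k ^ e ∈ invariantRing H) (hW : octaW k ∈ invariantRing H) (he : e ≠ 0)
    (heig : ∀ g ∈ H, g 1 0 = 0 → g 0 0 ^ r = 1) : Nat.card H = 6 * r := by
  obtain ⟨Z, hZ, hind⟩ := exists_octa_lines hi h2 le_rfl
  refine card_eq_of_lines (L := Fin 6) (fun l => hH (hZ l)) hind (fun g hg => ?_) hζ hD hDζ heig
    fun g hg h10 h00 => ?_
  · have h3 := eval_mulVec_of_mem hT hg ![1, 0]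
    rw [map_pow, map_pow, eval_octaT, zero_pow he] at h3
    obtain ⟨l, hl⟩ := exists_eval_eq_zero_iff hZ hind isHomogeneous_octaT
      (octa_mem_invariantRing hi h2).1 eval_octaT octaT_ne_zero (pow_eq_zero_iff he |>.mp h3)
    exact ⟨l, by simpa using hl⟩
  · have h3 := aeval_unipotent_eq hW hg h10 h00
    have h4 := congrArg (fun q => (Polynomial.derivative q).eval 0) h3
    have h8 : (8 : k) ≠ 0 := by
      rw [show (8 : k) = 2 * 2 * 2 by norm_num]
      exact mul_ne_zero (mul_ne_zero h2 h2) h2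
    simpa [octaW, Polynomial.derivative_pow, h8] using h4

theorem card_E6 (hi : i ^ 2 = -1) (h2 : (2 : k) ≠ 0) :
    Nat.card (generated (tetrahedralGens i)) = 24 := by
  obtain ⟨hT, hW, hX⟩ := octa_mem_invariantRing hi h2
  have hiv : -i = i⁻¹ := by
    refine eq_inv_of_mul_eq_one_left ?_
    linear_combination -hi
  have hd : (⟨!![i, 0; 0, -i], det_diag_neg hi⟩ : SpecialLinearGroup (Fin 2) k) ∈
      generated (tetrahedralGens i) := mem_generated (by simp [tetrahedralGens])
  have h := card_of_octaT_pow hi h2 le_rfl (r := 4) (e := 1) (isPrimitiveRoot_four hi h2) hd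
    (by simp [← hiv]) (by rwa [pow_one]) hW one_ne_zero (fun g hg h10 => ?_)
  · rw [h]
  · have h1 := pow_eq_one_of_upper isHomogeneous_octaW hW (by simp [eval_octaW]) hg h10
    have h3 := pow_eq_one_of_upper isHomogeneous_octaX hX (by simp [eval_octaX]) hg h10
    -- The eigenvalue is killed by the degrees `8` and `12` of `W` and `χ`, hence by `4`.
    rw [show 12 = 8 + 4 by norm_num, pow_add, h1, one_mul] at h3
    exact h3

end Octahedral

/-! ### The binary octahedral group -/

section E7

variable {k : Type*} [Field k] {ζ : k}

theorem sq_sq_eq_neg_one (hζ : IsPrimitiveRoot ζ 8) : (ζ ^ 2) ^ 2 = -1 := by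
  have h1 : ζ ^ 4 - 1 ≠ 0 := sub_ne_zero.mpr (hζ.pow_ne_one_of_pos_of_lt (by norm_num) (by norm_num))
  have h2 : (ζ ^ 4 - 1) * (ζ ^ 4 + 1) = 0 := by linear_combination hζ.pow_eq_one
  linear_combination (mul_eq_zero.mp h2).resolve_left h1

theorem tetra_le_octa : generated (tetrahedralGens (ζ ^ 2)) ≤
    generated (insert !![ζ, 0; 0, ζ⁻¹] (tetrahedralGens (ζ ^ 2))) :=
  Subgroup.closure_mono fun _ h => Set.mem_insert_of_mem _ h

theorem subst_octa (hζ : IsPrimitiveRoot ζ 8) :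
    subst !![ζ, 0; 0, ζ⁻¹] (octaT k) = -octaT k ∧ subst !![ζ, 0; 0, ζ⁻¹] (octaW k) = octaW k ∧
    subst !![ζ, 0; 0, ζ⁻¹] (octaX k) = -octaX k := by
  have h4 : (C ζ : MvPolynomial (Fin 2) k) ^ 4 = -1 := by
    have := sq_sq_eq_neg_one hζ
    rw [← C_pow, show ζ ^ 4 = -1 by rw [← this]; ring, C_neg, C_1]
  have h5 : (C ζ : MvPolynomial (Fin 2) k) * C ζ⁻¹ = 1 := by
    rw [← C_mul, mul_inv_cancel₀ (hζ.ne_zero (by norm_num)), C_1]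
  have h6 : (C ζ⁻¹ : MvPolynomial (Fin 2) k) ^ 4 = -1 := by
    have : (C ζ * C ζ⁻¹ : MvPolynomial (Fin 2) k) ^ 4 = 1 := by rw [h5, one_pow]
    rw [mul_pow, h4] at this
    linear_combination -this
  have hx : (C ζ * X 0 : MvPolynomial (Fin 2) k) ^ 4 = -X 0 ^ 4 := by
    rw [mul_pow, h4, neg_one_mul]
  have hy : (C ζ⁻¹ * X 1 : MvPolynomial (Fin 2) k) ^ 4 = -X 1 ^ 4 := by
    rw [mul_pow, h6, neg_one_mul]
  refine ⟨?_, ?_, ?_⟩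
  · have hT : octaT k = X 0 * X 1 * (X 0 ^ 4 - X 1 ^ 4) := by rw [octaT]; ring
    rw [hT]
    simp only [map_mul, map_sub, map_pow, subst_diag_X_zero, subst_diag_X_one, hx, hy]
    linear_combination X 0 * X 1 * (X 1 ^ 4 - X 0 ^ 4) * h5
  · have hW : octaW k = (X 0 ^ 4) ^ 2 + 14 * X 0 ^ 4 * X 1 ^ 4 + (X 1 ^ 4) ^ 2 := by
      rw [octaW]; ring
    rw [hW]
    simp only [map_mul, map_add, map_pow, map_ofNat, subst_diag_X_zero, subst_diag_X_one, hx, hy]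
    ring
  · have hX : octaX k = (X 0 ^ 4) ^ 3 - 33 * (X 0 ^ 4) ^ 2 * X 1 ^ 4
        - 33 * X 0 ^ 4 * (X 1 ^ 4) ^ 2 + (X 1 ^ 4) ^ 3 := by rw [octaX]; ring
    rw [hX]
    simp only [map_mul, map_add, map_sub, map_pow, map_ofNat, subst_diag_X_zero, subst_diag_X_one,
      hx, hy]
    ring

theorem gens_E7_mem (hζ : IsPrimitiveRoot ζ 8) (h2 : (2 : k) ≠ 0) (j : Fin 3) :
    gens k E7 j ∈ invariantRing (generated (insert !![ζ, 0; 0, ζ⁻¹] (tetrahedralGens (ζ ^ 2)))) := by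
  have hi := sq_sq_eq_neg_one hζ
  obtain ⟨hT, hW, hX⟩ := octa_mem_invariantRing hi h2
  obtain ⟨sT, sW, sX⟩ := subst_octa hζ
  have hdet : ∀ M ∈ tetrahedralGens (ζ ^ 2), M.det = 1 := by
    rintro _ (rfl | rfl | rfl)
    exacts [det_diag_neg hi, det_anti hi, det_tetra hi h2]
  have key : ∀ f ∈ invariantRing (generated (tetrahedralGens (ζ ^ 2))),
      subst !![ζ, 0; 0, ζ⁻¹] f = f →
      f ∈ invariantRing (generated (insert !![ζ, 0; 0, ζ⁻¹] (tetrahedralGens (ζ ^ 2)))) := by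
    intro f hf hζf
    refine mem_invariantRing_generated ?_
    rintro M (rfl | hM)
    · exact hζf
    · exact subst_eq_of_mem_invariantRing_generated hf hM (hdet M hM)
  fin_cases j
  · exact key _ hW sW
  · refine key _ (Subalgebra.pow_mem _ hT 2) ?_
    change subst _ (octaT k ^ 2) = octaT k ^ 2
    rw [map_pow, sT, neg_sq]
  · refine key _ (Subalgebra.mul_mem _ hT hX) ?_
    change subst _ (octaT k * octaX k) = octaT k * octaX k
    rw [map_mul, sT, sX, neg_mul_neg]

/-- The new generator fixes `W` and changes the signs of `t` and `χ`, so it acts by signs on the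
generators of the invariants of type `E₆`. The relation between the three expresses `χ²` by `W` and
`t²`. -/
theorem invariantRing_E7 (hζ : IsPrimitiveRoot ζ 8) (h6 : (6 : k) ≠ 0) :
    invariantRing (generated (insert !![ζ, 0; 0, ζ⁻¹] (tetrahedralGens (ζ ^ 2)))) =
      Algebra.adjoin k (Set.range (gens k E7)) := by
  have h2 : (2 : k) ≠ 0 := fun h => h6 (by linear_combination 3 * h)
  have hi := sq_sq_eq_neg_one hζ
  obtain ⟨sT, sW, sX⟩ := subst_octa hζ
  have hle : Algebra.adjoin k (Set.range (gens k E7)) ≤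
      invariantRing (generated (insert !![ζ, 0; 0, ζ⁻¹] (tetrahedralGens (ζ ^ 2)))) := by
    rw [Algebra.adjoin_le_iff]
    rintro _ ⟨j, rfl⟩
    exact gens_E7_mem hζ h2 j
  refine le_antisymm (fun f hf => ?_) hle
  have hf6 : f ∈ invariantRing (generated (tetrahedralGens (ζ ^ 2))) := fun g hg =>
    hf g (tetra_le_octa hg)
  rw [invariantRing_E6 hi h6, range_gens_E6] at hf6
  have hdet := det_diag_inv (hζ.ne_zero (by norm_num))
  have hS : ∀ j, gens k E7 j ∈ Algebra.adjoin k (Set.range (gens k E7)) := fun j =>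
    Algebra.subset_adjoin ⟨j, rfl⟩
  have hTT : octaT k * octaT k ∈ Algebra.adjoin k (Set.range (gens k E7)) := by
    rw [← sq]
    exact hS 1
  refine mem_of_mem_double_cover h2 (e₁ := octaT k) (e₂ := octaX k) hTT (hS 2) ?_
    (subst !![ζ, 0; 0, ζ⁻¹]) (fun s hs => ?_) sT sX ?_ hf6 ?_
  · have : octaX k * octaX k = gens k E7 0 ^ 3 -
        algebraMap k _ 108 * (octaT k * octaT k) ^ 2 := by
      rw [map_ofNat, ← sq, octaX_sq]
      change _ = octaW k ^ 3 - _
      ring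
    rw [this]
    exact Subalgebra.sub_mem _ (Subalgebra.pow_mem _ (hS 0) 3)
      (Subalgebra.mul_mem _ (Subalgebra.algebraMap_mem _ _) (Subalgebra.pow_mem _ hTT 2))
  · exact subst_eq_of_mem_invariantRing_generated (hle hs) (Set.mem_insert _ _) hdet
  · have h0 := Subalgebra.zero_mem (Algebra.adjoin k (Set.range (gens k E7)))
    have h1 := Subalgebra.one_mem (Algebra.adjoin k (Set.range (gens k E7)))
    rintro _ (rfl | rfl | rfl)
    · exact ⟨0, h0, 1, h1, 0, h0, by ring⟩
    · exact ⟨_, hS 0, 0, h0, 0, h0, by rw [zero_mul, zero_mul, add_zero, add_zero]; rfl⟩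
    · exact ⟨0, h0, 0, h0, 1, h1, by ring⟩
  · exact subst_eq_of_mem_invariantRing_generated hf (Set.mem_insert _ _) hdet

theorem card_E7 (hζ : IsPrimitiveRoot ζ 8) (h2 : (2 : k) ≠ 0) :
    Nat.card (generated (insert !![ζ, 0; 0, ζ⁻¹] (tetrahedralGens (ζ ^ 2)))) = 48 := by
  have hi := sq_sq_eq_neg_one hζ
  have hD : (⟨!![ζ, 0; 0, ζ⁻¹], det_diag_inv (hζ.ne_zero (by norm_num))⟩ :
      SpecialLinearGroup (Fin 2) k) ∈
      generated (insert !![ζ, 0; 0, ζ⁻¹] (tetrahedralGens (ζ ^ 2))) :=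
    mem_generated (Set.mem_insert _ _)
  have hW : octaW k ∈ invariantRing (generated (insert !![ζ, 0; 0, ζ⁻¹] (tetrahedralGens (ζ ^ 2)))) :=
    gens_E7_mem hζ h2 0
  exact card_of_octaT_pow hi h2 tetra_le_octa (r := 8) (e := 2) hζ hD rfl (gens_E7_mem hζ h2 1) hW
    two_ne_zero fun g hg h10 =>
      pow_eq_one_of_upper isHomogeneous_octaW hW (by simp [eval_octaW]) hg h10

end E7

end KleinType

namespace KleinType

open HilbertKunz

/-! ### The binary icosahedral group -/

section IcosaIdentities

variable {R : Type*} [CommRing R] [IsDomain R] {x y P Q S : R}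

/-- `P` and `Q` stand for the images of `x`, `y` under the second generator, of which only the
quadratic relations are used. The three forms depend on `P`, `Q` through `P Q`, `P¹⁰ ± Q¹⁰` and `P⁵
Q⁵`. These are computed from `U`, `V`, `W` with `S² = 5`, after which integral polynomial identities
in `x`, `y` remain. -/
theorem icosa_identities (h10 : (10 : R) ≠ 0) (hS : S ^ 2 = 5)
    (hP : 10 * P ^ 2 = -5 * (x ^ 2 + y ^ 2) + S * (-x ^ 2 + 4 * x * y + y ^ 2))
    (hQ : 10 * Q ^ 2 = -5 * (x ^ 2 + y ^ 2) - S * (-x ^ 2 + 4 * x * y + y ^ 2))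
    (hPQ : 5 * (P * Q) = S * (x ^ 2 + x * y - y ^ 2)) :
    P * Q * (P ^ 10 + 11 * P ^ 5 * Q ^ 5 - Q ^ 10) =
      x * y * (x ^ 10 + 11 * x ^ 5 * y ^ 5 - y ^ 10) ∧
    P ^ 30 + Q ^ 30 + 522 * (P ^ 25 * Q ^ 5 - Q ^ 25 * P ^ 5)
        - 10005 * (P ^ 20 * Q ^ 10 + P ^ 10 * Q ^ 20) =
      x ^ 30 + y ^ 30 + 522 * (x ^ 25 * y ^ 5 - y ^ 25 * x ^ 5)
        - 10005 * (x ^ 20 * y ^ 10 + x ^ 10 * y ^ 20) ∧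
    -P ^ 20 - Q ^ 20 + 228 * (P ^ 15 * Q ^ 5 - Q ^ 15 * P ^ 5) - 494 * (P ^ 10 * Q ^ 10) =
      -x ^ 20 - y ^ 20 + 228 * (x ^ 15 * y ^ 5 - y ^ 15 * x ^ 5) - 494 * (x ^ 10 * y ^ 10) := by
  have h5 : (5 : R) ≠ 0 := fun h => h10 (by linear_combination 2 * h)
  have h2 : (2 : R) ≠ 0 := fun h => h10 (by linear_combination 5 * h)
  obtain ⟨U, hU⟩ : ∃ U, U = x ^ 2 + y ^ 2 := ⟨_, rfl⟩
  obtain ⟨V, hV⟩ : ∃ V, V = -x ^ 2 + 4 * x * y + y ^ 2 := ⟨_, rfl⟩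
  obtain ⟨W, hW⟩ : ∃ W, W = x ^ 2 + x * y - y ^ 2 := ⟨_, rfl⟩
  rw [← hU, ← hV] at hP hQ
  rw [← hW] at hPQ
  -- The factors `50`, `25` and `1250` complete the constants to `10⁵`, `5⁵` and `10⁵`, so that
  -- fifth powers of `10 P²`, `10 Q²` and `5 P Q` appear.
  have hA : 2000 * (P ^ 10 - Q ^ 10) = S * (125 * U ^ 4 * V + 50 * U ^ 2 * V ^ 3 + V ^ 5) := by
    have h50 : (50 : R) ≠ 0 := by
      rw [show (50 : R) = 10 * 5 by norm_num]
      exact mul_ne_zero h10 h5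
    refine mul_left_cancel₀ h50 ?_
    have e : (50 : R) * (2000 * (P ^ 10 - Q ^ 10)) = (10 * P ^ 2) ^ 5 - (10 * Q ^ 2) ^ 5 := by ring
    rw [e, hP, hQ]
    linear_combination (500 * U ^ 2 * V ^ 3 * S + 2 * V ^ 5 * S * (S ^ 2 + 5)) * hS
  have hB : 125 * (P ^ 5 * Q ^ 5) = S * W ^ 5 := by
    have h25 : (25 : R) ≠ 0 := by
      rw [show (25 : R) = 5 * 5 by norm_num]
      exact mul_ne_zero h5 h5
    refine mul_left_cancel₀ h25 ?_
    have e : (25 : R) * (125 * (P ^ 5 * Q ^ 5)) = (5 * (P * Q)) ^ 5 := by ring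
    rw [e, hPQ]
    linear_combination W ^ 5 * S * (S ^ 2 + 5) * hS
  have hE : 80 * (P ^ 10 + Q ^ 10) = -(5 * U ^ 5 + 10 * U ^ 3 * V ^ 2 + U * V ^ 4) := by
    have h1250 : (1250 : R) ≠ 0 := by
      rw [show (1250 : R) = 10 * (5 * (5 * 5)) by norm_num]
      exact mul_ne_zero h10 (mul_ne_zero h5 (mul_ne_zero h5 h5))
    refine mul_left_cancel₀ h1250 ?_
    have e : (1250 : R) * (80 * (P ^ 10 + Q ^ 10)) = (10 * P ^ 2) ^ 5 + (10 * Q ^ 2) ^ 5 := by ring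
    rw [e, hP, hQ]
    linear_combination (-2500 * U ^ 3 * V ^ 2 - 50 * U * V ^ 4 * (S ^ 2 + 5)) * hS
  obtain ⟨A, hA'⟩ : ∃ A, A = 125 * U ^ 4 * V + 50 * U ^ 2 * V ^ 3 + V ^ 5 := ⟨_, rfl⟩
  obtain ⟨B, hB'⟩ : ∃ B, B = 16 * W ^ 5 := ⟨_, rfl⟩
  rw [← hA'] at hA
  replace hB : 2000 * (P ^ 5 * Q ^ 5) = S * B := by rw [hB']; linear_combination 16 * hB
  have h2000 : (2000 : R) ≠ 0 := by
    rw [show (2000 : R) = 10 * 10 * 10 * 2 by norm_num]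
    exact mul_ne_zero (mul_ne_zero (mul_ne_zero h10 h10) h10) h2
  have h80 : (80 : R) ≠ 0 := by
    rw [show (80 : R) = 10 * 2 * 2 * 2 by norm_num]
    exact mul_ne_zero (mul_ne_zero (mul_ne_zero h10 h2) h2) h2
  have i1 : W * (A + 11 * B) = 2000 * (x * y * (x ^ 10 + 11 * x ^ 5 * y ^ 5 - y ^ 10)) := by
    rw [hA', hB', hU, hV, hW]
    ring
  have i3 : 5 * (-A ^ 2 + 228 * A * B - 496 * B ^ 2) = 2000 ^ 2 *
      (-x ^ 20 - y ^ 20 + 228 * (x ^ 15 * y ^ 5 - y ^ 15 * x ^ 5) - 494 * (x ^ 10 * y ^ 10)) := by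
    rw [hA', hB', hU, hV, hW]
    ring
  have i2 : -(5 * U ^ 5 + 10 * U ^ 3 * V ^ 2 + U * V ^ 4) *
      (5 * (A ^ 2 + 522 * A * B - 10004 * B ^ 2)) = 80 * 2000 ^ 2 *
      (x ^ 30 + y ^ 30 + 522 * (x ^ 25 * y ^ 5 - y ^ 25 * x ^ 5)
        - 10005 * (x ^ 20 * y ^ 10 + x ^ 10 * y ^ 20)) := by
    rw [hA', hB', hU, hV, hW]
    ring
  refine ⟨?_, ?_, ?_⟩
  · refine mul_left_cancel₀ (mul_ne_zero h5 h2000) ?_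
    linear_combination 5 * i1 + (2000 * (P ^ 10 - Q ^ 10) + 11 * (2000 * (P ^ 5 * Q ^ 5))) * hPQ +
      S * W * (hA + 11 * hB) + W * (A + 11 * B) * hS
  · refine mul_left_cancel₀ (mul_ne_zero h80 (pow_ne_zero 2 h2000)) ?_
    rw [← i2, ← hE]
    -- The form of degree `30` is `P¹⁰ + Q¹⁰` times a quadratic form in `P¹⁰ - Q¹⁰` and `P⁵ Q⁵`. The
    -- coefficient `-10004` instead of `-10005` compensates for the mixed term of `(P¹⁰ - Q¹⁰)²`; in
    -- degree `20` it is likewise `-496` instead of `-494`.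
    have e : (80 * 2000 ^ 2 : R) * (P ^ 30 + Q ^ 30 + 522 * (P ^ 25 * Q ^ 5 - Q ^ 25 * P ^ 5)
        - 10005 * (P ^ 20 * Q ^ 10 + P ^ 10 * Q ^ 20)) = 80 * (P ^ 10 + Q ^ 10) *
        ((2000 * (P ^ 10 - Q ^ 10)) ^ 2 + 522 * (2000 * (P ^ 10 - Q ^ 10)) *
          (2000 * (P ^ 5 * Q ^ 5)) - 10004 * (2000 * (P ^ 5 * Q ^ 5)) ^ 2) := by ring
    rw [e, hA, hB, ← hS]
    ring
  · refine mul_left_cancel₀ (pow_ne_zero 2 h2000) ?_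
    rw [← i3]
    have e : (2000 ^ 2 : R) * (-P ^ 20 - Q ^ 20 + 228 * (P ^ 15 * Q ^ 5 - Q ^ 15 * P ^ 5)
        - 494 * (P ^ 10 * Q ^ 10)) =
        -(2000 * (P ^ 10 - Q ^ 10)) ^ 2 + 228 * (2000 * (P ^ 10 - Q ^ 10)) *
          (2000 * (P ^ 5 * Q ^ 5)) - 496 * (2000 * (P ^ 5 * Q ^ 5)) ^ 2 := by ring
    rw [e, hA, hB, ← hS]
    ring

end IcosaIdentities

section Icosahedral

variable {k : Type*} [Field k]

/-- The constants in the generators of the binary icosahedral group. -/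
structure IsIcosa (ε s α β : k) : Prop where
  prim : IsPrimitiveRoot ε 5
  ne_zero : (30 : k) ≠ 0
  sum_eq : 1 + ε + ε ^ 2 + ε ^ 3 + ε ^ 4 = 0
  s_eq : s = ε + ε ^ 4 - ε ^ 2 - ε ^ 3
  left : α = 5⁻¹ * (-ε - 2 * ε ^ 2 + 2 * ε ^ 3 + ε ^ 4)
  right : β = 5⁻¹ * (2 * ε - ε ^ 2 + ε ^ 3 - 2 * ε ^ 4)

/-- Since `s² = 5`, dividing by `s` is multiplying by `s / 5`. The matrix entries become polynomials
in `ε`, and identities between them can be checked modulo `1 + ε + ε² + ε³ + ε⁴`. -/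
theorem isIcosa {ε s : k} (hε : IsPrimitiveRoot ε 5) (h30 : (30 : k) ≠ 0)
    (hs : s = ε + ε ^ 4 - ε ^ 2 - ε ^ 3) : IsIcosa ε s ((ε ^ 4 - ε) / s) ((ε ^ 2 - ε ^ 3) / s) := by
  have h5 : (5 : k) ≠ 0 := fun h => h30 (by linear_combination 6 * h)
  have hsum : 1 + ε + ε ^ 2 + ε ^ 3 + ε ^ 4 = 0 := by
    have h1 : ε - 1 ≠ 0 := sub_ne_zero.mpr (hε.ne_one (by norm_num))
    refine (mul_eq_zero.mp ?_).resolve_left h1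
    linear_combination hε.pow_eq_one
  have hs2 : s ^ 2 = 5 := by
    rw [hs]
    linear_combination (-5 + 5 * ε + ε ^ 2 - 3 * ε ^ 3 + ε ^ 4) * hsum
  have hs0 : s ≠ 0 := by
    rintro rfl
    exact h5 (by linear_combination -hs2)
  have hc : (5 : k)⁻¹ * 5 = 1 := inv_mul_cancel₀ h5
  refine ⟨hε, h30, hsum, hs, ?_, ?_⟩ <;> rw [div_eq_iff hs0] <;> subst hs
  · linear_combination -(ε ^ 4 - ε) * hc - 5⁻¹ * (ε ^ 4 - ε) * hs2 +
      5⁻¹ * (ε - 2 * ε ^ 3 + ε ^ 4) * (ε + ε ^ 4 - ε ^ 2 - ε ^ 3) * hsum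
  · linear_combination -(ε ^ 2 - ε ^ 3) * hc - 5⁻¹ * (ε ^ 2 - ε ^ 3) * hs2 +
      5⁻¹ * (-2 * ε + 3 * ε ^ 2 - ε ^ 3) * (ε + ε ^ 4 - ε ^ 2 - ε ^ 3) * hsum

namespace IsIcosa

variable {ε s α β : k}

theorem five_ne_zero (h : IsIcosa ε s α β) : (5 : k) ≠ 0 := fun h5 =>
  h.ne_zero (by linear_combination 6 * h5)

theorem two_ne_zero (h : IsIcosa ε s α β) : (2 : k) ≠ 0 := fun h2 =>
  h.ne_zero (by linear_combination 15 * h2)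

theorem three_ne_zero (h : IsIcosa ε s α β) : (3 : k) ≠ 0 := fun h3 =>
  h.ne_zero (by linear_combination 10 * h3)

theorem ten_ne_zero (h : IsIcosa ε s α β) : (10 : k) ≠ 0 := fun h3 =>
  h.ne_zero (by linear_combination 3 * h3)

theorem s_sq (h : IsIcosa ε s α β) : s ^ 2 = 5 := by
  rw [h.s_eq]
  linear_combination (-5 + 5 * ε + ε ^ 2 - 3 * ε ^ 3 + ε ^ 4) * h.sum_eq

theorem s_ne_zero (h : IsIcosa ε s α β) : s ≠ 0 := by
  intro hs
  have := h.s_sq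
  rw [hs] at this
  exact h.five_ne_zero (by linear_combination -this)

theorem pow_five (h : IsIcosa ε s α β) : ε ^ 5 = 1 := h.prim.pow_eq_one

theorem left_sq (h : IsIcosa ε s α β) : 10 * α ^ 2 = -5 - s := by
  have hc : (5 : k)⁻¹ * 5 = 1 := inv_mul_cancel₀ h.five_ne_zero
  rw [h.left, h.s_eq]
  linear_combination 5 * 5⁻¹ ^ 2 * (25 - 20 * ε - 8 * ε ^ 2 + 6 * ε ^ 3 + 2 * ε ^ 4) * h.sum_eq -
    (5 + (ε + ε ^ 4 - ε ^ 2 - ε ^ 3)) * (5 * 5⁻¹ + 1) * hc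

theorem right_sq (h : IsIcosa ε s α β) : 10 * β ^ 2 = -5 + s := by
  have hc : (5 : k)⁻¹ * 5 = 1 := inv_mul_cancel₀ h.five_ne_zero
  rw [h.right, h.s_eq]
  linear_combination 5 * 5⁻¹ ^ 2 * (25 - 30 * ε + 18 * ε ^ 2 - 16 * ε ^ 3 + 8 * ε ^ 4) * h.sum_eq -
    (5 - (ε + ε ^ 4 - ε ^ 2 - ε ^ 3)) * (5 * 5⁻¹ + 1) * hc

theorem left_mul_right (h : IsIcosa ε s α β) : 5 * (α * β) = s := by
  have hc : (5 : k)⁻¹ * 5 = 1 := inv_mul_cancel₀ h.five_ne_zero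
  rw [h.left, h.right, h.s_eq]
  linear_combination 5 * 5⁻¹ ^ 2 * (-5 * ε + 8 * ε ^ 2 - ε ^ 3 - 2 * ε ^ 4) * h.sum_eq +
    (ε + ε ^ 4 - ε ^ 2 - ε ^ 3) * (5 * 5⁻¹ + 1) * hc

theorem right_sq_sub (h : IsIcosa ε s α β) : 5 * (β ^ 2 - α ^ 2) = s := by
  refine mul_left_cancel₀ h.two_ne_zero ?_
  linear_combination h.right_sq - h.left_sq

theorem sq_add_sq (h : IsIcosa ε s α β) : α ^ 2 + β ^ 2 = -1 := by
  refine mul_left_cancel₀ h.ten_ne_zero ?_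
  linear_combination h.right_sq + h.left_sq

theorem left_ne_zero (h : IsIcosa ε s α β) : α ≠ 0 := by
  rintro rfl
  exact h.s_ne_zero (by rw [← h.left_mul_right, zero_mul, mul_zero])

theorem right_ne_zero (h : IsIcosa ε s α β) : β ≠ 0 := by
  rintro rfl
  exact h.s_ne_zero (by rw [← h.left_mul_right, mul_zero, mul_zero])

/-- The value `-1/5` is used twice: it separates the two rings of lines in `exists_lines`, and it
excludes invariants of degree `10`. -/
theorem pow_ten_add (h : IsIcosa ε s α β) : 5 * (α ^ 10 + β ^ 10) = -1 := by
  have h20000 : (20000 : k) ≠ 0 := by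
    rw [show (20000 : k) = 10 * 10 * 10 * 10 * 2 by norm_num]
    have := h.ten_ne_zero
    exact mul_ne_zero (mul_ne_zero (mul_ne_zero (mul_ne_zero this this) this) this) h.two_ne_zero
  refine mul_left_cancel₀ h20000 ?_
  have e : (20000 : k) * (5 * (α ^ 10 + β ^ 10)) = (10 * α ^ 2) ^ 5 + (10 * β ^ 2) ^ 5 := by ring
  rw [e, h.left_sq, h.right_sq]
  linear_combination (-2500 - 50 * (s ^ 2 + 5)) * h.s_sq

theorem det_reflection (h : IsIcosa ε s α β) : (!![α, β; β, -α]).det = 1 := by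
  rw [det_fin_two]
  simp
  linear_combination -h.sq_add_sq

theorem mul_eq_one (h : IsIcosa ε s α β) : -ε ^ 3 * -ε ^ 2 = 1 := by
  linear_combination h.pow_five

theorem det_diag (h : IsIcosa ε s α β) : (!![-ε ^ 3, 0; 0, -ε ^ 2]).det = 1 := by
  rw [det_fin_two]
  simp
  linear_combination h.pow_five

theorem isPrimitiveRoot_ten (h : IsIcosa ε s α β) : IsPrimitiveRoot (-ε ^ 3) 10 := by
  refine ⟨by linear_combination (ε ^ 25 + ε ^ 20 + ε ^ 15 + ε ^ 10 + ε ^ 5 + 1) * h.pow_five, ?_⟩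
  intro l hl
  have h1 : ε ^ (6 * l) = 1 := by
    have : ((-ε ^ 3) ^ l) ^ 2 = ε ^ (6 * l) := by
      rw [← pow_mul, mul_comm l 2, pow_mul, neg_sq, ← pow_mul, ← pow_mul]
      congr 1
      omega
    rw [← this, hl, one_pow]
  have h5 := h.prim.dvd_of_pow_eq_one _ h1
  obtain ⟨j, rfl⟩ : 5 ∣ l := by omega
  rw [pow_mul, show (-ε ^ 3) ^ 5 = -1 by
    linear_combination -(ε ^ 10 + ε ^ 5 + 1) * h.pow_five] at hl
  rcases Nat.even_or_odd' j with ⟨r, rfl | rfl⟩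
  · exact ⟨r, by ring⟩
  · rw [pow_succ, pow_mul, neg_one_sq, one_pow, one_mul] at hl
    exact absurd (by linear_combination -hl) h.two_ne_zero

/-- The standard group of type `E₈`. -/
abbrev group (_ : IsIcosa ε s α β) : Subgroup (SpecialLinearGroup (Fin 2) k) :=
  generated {!![-ε ^ 3, 0; 0, -ε ^ 2], !![α, β; β, -α]}

/-- The first generator. -/
def diag (h : IsIcosa ε s α β) : SpecialLinearGroup (Fin 2) k := ⟨_, h.det_diag⟩

/-- The second generator. -/
def reflection (h : IsIcosa ε s α β) : SpecialLinearGroup (Fin 2) k := ⟨_, h.det_reflection⟩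

theorem diag_mem (h : IsIcosa ε s α β) : h.diag ∈ h.group := mem_generated (by simp [diag])

theorem reflection_mem (h : IsIcosa ε s α β) : h.reflection ∈ h.group :=
  mem_generated (by simp [reflection])

theorem gens_mem (h : IsIcosa ε s α β) (j : Fin 3) : gens k E8 j ∈ invariantRing h.group := by
  have h5 : (C ε : MvPolynomial (Fin 2) k) ^ 5 = 1 := by rw [← C_pow, h.pow_five, C_1]
  have hD : (C (-ε ^ 3) : MvPolynomial (Fin 2) k) * C (-ε ^ 2) = 1 := by
    rw [← C_mul, h.mul_eq_one, C_1]
  have hD0 : (C (-ε ^ 3) : MvPolynomial (Fin 2) k) ^ 5 = -1 := by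
    rw [C_neg, C_pow]
    linear_combination -(C ε ^ 10 + C ε ^ 5 + 1) * h5
  have hD1 : (C (-ε ^ 2) : MvPolynomial (Fin 2) k) ^ 5 = -1 := by
    rw [C_neg, C_pow]
    linear_combination -(C ε ^ 5 + 1) * h5
  have hC : ∀ n : ℕ, [n.AtLeastTwo] → (C (OfNat.ofNat n) : MvPolynomial (Fin 2) k) = OfNat.ofNat n :=
    fun n _ => map_ofNat C n
  have hx : (C (-ε ^ 3) * X 0 : MvPolynomial (Fin 2) k) ^ 5 = -X 0 ^ 5 := by
    rw [mul_pow, hD0, neg_one_mul]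
  have hy : (C (-ε ^ 2) * X 1 : MvPolynomial (Fin 2) k) ^ 5 = -X 1 ^ 5 := by
    rw [mul_pow, hD1, neg_one_mul]
  have hαβ : (5 * (C α * C β) : MvPolynomial (Fin 2) k) = C s := by
    rw [← hC 5, ← C_mul, ← C_mul, h.left_mul_right]
  have hd : (5 * (C β ^ 2 - C α ^ 2) : MvPolynomial (Fin 2) k) = C s := by
    rw [← hC 5, ← C_pow, ← C_pow, ← C_sub, ← C_mul, h.right_sq_sub]
  have hα : (10 * C α ^ 2 : MvPolynomial (Fin 2) k) = -5 - C s := by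
    rw [← hC 5, ← hC 10, ← C_pow, ← C_mul, ← C_neg, ← C_sub, h.left_sq]
  have hβ : (10 * C β ^ 2 : MvPolynomial (Fin 2) k) = -5 + C s := by
    rw [← hC 5, ← hC 10, ← C_pow, ← C_mul, ← C_neg, ← C_add, h.right_sq]
  have hS : (C s ^ 2 : MvPolynomial (Fin 2) k) = 5 := by
    rw [← hC 5, ← C_pow, h.s_sq]
  have h10 : (10 : MvPolynomial (Fin 2) k) ≠ 0 := by
    rw [← hC 10, Ne, C_eq_zero]
    exact h.ten_ne_zero
  obtain ⟨j0, j1, j2⟩ := icosa_identities (x := X 0) (y := X 1) (P := C α * X 0 + C β * X 1)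
    (Q := C β * X 0 + C (-α) * X 1) (S := (C s : MvPolynomial (Fin 2) k)) h10 hS
    (by linear_combination X 0 ^ 2 * hα + 4 * X 0 * X 1 * hαβ + X 1 ^ 2 * hβ)
    (by
      rw [C_neg]
      linear_combination X 0 ^ 2 * hβ - 4 * X 0 * X 1 * hαβ + X 1 ^ 2 * hα)
    (by
      rw [C_neg]
      linear_combination (X 0 ^ 2 - X 1 ^ 2) * hαβ + X 0 * X 1 * hd)
  have s0 : subst !![α, β; β, -α] (X 0) = C α * X 0 + C β * X 1 := by simp [subst_X]
  have s1 : subst !![α, β; β, -α] (X 1) = C β * X 0 + C (-α) * X 1 := by simp [subst_X]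
  refine mem_invariantRing_generated ?_
  rintro _ (rfl | rfl)
  · have e30 : ∀ z : MvPolynomial (Fin 2) k, z ^ 30 = (z ^ 5) ^ 6 := fun z => by ring
    have e25 : ∀ z : MvPolynomial (Fin 2) k, z ^ 25 = (z ^ 5) ^ 5 := fun z => by ring
    have e20 : ∀ z : MvPolynomial (Fin 2) k, z ^ 20 = (z ^ 5) ^ 4 := fun z => by ring
    have e15 : ∀ z : MvPolynomial (Fin 2) k, z ^ 15 = (z ^ 5) ^ 3 := fun z => by ring
    have e10 : ∀ z : MvPolynomial (Fin 2) k, z ^ 10 = (z ^ 5) ^ 2 := fun z => by ring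
    fin_cases j
    · change subst _ (X 0 * X 1 * (X 0 ^ 10 + 11 * X 0 ^ 5 * X 1 ^ 5 - X 1 ^ 10)) =
        X 0 * X 1 * (X 0 ^ 10 + 11 * X 0 ^ 5 * X 1 ^ 5 - X 1 ^ 10)
      simp only [map_mul, map_add, map_sub, map_pow, map_ofNat, subst_diag_X_zero,
        subst_diag_X_one, e10, hx, hy]
      linear_combination X 0 * X 1 * (X 0 ^ 10 + 11 * X 0 ^ 5 * X 1 ^ 5 - X 1 ^ 10) * hD
    · change subst _ (X 0 ^ 30 + X 1 ^ 30 + 522 * (X 0 ^ 25 * X 1 ^ 5 - X 1 ^ 25 * X 0 ^ 5)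
        - 10005 * (X 0 ^ 20 * X 1 ^ 10 + X 0 ^ 10 * X 1 ^ 20)) =
        X 0 ^ 30 + X 1 ^ 30 + 522 * (X 0 ^ 25 * X 1 ^ 5 - X 1 ^ 25 * X 0 ^ 5)
        - 10005 * (X 0 ^ 20 * X 1 ^ 10 + X 0 ^ 10 * X 1 ^ 20)
      simp only [map_mul, map_add, map_sub, map_pow, map_ofNat, subst_diag_X_zero,
        subst_diag_X_one, e10, e20, e25, e30, hx, hy]
      ring
    · change subst _ (-X 0 ^ 20 - X 1 ^ 20 + 228 * (X 0 ^ 15 * X 1 ^ 5 - X 1 ^ 15 * X 0 ^ 5)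
        - 494 * (X 0 ^ 10 * X 1 ^ 10)) =
        -X 0 ^ 20 - X 1 ^ 20 + 228 * (X 0 ^ 15 * X 1 ^ 5 - X 1 ^ 15 * X 0 ^ 5)
        - 494 * (X 0 ^ 10 * X 1 ^ 10)
      simp only [map_mul, map_add, map_sub, map_neg (subst _), map_pow, map_ofNat, subst_diag_X_zero,
        subst_diag_X_one, e10, e15, e20, hx, hy]
      ring
  · fin_cases j
    · change subst _ (X 0 * X 1 * (X 0 ^ 10 + 11 * X 0 ^ 5 * X 1 ^ 5 - X 1 ^ 10)) =
        X 0 * X 1 * (X 0 ^ 10 + 11 * X 0 ^ 5 * X 1 ^ 5 - X 1 ^ 10)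
      simp only [map_mul, map_add, map_sub, map_pow, map_ofNat, s0, s1]
      exact j0
    · change subst _ (X 0 ^ 30 + X 1 ^ 30 + 522 * (X 0 ^ 25 * X 1 ^ 5 - X 1 ^ 25 * X 0 ^ 5)
        - 10005 * (X 0 ^ 20 * X 1 ^ 10 + X 0 ^ 10 * X 1 ^ 20)) =
        X 0 ^ 30 + X 1 ^ 30 + 522 * (X 0 ^ 25 * X 1 ^ 5 - X 1 ^ 25 * X 0 ^ 5)
        - 10005 * (X 0 ^ 20 * X 1 ^ 10 + X 0 ^ 10 * X 1 ^ 20)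
      simp only [map_mul, map_add, map_sub, map_pow, map_ofNat, s0, s1]
      exact j1
    · change subst _ (-X 0 ^ 20 - X 1 ^ 20 + 228 * (X 0 ^ 15 * X 1 ^ 5 - X 1 ^ 15 * X 0 ^ 5)
        - 494 * (X 0 ^ 10 * X 1 ^ 10)) =
        -X 0 ^ 20 - X 1 ^ 20 + 228 * (X 0 ^ 15 * X 1 ^ 5 - X 1 ^ 15 * X 0 ^ 5)
        - 494 * (X 0 ^ 10 * X 1 ^ 10)
      simp only [map_mul, map_add, map_sub, map_neg (subst _), map_pow, map_ofNat, s0, s1]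
      exact j2

/-- An element of the group that exchanges the coordinate axes. -/
theorem exists_swap (h : IsIcosa ε s α β) : ∃ J ∈ h.group, J 0 0 = 0 ∧ J 1 0 = -ε ^ 4 := by
  have hc : (5 : k)⁻¹ * 5 = 1 := inv_mul_cancel₀ h.five_ne_zero
  have hm := fun x y => Subgroup.mul_mem h.group (x := x) (y := y)
  -- With `T` the reflection and `D` the diagonal generator, the word `T D² T D³ T` takes `(1, 0)`
  -- to a multiple of `(0, 1)`; its entries are reduced modulo the cyclotomic relation.
  refine ⟨h.reflection * (h.diag * h.diag) * h.reflection * (h.diag * h.diag * h.diag) *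
    h.reflection, hm _ _ (hm _ _ (hm _ _ (hm _ _ h.reflection_mem (hm _ _ h.diag_mem h.diag_mem))
      h.reflection_mem) (hm _ _ (hm _ _ h.diag_mem h.diag_mem) h.diag_mem)) h.reflection_mem,
    ?_, ?_⟩
  · simp only [mul_entry]
    simp [reflection, diag]
    rw [h.left, h.right]
    linear_combination 5⁻¹ ^ 3 * (-4 * ε ^ 13 + 19 * ε ^ 15 - 11 * ε ^ 16 + 10 * ε ^ 17 -
      45 * ε ^ 18 + 20 * ε ^ 19 + 21 * ε ^ 20 - 4 * ε ^ 21 - 5 * ε ^ 22 - ε ^ 23) * h.sum_eq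
  · simp only [mul_entry]
    simp [reflection, diag]
    rw [h.left, h.right]
    linear_combination 5⁻¹ ^ 3 * (125 * ε ^ 4 - 125 * ε ^ 5 + 125 * ε ^ 9 - 125 * ε ^ 10 -
      2 * ε ^ 13 + 120 * ε ^ 14 - 123 * ε ^ 15 + 37 * ε ^ 16 - 45 * ε ^ 17 + 45 * ε ^ 18 +
      10 * ε ^ 19 - 12 * ε ^ 20 - 12 * ε ^ 21 + 5 * ε ^ 22 + 2 * ε ^ 23) * h.sum_eq -
      (25 * 5⁻¹ ^ 2 + 5 * 5⁻¹ + 1) * ε ^ 4 * hc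

/-- The twelve lines are the vertices of an icosahedron: two poles and two rings of five, spanned by
`(α, ε^(4j) β)` and `(β, -ε^(4j) α)`. Within a ring the powers of `ε⁴` differ. Two proportional
lines from different rings would give, after fifth powers, `α¹⁰ + β¹⁰ = 0`, against `pow_ten_add`.
-/
theorem exists_lines (h : IsIcosa ε s α β) :
    ∃ Z : Fin 2 ⊕ Fin 5 ⊕ Fin 5 → SpecialLinearGroup (Fin 2) k, (∀ l, Z l ∈ h.group) ∧
      ∀ l l', l ≠ l' → Z l 0 0 * Z l' 1 0 - Z l 1 0 * Z l' 0 0 ≠ 0 := by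
  obtain ⟨J, hJ, hJ0, hJ1⟩ := h.exists_swap
  have hε0 := h.prim.ne_zero (by norm_num)
  have hα := h.left_ne_zero
  have hβ := h.right_ne_zero
  have hdm : ∀ j : ℕ, h.diag ^ j ∈ h.group := fun j => Subgroup.pow_mem _ h.diag_mem j
  have hd : ∀ j : ℕ, ((h.diag ^ j : SpecialLinearGroup (Fin 2) k) : Matrix (Fin 2) (Fin 2) k) =
      !![(-ε ^ 3) ^ j, 0; 0, (-ε ^ 2) ^ j] := by
    intro j
    induction j with
    | zero => ext a b; fin_cases a <;> fin_cases b <;> simp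
    | succ j ih =>
      rw [pow_succ, Matrix.SpecialLinearGroup.coe_mul, ih]
      ext a b
      fin_cases a <;> fin_cases b <;> simp [diag, pow_succ]
  have hη : ∀ j : ℕ, (-ε ^ 2) ^ j = (-ε ^ 3) ^ j * (ε ^ 4) ^ j := by
    intro j
    rw [← mul_pow]
    congr 1
    linear_combination ε ^ 2 * h.pow_five
  have hinj : ∀ j j' : Fin 5, (ε ^ 4) ^ (j : ℕ) = (ε ^ 4) ^ (j' : ℕ) → j = j' := by
    intro j j' hj
    exact Fin.ext ((h.prim.pow_of_coprime 4 (by norm_num)).pow_inj j.2 j'.2 hj)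
  have hη0 : ∀ j : ℕ, (ε ^ 4) ^ j ≠ 0 := fun j => pow_ne_zero _ (pow_ne_zero _ hε0)
  have hd0 : ∀ j : ℕ, (-ε ^ 3) ^ j ≠ 0 := fun j => pow_ne_zero _ (neg_ne_zero.mpr (pow_ne_zero _ hε0))
  have hmix : ∀ j j' : ℕ, (ε ^ 4) ^ j * α ^ 2 + (ε ^ 4) ^ j' * β ^ 2 ≠ 0 := by
    intro j j' h0
    have h1 : ((ε ^ 4) ^ j * α ^ 2) ^ 5 = (-((ε ^ 4) ^ j' * β ^ 2)) ^ 5 := by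
      rw [eq_neg_of_add_eq_zero_left h0]
    have h2 : ∀ j : ℕ, ((ε ^ 4) ^ j) ^ 5 = 1 := by
      intro j
      rw [← pow_mul, ← pow_mul, mul_comm 4, mul_comm j, mul_assoc, pow_mul, h.pow_five, one_pow]
    have h3 : α ^ 10 + β ^ 10 = 0 := by
      linear_combination h1 - α ^ 10 * h2 j - β ^ 10 * h2 j'
    have h4 := h.pow_ten_add
    rw [h3, mul_zero] at h4
    exact one_ne_zero (neg_eq_zero.mp h4.symm)
  refine ⟨Sum.elim ![1, J] (Sum.elim (fun j => h.diag ^ (j : ℕ) * h.reflection)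
    fun j => h.diag ^ (j : ℕ) * (h.reflection * J)), ?_,
    independent_of_columns
      (v := Sum.elim ![1, 0] (Sum.elim (fun _ => α) fun _ => β))
      (w := Sum.elim ![0, 1] (Sum.elim (fun j => (ε ^ 4) ^ (j : ℕ) * β)
        fun j => -((ε ^ 4) ^ (j : ℕ) * α))) ?_ ?_⟩
  · rintro (l | l | l)
    · fin_cases l
      exacts [Subgroup.one_mem _, hJ]
    · exact Subgroup.mul_mem _ (hdm _) h.reflection_mem
    · exact Subgroup.mul_mem _ (hdm _) (Subgroup.mul_mem _ h.reflection_mem hJ)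
  · rintro (l | l | l)
    · fin_cases l
      · exact ⟨1, one_ne_zero, by simp, by simp⟩
      · exact ⟨-ε ^ 4, neg_ne_zero.mpr (pow_ne_zero _ hε0), by simp [hJ0], by simp [hJ1]⟩
    · refine ⟨(-ε ^ 3) ^ (l : ℕ), hd0 _, ?_, ?_⟩
      · change (h.diag ^ (l : ℕ) * h.reflection) 0 0 = _ * α
        rw [mul_entry, hd]
        simp [reflection]
      · change (h.diag ^ (l : ℕ) * h.reflection) 1 0 = _ * ((ε ^ 4) ^ (l : ℕ) * β)
        rw [mul_entry, hd]
        simp [reflection]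
        rw [hη]
        ring
    · refine ⟨(-ε ^ 3) ^ (l : ℕ) * -ε ^ 4,
        mul_ne_zero (hd0 _) (neg_ne_zero.mpr (pow_ne_zero _ hε0)), ?_, ?_⟩
      · change (h.diag ^ (l : ℕ) * (h.reflection * J)) 0 0 = _ * β
        rw [mul_entry, mul_entry, mul_entry, hd, hJ0, hJ1]
        simp [reflection]
        ring
      · change (h.diag ^ (l : ℕ) * (h.reflection * J)) 1 0 = _ * -((ε ^ 4) ^ (l : ℕ) * α)
        rw [mul_entry, mul_entry, mul_entry, hd, hJ0, hJ1]
        simp [reflection]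
        rw [hη]
        ring
  · rintro (l | l | l) (l' | l' | l') hne
    · fin_cases l <;> fin_cases l' <;> simp at hne ⊢
    · fin_cases l <;> simp [hα, hβ, hε0]
    · fin_cases l <;> simp [hα, hβ, hε0]
    · fin_cases l' <;> simp [hα, hβ, hε0]
    · have hne' : (ε ^ 4) ^ (l' : ℕ) - (ε ^ 4) ^ (l : ℕ) ≠ 0 := fun h0 =>
        hne (by rw [hinj _ _ (sub_eq_zero.mp h0)])
      intro h0
      refine mul_ne_zero (mul_ne_zero hα hβ) hne' ?_
      change α * ((ε ^ 4) ^ (l' : ℕ) * β) - (ε ^ 4) ^ (l : ℕ) * β * α = 0 at h0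
      linear_combination h0
    · intro h0
      refine hmix l' l ?_
      change α * -((ε ^ 4) ^ (l' : ℕ) * α) - (ε ^ 4) ^ (l : ℕ) * β * β = 0 at h0
      linear_combination -h0
    · fin_cases l' <;> simp [hα, hβ, hε0]
    · intro h0
      refine hmix l l' ?_
      change β * ((ε ^ 4) ^ (l' : ℕ) * β) - -((ε ^ 4) ^ (l : ℕ) * α) * α = 0 at h0
      linear_combination h0
    · have hne' : (ε ^ 4) ^ (l' : ℕ) - (ε ^ 4) ^ (l : ℕ) ≠ 0 := fun h0 =>
        hne (by rw [hinj _ _ (sub_eq_zero.mp h0)])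
      intro h0
      refine mul_ne_zero (mul_ne_zero hα hβ) hne' ?_
      change β * -((ε ^ 4) ^ (l' : ℕ) * α) - -((ε ^ 4) ^ (l : ℕ) * α) * β = 0 at h0
      linear_combination -h0

/-- The diagonal generator, with an eigenvalue of order `10`, forces `10 ∣ m`, and all multiples of
`10` except `10` have the form `30 a + 20 b`. -/
theorem degree_of_eval_ne_zero (h : IsIcosa ε s α β) {m : ℕ}
    {f : MvPolynomial (Fin 2) k} (hfH : f ∈ invariantRing h.group)
    (hf : f.IsHomogeneous m) (h0 : eval ![1, 0] f ≠ 0) : ∃ a b, m = a * 30 + b * 20 := by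
  have h10 : 10 ∣ m := h.isPrimitiveRoot_ten.dvd_of_pow_eq_one _
    (by simpa [diag] using pow_eq_one_of_upper hf hfH h0 h.diag_mem (by simp [diag]))
  have hm : m ≠ 10 := by
    rintro rfl
    obtain ⟨J, hJ, hJ0, hJ1⟩ := h.exists_swap
    -- Invariance under the diagonal generator leaves only `x₁¹⁰`, `x₁⁵x₂⁵` and `x₂¹⁰`.
    have hcoeff : ∀ j ∈ Finset.range 11, ¬ 5 ∣ j → coeff (expo (10 - j) j) f = 0 := by
      intro j hj h5j
      have h1 := coeff_subst_diag (-ε ^ 3) (-ε ^ 2) f (expo (10 - j) j)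
      rw [subst_eq_of_mem_invariantRing_generated hfH (by simp) h.det_diag, expo_zero,
        expo_one] at h1
      have hj' := Finset.mem_range.mp hj
      have h2 : (-ε ^ 3) ^ (10 - j) * (-ε ^ 2) ^ j = ε ^ (30 - j) := by
        rw [neg_pow, neg_pow (ε ^ 2), mul_mul_mul_comm, ← pow_add, ← pow_mul, ← pow_mul, ← pow_add,
          show 10 - j + j = 10 by omega, show 3 * (10 - j) + 2 * j = 30 - j by omega]
        norm_num
      by_contra hne
      rw [h2] at h1
      have h3 : ε ^ (30 - j) = 1 := mul_right_cancel₀ hne (by rw [← h1, one_mul])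
      have := h.prim.dvd_of_pow_eq_one _ h3
      omega
    have e1 := eval_eq_of_column hf hfH h.reflection_mem (c := 1) (v := α) (w := β)
      (by simp [reflection]) (by simp [reflection])
    have e2 := eval_eq_of_column hf hfH (Subgroup.mul_mem _ h.reflection_mem hJ) (c := -ε ^ 4)
      (v := β) (w := -α) (by rw [mul_entry, hJ0, hJ1]; simp [reflection]; ring)
      (by rw [mul_entry, hJ0, hJ1]; simp [reflection]; ring)
    have e3 := eval_eq_of_column hf hfH hJ (c := -ε ^ 4) (v := 0) (w := 1)
      (by rw [hJ0, mul_zero]) (by rw [hJ1, mul_one])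
    have hε10 : (-ε ^ 4) ^ 10 = 1 := by
      linear_combination (ε ^ 35 + ε ^ 30 + ε ^ 25 + ε ^ 20 + ε ^ 15 + ε ^ 10 + ε ^ 5 + 1) *
        h.pow_five
    rw [hε10, one_mul] at e2 e3
    rw [one_pow, one_mul] at e1
    rw [eval_eq_sum_of_isHomogeneous hf, eval_eq_sum_of_isHomogeneous hf] at e1 e2 e3
    rw [eval_eq_sum_of_isHomogeneous hf] at h0
    have c1 := hcoeff 1 (by decide) (by decide)
    have c2 := hcoeff 2 (by decide) (by decide)
    have c3 := hcoeff 3 (by decide) (by decide)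
    have c4 := hcoeff 4 (by decide) (by decide)
    have c6 := hcoeff 6 (by decide) (by decide)
    have c7 := hcoeff 7 (by decide) (by decide)
    have c8 := hcoeff 8 (by decide) (by decide)
    have c9 := hcoeff 9 (by decide) (by decide)
    simp only [Nat.reduceSub] at c1 c2 c3 c4 c6 c7 c8 c9
    simp [Finset.sum_range_succ, c1, c2, c3, c4, c6, c7, c8, c9] at e1 e2 e3 h0
    have h12 : (2 * 2 * 3 : k) ≠ 0 :=
      mul_ne_zero (mul_ne_zero h.two_ne_zero h.two_ne_zero) h.three_ne_zero
    refine mul_ne_zero h12 h0 ?_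
    -- The outer coefficients both equal `v = f(1, 0)`, and so do the values at `(α, β)` and `(β,
    -- -α)`. In their sum the middle terms cancel: `2 v (α¹⁰ + β¹⁰) = 2 v`, that is `12 v = 0`.
    linear_combination -5 * e1 - 5 * e2 + 5 * (α ^ 10 + β ^ 10) * e3 +
      2 * coeff (expo 10 0) f * h.pow_ten_add
  obtain ⟨q, rfl⟩ := h10
  have : q ≠ 1 := by rintro rfl; exact hm rfl
  rcases Nat.even_or_odd' q with ⟨r, rfl | rfl⟩
  · exact ⟨0, r, by omega⟩
  · exact ⟨1, r - 1, by omega⟩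

theorem isHomogeneous_gens (j : Fin 3) : (gens k E8 j).IsHomogeneous (degrees E8 j) := by
  refine isHomogeneous_of_homogenize ?_
  fin_cases j
  · change homogenize (X 0 * X 1 * (X 0 ^ 10 + 11 * X 0 ^ 5 * X 1 ^ 5 - X 1 ^ 10)) =
      Polynomial.C (X 0 * X 1 * (X 0 ^ 10 + 11 * X 0 ^ 5 * X 1 ^ 5 - X 1 ^ 10)) *
        Polynomial.X ^ 12
    simp only [map_mul, map_add, map_sub, map_pow, map_ofNat, homogenize_X]
    ring
  · change homogenize (X 0 ^ 30 + X 1 ^ 30 + 522 * (X 0 ^ 25 * X 1 ^ 5 - X 1 ^ 25 * X 0 ^ 5)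
        - 10005 * (X 0 ^ 20 * X 1 ^ 10 + X 0 ^ 10 * X 1 ^ 20)) =
      Polynomial.C (X 0 ^ 30 + X 1 ^ 30 + 522 * (X 0 ^ 25 * X 1 ^ 5 - X 1 ^ 25 * X 0 ^ 5)
        - 10005 * (X 0 ^ 20 * X 1 ^ 10 + X 0 ^ 10 * X 1 ^ 20)) * Polynomial.X ^ 30
    simp only [map_mul, map_add, map_sub, map_pow, map_ofNat, homogenize_X]
    ring
  · change homogenize (-X 0 ^ 20 - X 1 ^ 20 + 228 * (X 0 ^ 15 * X 1 ^ 5 - X 1 ^ 15 * X 0 ^ 5)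
        - 494 * (X 0 ^ 10 * X 1 ^ 10)) =
      Polynomial.C (-X 0 ^ 20 - X 1 ^ 20 + 228 * (X 0 ^ 15 * X 1 ^ 5 - X 1 ^ 15 * X 0 ^ 5)
        - 494 * (X 0 ^ 10 * X 1 ^ 10)) * Polynomial.X ^ 20
    simp only [map_mul, map_add, map_sub, map_neg, map_pow, map_ofNat, homogenize_X]
    ring

theorem eval_gens (j : Fin 3) : eval ![1, 0] (gens k E8 j) = ![0, 1, -1] j := by
  fin_cases j
  · change eval ![1, 0] (X 0 * X 1 * (X 0 ^ 10 + 11 * X 0 ^ 5 * X 1 ^ 5 - X 1 ^ 10)) = 0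
    simp
  · change eval ![1, 0] (X 0 ^ 30 + X 1 ^ 30 + 522 * (X 0 ^ 25 * X 1 ^ 5 - X 1 ^ 25 * X 0 ^ 5)
        - 10005 * (X 0 ^ 20 * X 1 ^ 10 + X 0 ^ 10 * X 1 ^ 20)) = 1
    simp
  · change eval ![1, 0] (-X 0 ^ 20 - X 1 ^ 20 + 228 * (X 0 ^ 15 * X 1 ^ 5 - X 1 ^ 15 * X 0 ^ 5)
        - 494 * (X 0 ^ 10 * X 1 ^ 10)) = -1
    simp

theorem gens_zero_ne_zero : gens k E8 0 ≠ 0 := by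
  intro h
  have h1 := congrArg (aeval ![1, (Polynomial.X : Polynomial k)]) h
  change aeval ![1, Polynomial.X] (X 0 * X 1 * (X 0 ^ 10 + 11 * X 0 ^ 5 * X 1 ^ 5 - X 1 ^ 10)) =
    aeval ![1, Polynomial.X] 0 at h1
  have h2 := congrArg (fun q => Polynomial.eval 0 (Polynomial.derivative q)) h1
  simp at h2

theorem invariantRing_eq (h : IsIcosa ε s α β) :
    invariantRing h.group = Algebra.adjoin k (Set.range (gens k E8)) := by
  obtain ⟨Z, hZ, hind⟩ := h.exists_lines
  have hr : Set.range (gens k E8) = {gens k E8 0, gens k E8 1, gens k E8 2} := by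
    change Set.range ![gens k E8 0, gens k E8 1, gens k E8 2] = _
    rw [Matrix.range_cons, Matrix.range_cons, Matrix.range_cons, Matrix.range_empty,
      Set.union_empty, Set.singleton_union, Set.singleton_union]
  rw [hr]
  exact invariantRing_eq_adjoin_of_lines hZ hind (a := 30) (b := 20) (isHomogeneous_gens 0)
    (isHomogeneous_gens 1) (isHomogeneous_gens 2) (h.gens_mem 0) (h.gens_mem 1) (h.gens_mem 2)
    (by rw [eval_gens]; rfl) (by simp [eval_gens]) (by simp [eval_gens]) gens_zero_ne_zero
    fun m f hfH hf h0 => h.degree_of_eval_ne_zero hfH hf h0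

/-- Twelve lines, each with a stabilizer of order `10`. The degrees `30` and `20` bound the
eigenvalues, and the degree `20`, invertible in `k`, excludes unipotent elements. -/
theorem card_eq (h : IsIcosa ε s α β) : Nat.card h.group = 120 := by
  obtain ⟨Z, hZ, hind⟩ := h.exists_lines
  have hcard := card_eq_of_lines hZ hind (fun g hg => ?_) (r := 10) h.isPrimitiveRoot_ten h.diag_mem
    ?_ (fun g hg h10 => ?_) fun g hg h10 h00 => ?_
  · rw [hcard]
    rfl
  · have h3 := eval_mulVec_of_mem (h.gens_mem 0) hg ![1, 0]
    rw [eval_gens] at h3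
    obtain ⟨l, hl⟩ := exists_eval_eq_zero_iff hZ hind (isHomogeneous_gens 0) (h.gens_mem 0)
      (by rw [eval_gens]; rfl) gens_zero_ne_zero h3
    exact ⟨l, by simpa using hl⟩
  · rw [← eq_inv_of_mul_eq_one_right h.mul_eq_one]
    rfl
  · have h1 := pow_eq_one_of_upper (isHomogeneous_gens 1) (h.gens_mem 1) (by simp [eval_gens]) hg h10
    have h2 := pow_eq_one_of_upper (isHomogeneous_gens 2) (h.gens_mem 2) (by simp [eval_gens]) hg h10
    change _ ^ 30 = _ at h1
    change _ ^ 20 = _ at h2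
    rw [show 30 = 20 + 10 by norm_num, pow_add, h2, one_mul] at h1
    exact h1
  · have h3 := aeval_unipotent_eq (h.gens_mem 2) hg h10 h00
    have h20 : (20 : k) ≠ 0 := by
      rw [show (20 : k) = 10 * 2 by norm_num]
      exact mul_ne_zero h.ten_ne_zero h.two_ne_zero
    have h4 := congrArg (fun q => (Polynomial.derivative q).eval 0) h3
    simpa [gens, Polynomial.derivative_pow, h20] using h4

end IsIcosa

end Icosahedral

end KleinType

namespace KleinType

open HilbertKunz

/-! ### The syzygies of the generators -/

section Syzygies

variable {k : Type*} [Field k]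

theorem isUnit_C {c : k} (hc : c ≠ 0) : IsUnit (C c : MvPolynomial (Fin 2) k) :=
  hc.isUnit.map C

/-- Modulo `X i` the polynomial is a unit times a power of the other variable. -/
theorem isRelPrime_X_of_eq {i j : Fin 2} (hij : i ≠ j) {f g : MvPolynomial (Fin 2) k} {c : k}
    (hc : c ≠ 0) {m : ℕ} (hf : f = C c * X j ^ m + X i * g) : IsRelPrime (X i) f := by
  rw [hf, (X_prime (R := k) (i := i)).irreducible.isRelPrime_iff_not_dvd,
    dvd_add_left (dvd_mul_right _ _)]
  intro h
  rw [(isUnit_C hc).dvd_mul_left] at h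
  have h1 := (X_prime (R := k) (i := i)).dvd_of_dvd_pow h
  exact hij (X_dvd_X.mp h1)

theorem isMinors_A {n : ℕ} (hn : 2 ≤ n) :
    IsMinors ![X 0 ^ (n - 1), -X 1, 0] ![X 1 ^ (n - 1), 0, -X 0] (gens k (A n)) (degrees (A n))
      (syzygyDegree (A n)) := by
  obtain ⟨m, rfl⟩ : ∃ m, n = m + 1 := ⟨n - 1, by omega⟩
  have hX : ∀ i : Fin 2, (X i : MvPolynomial (Fin 2) k).IsHomogeneous (m + 1 + 1 - (m + 1)) :=
    fun i => by
      rw [Nat.add_sub_cancel_left]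
      exact isHomogeneous_X _ _
  refine ⟨?_, ?_, ?_, fun i => ?_, ⟨1, 2, ?_⟩, degrees_pos (t := A (m + 1)) hn,
    degrees_lt (t := A (m + 1)) hn, sum_degrees _, fun i => ?_, fun i => ?_, fun i => ?_⟩
  · change X 0 * X 1 = -X 1 * -X 0 - 0 * 0
    ring
  · change X 0 ^ (m + 1) = 0 * X 1 ^ m - X 0 ^ m * -X 0
    ring
  · change X 1 ^ (m + 1) = X 0 ^ m * 0 - -X 1 * X 1 ^ m
    ring
  · fin_cases i
    exacts [mul_ne_zero (X_ne_zero _) (X_ne_zero _), pow_ne_zero _ (X_ne_zero _),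
      pow_ne_zero _ (X_ne_zero _)]
  · exact (isRelPrime_X_of_eq (i := 0) (j := 1) (f := X 1) (c := (1 : k)) (by decide) one_ne_zero (m := 1)
      (g := 0) (by simp)).pow
  · fin_cases i
    exacts [(isHomogeneous_X k 0).mul (isHomogeneous_X k 1), isHomogeneous_X_pow 0 _,
      isHomogeneous_X_pow 1 _]
  · fin_cases i
    exacts [isHomogeneous_X_pow 0 m, (hX 1).neg, isHomogeneous_zero _ _ _]
  · fin_cases i
    exacts [isHomogeneous_X_pow 1 m, isHomogeneous_zero _ _ _, (hX 0).neg]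

theorem isHomogeneous_C_mul_X_pow (c : k) (i : Fin 2) (j : ℕ) :
    (C c * X i ^ j : MvPolynomial (Fin 2) k).IsHomogeneous j := by
  have := (isHomogeneous_C (Fin 2) c).mul (isHomogeneous_X_pow i j)
  rwa [zero_add] at this

theorem isHomogeneous_gens_D (n : ℕ) (i : Fin 3) : (gens k (D n) i).IsHomogeneous (degrees (D n) i) := by
  have hA : ∀ c : k, (X 0 ^ (2 * n) + C c * X 1 ^ (2 * n) : MvPolynomial (Fin 2) k).IsHomogeneous (2 * n) := fun c =>
    (isHomogeneous_X_pow (R := k) 0 (2 * n)).add (isHomogeneous_C_mul_X_pow c 1 (2 * n))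
  fin_cases i
  · change (-2 * X 0 ^ 2 * X 1 ^ 2 : MvPolynomial (Fin 2) k).IsHomogeneous 4
    rw [show (-2 : MvPolynomial (Fin 2) k) = C (-2) by rw [C_neg]; exact congrArg _ (map_ofNat C 2).symm]
    exact (isHomogeneous_C_mul_X_pow (-2) 0 2).mul (isHomogeneous_X_pow 1 2)
  · change (X 0 ^ (2 * n) + (-1) ^ n * X 1 ^ (2 * n) : MvPolynomial (Fin 2) k).IsHomogeneous (2 * n)
    have := hA ((-1) ^ n)
    rwa [C_pow, C_neg, C_1] at this
  · change (X 0 * X 1 * (X 0 ^ (2 * n) - (-1) ^ n * X 1 ^ (2 * n)) :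
      MvPolynomial (Fin 2) k).IsHomogeneous (2 * n + 2)
    have := hA (-(-1) ^ n)
    rw [C_neg, C_pow, C_neg, C_1, neg_mul, ← sub_eq_add_neg] at this
    rw [add_comm]
    exact ((isHomogeneous_X k 0).mul (isHomogeneous_X k 1)).mul this

theorem gens_D_ne_zero {n : ℕ} (hn : n ≠ 0) (h2 : (2 : k) ≠ 0) (i : Fin 3) : gens k (D n) i ≠ 0 := by
  have hC2 : (C 2 : MvPolynomial (Fin 2) k) = 2 := map_ofNat C 2
  fin_cases i
  · change -2 * X 0 ^ 2 * X 1 ^ 2 ≠ 0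
    refine mul_ne_zero (mul_ne_zero ?_ (pow_ne_zero _ (X_ne_zero _))) (pow_ne_zero _ (X_ne_zero _))
    rw [← hC2, neg_ne_zero, Ne, C_eq_zero]
    exact h2
  · intro h
    have := congrArg (eval ![1, 0]) h
    change eval ![1, 0] (X 0 ^ (2 * n) + (-1) ^ n * X 1 ^ (2 * n)) = eval ![1, 0] 0 at this
    simp [hn] at this
  · change X 0 * X 1 * (X 0 ^ (2 * n) - (-1) ^ n * X 1 ^ (2 * n)) ≠ 0
    refine mul_ne_zero (mul_ne_zero (X_ne_zero _) (X_ne_zero _)) fun h => ?_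
    have := congrArg (eval ![1, 0]) h
    simp [hn] at this

theorem isRelPrime_gens_D {n : ℕ} (hn : n ≠ 0) (h2 : (2 : k) ≠ 0) :
    IsRelPrime (gens k (D n) 0) (gens k (D n) 1) := by
  obtain ⟨m, hm⟩ : ∃ m, 2 * n = m + 1 := ⟨2 * n - 1, by omega⟩
  have hsC : ((-1) ^ n : MvPolynomial (Fin 2) k) = C ((-1) ^ n) := by simp
  have hs0 : ((-1) ^ n : k) ≠ 0 := pow_ne_zero _ (neg_ne_zero.mpr one_ne_zero)
  have hC2 : (C 2 : MvPolynomial (Fin 2) k) = 2 := map_ofNat C 2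
  change IsRelPrime (-2 * X 0 ^ 2 * X 1 ^ 2) (X 0 ^ (2 * n) + (-1) ^ n * X 1 ^ (2 * n))
  refine IsRelPrime.mul_left (IsRelPrime.mul_left ?_ ?_) ?_
  · rw [← hC2, ← C_neg]
    exact (isUnit_C (neg_ne_zero.mpr h2)).isRelPrime_left
  · refine (isRelPrime_X_of_eq (i := 0) (j := 1) (by decide) hs0 (m := 2 * n) (g := X 0 ^ m)
      ?_).pow_left
    rw [hm, hsC]
    ring
  · refine (isRelPrime_X_of_eq (i := 1) (j := 0) (by decide) one_ne_zero (m := 2 * n)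
      (g := (-1) ^ n * X 1 ^ m) ?_).pow_left
    rw [hm, C_1]
    ring

/-- The rows of the Hilbert–Burch matrix in type `D n`. -/
noncomputable def syzygyD (k : Type*) [Field k] (n : ℕ) : Fin 2 → Fin 3 → MvPolynomial (Fin 2) k :=
  ![![C (-(-1) ^ n) * X 1 ^ (2 * n - 1), -X 0 ^ 2 * X 1, X 0],
    ![X 0 ^ (2 * n - 1), X 0 * X 1 ^ 2, X 1]]

theorem isHomogeneous_syzygyD {n : ℕ} (hn : 2 ≤ n) (j : Fin 2) (i : Fin 3) :
    (syzygyD k n j i).IsHomogeneous (2 * n + 3 - degrees (D n) i) := by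
  have e0 : 2 * n + 3 - degrees (D n) 0 = 2 * n - 1 := by
    change 2 * n + 3 - 4 = 2 * n - 1
    omega
  have e1 : 2 * n + 3 - degrees (D n) 1 = 3 := by
    change 2 * n + 3 - 2 * n = 3
    omega
  have e2 : 2 * n + 3 - degrees (D n) 2 = 1 := by
    change 2 * n + 3 - (2 * n + 2) = 1
    omega
  fin_cases i <;> simp only [Fin.zero_eta, Fin.mk_one, Fin.reduceFinMk, e0, e1, e2] <;> fin_cases j
  · exact isHomogeneous_C_mul_X_pow _ _ _
  · exact isHomogeneous_X_pow 0 _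
  · exact (isHomogeneous_X_pow 0 2).neg.mul (isHomogeneous_X k 1)
  · exact (isHomogeneous_X k 0).mul (isHomogeneous_X_pow 1 2)
  · exact isHomogeneous_X k 0
  · exact isHomogeneous_X k 1

theorem isMinors_D {n : ℕ} (hn : 2 ≤ n) (h2 : (2 : k) ≠ 0) :
    IsMinors (syzygyD k n 0) (syzygyD k n 1) (gens k (D n)) (degrees (D n))
      (syzygyDegree (D n)) := by
  have hn0 : n ≠ 0 := by omega
  obtain ⟨m, hm⟩ : ∃ m, 2 * n = m + 1 := ⟨2 * n - 1, by omega⟩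
  have hsC : (C (-(-1) ^ n) : MvPolynomial (Fin 2) k) = -(-1) ^ n := by simp
  refine ⟨?_, ?_, ?_, gens_D_ne_zero hn0 h2, ⟨0, 1, isRelPrime_gens_D hn0 h2⟩,
    degrees_pos (t := D n) hn, degrees_lt (t := D n) hn, sum_degrees _, isHomogeneous_gens_D n,
    isHomogeneous_syzygyD hn 0, isHomogeneous_syzygyD hn 1⟩
  · change -2 * X 0 ^ 2 * X 1 ^ 2 = -X 0 ^ 2 * X 1 * X 1 - X 0 * (X 0 * X 1 ^ 2)
    ring
  · change X 0 ^ (2 * n) + (-1) ^ n * X 1 ^ (2 * n) =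
      X 0 * X 0 ^ (2 * n - 1) - C (-(-1) ^ n) * X 1 ^ (2 * n - 1) * X 1
    rw [hsC, hm, Nat.add_sub_cancel]
    ring
  · change X 0 * X 1 * (X 0 ^ (2 * n) - (-1) ^ n * X 1 ^ (2 * n)) =
      C (-(-1) ^ n) * X 1 ^ (2 * n - 1) * (X 0 * X 1 ^ 2) - -X 0 ^ 2 * X 1 * X 0 ^ (2 * n - 1)
    rw [hsC, hm, Nat.add_sub_cancel]
    ring

theorem octaW_ne_zero : octaW k ≠ 0 := fun h => by simpa [h] using eval_octaW (k := k)

theorem octaX_ne_zero : octaX k ≠ 0 := fun h => by simpa [h] using eval_octaX (k := k)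

/-- Modulo `x₁⁴ - x₂⁴` the form `W` is `16 x₂⁸`, so only the invertibility of `2` is needed. -/
theorem isRelPrime_octaT_octaW (h2 : (2 : k) ≠ 0) : IsRelPrime (octaT k) (octaW k) := by
  have h16 : (16 : k) ≠ 0 := by
    rw [show (16 : k) = 2 ^ 4 by norm_num]
    exact pow_ne_zero _ h2
  have hC : (C 16 : MvPolynomial (Fin 2) k) = 16 := map_ofNat C 16
  have hT : octaT k = X 0 * X 1 * (X 0 ^ 4 - X 1 ^ 4) := by rw [octaT]; ring
  have hW : octaW k = C 16 * X 1 ^ 8 + (X 0 ^ 4 - X 1 ^ 4) * (X 0 ^ 4 + 15 * X 1 ^ 4) := by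
    rw [octaW, hC]
    ring
  rw [hT]
  refine IsRelPrime.mul_left (IsRelPrime.mul_left ?_ ?_) ?_
  · refine isRelPrime_X_of_eq (i := 0) (j := 1) (by decide) one_ne_zero (m := 8)
      (g := X 0 ^ 7 + 14 * X 0 ^ 3 * X 1 ^ 4) ?_
    rw [octaW, C_1]
    ring
  · refine isRelPrime_X_of_eq (i := 1) (j := 0) (by decide) one_ne_zero (m := 8)
      (g := X 1 ^ 7 + 14 * X 0 ^ 4 * X 1 ^ 3) ?_
    rw [octaW, C_1]
    ring
  · rw [hW]
    refine IsRelPrime.add_mul_left_right (IsRelPrime.mul_right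
      (isUnit_C h16).isRelPrime_right (IsRelPrime.pow_right (IsRelPrime.symm ?_))) _
    refine isRelPrime_X_of_eq (i := 1) (j := 0) (by decide) one_ne_zero (m := 4)
      (g := -X 1 ^ 3) ?_
    rw [C_1]
    ring

/-- The rows of the Hilbert–Burch matrix in type `E₆`. -/
noncomputable def syzygyE6 (k : Type*) [Field k] : Fin 2 → Fin 3 → MvPolynomial (Fin 2) k :=
  ![![-(7 * X 0 ^ 4 * X 1 ^ 3 + X 1 ^ 7), C 6⁻¹ * (X 0 ^ 5 - 5 * X 0 * X 1 ^ 4), -C 6⁻¹ * X 0],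
    ![-6 * (X 0 ^ 7 + 7 * X 0 ^ 3 * X 1 ^ 4), 5 * X 0 ^ 4 * X 1 - X 1 ^ 5, X 1]]

theorem isHomogeneous_syzygyE6 (j : Fin 2) (i : Fin 3) :
    (syzygyE6 k j i).IsHomogeneous (13 - degrees E6 i) := by
  refine isHomogeneous_of_homogenize ?_
  have hC : homogenize (C 6⁻¹ : MvPolynomial (Fin 2) k) = Polynomial.C (C 6⁻¹) :=
    homogenize.commutes _
  fin_cases j <;> fin_cases i
  · change homogenize (-(7 * X 0 ^ 4 * X 1 ^ 3 + X 1 ^ 7)) =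
      Polynomial.C (-(7 * X 0 ^ 4 * X 1 ^ 3 + X 1 ^ 7)) * Polynomial.X ^ 7
    simp only [map_mul, map_add, map_neg, map_pow, map_ofNat, homogenize_X]
    ring
  · change homogenize (C 6⁻¹ * (X 0 ^ 5 - 5 * X 0 * X 1 ^ 4)) =
      Polynomial.C (C 6⁻¹ * (X 0 ^ 5 - 5 * X 0 * X 1 ^ 4)) * Polynomial.X ^ 5
    simp only [map_mul, map_sub, map_pow, map_ofNat, homogenize_X, hC]
    ring
  · change homogenize (-C 6⁻¹ * X 0) = Polynomial.C (-C 6⁻¹ * X 0) * Polynomial.X ^ 1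
    simp only [map_mul, map_neg, homogenize_X, hC]
    ring
  · change homogenize (-6 * (X 0 ^ 7 + 7 * X 0 ^ 3 * X 1 ^ 4)) =
      Polynomial.C (-6 * (X 0 ^ 7 + 7 * X 0 ^ 3 * X 1 ^ 4)) * Polynomial.X ^ 7
    simp only [map_mul, map_add, map_neg, map_pow, map_ofNat, homogenize_X]
    ring
  · change homogenize (5 * X 0 ^ 4 * X 1 - X 1 ^ 5) =
      Polynomial.C (5 * X 0 ^ 4 * X 1 - X 1 ^ 5) * Polynomial.X ^ 5
    simp only [map_mul, map_sub, map_pow, map_ofNat, homogenize_X]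
    ring
  · change homogenize (X 1) = Polynomial.C (X 1) * Polynomial.X ^ 1
    rw [homogenize_X, pow_one]

/-- Up to constants the rows consist of a partial derivative of `W`, one of `t`, and a variable. Two
minors are then Euler's identities for `t` and `W`, and the third, `χ`, is a multiple of their
Jacobian determinant. -/
theorem isMinors_E6 (h6 : (6 : k) ≠ 0) :
    IsMinors (syzygyE6 k 0) (syzygyE6 k 1) (gens k E6) (degrees E6) (syzygyDegree E6) := by
  have h2 : (2 : k) ≠ 0 := fun h => h6 (by linear_combination 3 * h)
  have hC : (C 6⁻¹ * 6 : MvPolynomial (Fin 2) k) = 1 := by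
    rw [show (6 : MvPolynomial (Fin 2) k) = C 6 from (map_ofNat C 6).symm, ← C_mul,
      inv_mul_cancel₀ h6, C_1]
  refine ⟨?_, ?_, ?_, fun i => ?_, ⟨0, 1, isRelPrime_octaT_octaW h2⟩, degrees_pos (t := E6) trivial,
    degrees_lt (t := E6) trivial, sum_degrees _, fun i => ?_, isHomogeneous_syzygyE6 0,
    isHomogeneous_syzygyE6 1⟩
  · change octaT k = C 6⁻¹ * (X 0 ^ 5 - 5 * X 0 * X 1 ^ 4) * X 1 -
      -C 6⁻¹ * X 0 * (5 * X 0 ^ 4 * X 1 - X 1 ^ 5)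
    rw [octaT]
    linear_combination -(X 0 ^ 5 * X 1 - X 0 * X 1 ^ 5) * hC
  · change octaW k = -C 6⁻¹ * X 0 * (-6 * (X 0 ^ 7 + 7 * X 0 ^ 3 * X 1 ^ 4)) -
      -(7 * X 0 ^ 4 * X 1 ^ 3 + X 1 ^ 7) * X 1
    rw [octaW]
    linear_combination -X 0 * (X 0 ^ 7 + 7 * X 0 ^ 3 * X 1 ^ 4) * hC
  · change octaX k = -(7 * X 0 ^ 4 * X 1 ^ 3 + X 1 ^ 7) * (5 * X 0 ^ 4 * X 1 - X 1 ^ 5) -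
      C 6⁻¹ * (X 0 ^ 5 - 5 * X 0 * X 1 ^ 4) * (-6 * (X 0 ^ 7 + 7 * X 0 ^ 3 * X 1 ^ 4))
    rw [octaX]
    linear_combination -(X 0 ^ 5 - 5 * X 0 * X 1 ^ 4) * (X 0 ^ 7 + 7 * X 0 ^ 3 * X 1 ^ 4) * hC
  · fin_cases i
    exacts [octaT_ne_zero, octaW_ne_zero, octaX_ne_zero]
  · fin_cases i
    exacts [isHomogeneous_octaT, isHomogeneous_octaW, isHomogeneous_octaX]

/-- The matrix of type `E₆` with its rows and two of its columns exchanged. Multiplying one column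
by `t` multiplies the minors `t` and `χ`, which use it, and leaves `W` alone. -/
theorem isMinors_E7 (h6 : (6 : k) ≠ 0) :
    IsMinors ![octaT k * syzygyE6 k 1 1, syzygyE6 k 1 0, syzygyE6 k 1 2]
      ![octaT k * syzygyE6 k 0 1, syzygyE6 k 0 0, syzygyE6 k 0 2] (gens k E7) (degrees E7)
      (syzygyDegree E7) := by
  have h2 : (2 : k) ≠ 0 := fun h => h6 (by linear_combination 3 * h)
  have H := isMinors_E6 h6
  have e0 : octaT k = _ := H.eq_zero
  have e1 : octaW k = _ := H.eq_one
  have e2 : octaX k = _ := H.eq_two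
  refine ⟨?_, ?_, ?_, fun i => ?_, ⟨0, 1, (isRelPrime_octaT_octaW h2).symm.pow_right⟩,
    degrees_pos (t := E7) trivial, degrees_lt (t := E7) trivial, sum_degrees _, fun i => ?_,
    fun i => ?_, fun i => ?_⟩
  · change octaW k = syzygyE6 k 1 0 * syzygyE6 k 0 2 - syzygyE6 k 1 2 * syzygyE6 k 0 0
    linear_combination e1
  · change octaT k ^ 2 = syzygyE6 k 1 2 * (octaT k * syzygyE6 k 0 1) -
      octaT k * syzygyE6 k 1 1 * syzygyE6 k 0 2
    linear_combination octaT k * e0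
  · change octaT k * octaX k = octaT k * syzygyE6 k 1 1 * syzygyE6 k 0 0 -
      syzygyE6 k 1 0 * (octaT k * syzygyE6 k 0 1)
    linear_combination octaT k * e2
  · fin_cases i
    exacts [octaW_ne_zero, pow_ne_zero _ octaT_ne_zero, mul_ne_zero octaT_ne_zero octaX_ne_zero]
  · fin_cases i
    exacts [isHomogeneous_octaW, isHomogeneous_octaT.pow 2, isHomogeneous_octaT.mul
      isHomogeneous_octaX]
  · fin_cases i
    exacts [isHomogeneous_octaT.mul (isHomogeneous_syzygyE6 (k := k) 1 1),
      isHomogeneous_syzygyE6 (k := k) 1 0, isHomogeneous_syzygyE6 (k := k) 1 2]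
  · fin_cases i
    exacts [isHomogeneous_octaT.mul (isHomogeneous_syzygyE6 (k := k) 0 1),
      isHomogeneous_syzygyE6 (k := k) 0 0, isHomogeneous_syzygyE6 (k := k) 0 2]

/-- The rows of the Hilbert–Burch matrix in type `E₈`. -/
noncomputable def syzygyE8 (k : Type*) [Field k] : Fin 2 → Fin 3 → MvPolynomial (Fin 2) k :=
  ![![C 12⁻¹ * (12 * X 1 ^ 19 - 684 * (X 0 ^ 15 * X 1 ^ 4 - 3 * (X 1 ^ 14 * X 0 ^ 5)) +
        2964 * (X 0 ^ 10 * X 1 ^ 9)), C 12⁻¹ * X 0,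
      C 12⁻¹ * (X 0 ^ 11 + 66 * X 0 ^ 6 * X 1 ^ 5 - 11 * X 0 * X 1 ^ 10)],
    ![12 * X 0 ^ 19 - 684 * (3 * (X 0 ^ 14 * X 1 ^ 5) - X 1 ^ 15 * X 0 ^ 4) +
        2964 * (X 0 ^ 9 * X 1 ^ 10), -X 1,
      11 * X 0 ^ 10 * X 1 + 66 * X 0 ^ 5 * X 1 ^ 6 - X 1 ^ 11]]

theorem isHomogeneous_syzygyE8 (j : Fin 2) (i : Fin 3) :
    (syzygyE8 k j i).IsHomogeneous (31 - degrees E8 i) := by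
  refine isHomogeneous_of_homogenize ?_
  have hC : homogenize (C 12⁻¹ : MvPolynomial (Fin 2) k) = Polynomial.C (C 12⁻¹) :=
    homogenize.commutes _
  fin_cases j <;> fin_cases i
  · change homogenize (C 12⁻¹ * (12 * X 1 ^ 19 - 684 * (X 0 ^ 15 * X 1 ^ 4 -
        3 * (X 1 ^ 14 * X 0 ^ 5)) + 2964 * (X 0 ^ 10 * X 1 ^ 9))) =
      Polynomial.C (C 12⁻¹ * (12 * X 1 ^ 19 - 684 * (X 0 ^ 15 * X 1 ^ 4 -
        3 * (X 1 ^ 14 * X 0 ^ 5)) + 2964 * (X 0 ^ 10 * X 1 ^ 9))) * Polynomial.X ^ 19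
    simp only [map_mul, map_add, map_sub, map_pow, map_ofNat, homogenize_X, hC]
    ring
  · change homogenize (C 12⁻¹ * X 0) = Polynomial.C (C 12⁻¹ * X 0) * Polynomial.X ^ 1
    simp only [map_mul, homogenize_X, hC]
    ring
  · change homogenize (C 12⁻¹ * (X 0 ^ 11 + 66 * X 0 ^ 6 * X 1 ^ 5 - 11 * X 0 * X 1 ^ 10)) =
      Polynomial.C (C 12⁻¹ * (X 0 ^ 11 + 66 * X 0 ^ 6 * X 1 ^ 5 - 11 * X 0 * X 1 ^ 10)) *
        Polynomial.X ^ 11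
    simp only [map_mul, map_add, map_sub, map_pow, map_ofNat, homogenize_X, hC]
    ring
  · change homogenize (12 * X 0 ^ 19 - 684 * (3 * (X 0 ^ 14 * X 1 ^ 5) - X 1 ^ 15 * X 0 ^ 4) +
        2964 * (X 0 ^ 9 * X 1 ^ 10)) =
      Polynomial.C (12 * X 0 ^ 19 - 684 * (3 * (X 0 ^ 14 * X 1 ^ 5) - X 1 ^ 15 * X 0 ^ 4) +
        2964 * (X 0 ^ 9 * X 1 ^ 10)) * Polynomial.X ^ 19
    simp only [map_mul, map_add, map_sub, map_pow, map_ofNat, homogenize_X]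
    ring
  · change homogenize (-X 1) = Polynomial.C (-X 1) * Polynomial.X ^ 1
    simp only [map_neg, homogenize_X]
    ring
  · change homogenize (11 * X 0 ^ 10 * X 1 + 66 * X 0 ^ 5 * X 1 ^ 6 - X 1 ^ 11) =
      Polynomial.C (11 * X 0 ^ 10 * X 1 + 66 * X 0 ^ 5 * X 1 ^ 6 - X 1 ^ 11) * Polynomial.X ^ 11
    simp only [map_mul, map_add, map_sub, map_pow, map_ofNat, homogenize_X]
    ring

/-- Modulo the factor of degree `10` the third generator is `-5⁵ x₁¹⁰ x₂¹⁰`. -/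
theorem isRelPrime_gens_E8 (h5 : (5 : k) ≠ 0) : IsRelPrime (gens k E8 0) (gens k E8 2) := by
  have h3125 : (-3125 : k) ≠ 0 := by
    rw [show (-3125 : k) = -5 ^ 5 by norm_num, neg_ne_zero]
    exact pow_ne_zero _ h5
  have hC : (C (-3125) : MvPolynomial (Fin 2) k) = -3125 := by
    rw [C_neg]
    exact congrArg _ (map_ofNat C 3125)
  have hy : ∀ j, gens k E8 2 = C (-1) * X 1 ^ 20 + X 0 * j → IsRelPrime (X 0) (gens k E8 2) :=
    fun j hj => isRelPrime_X_of_eq (by decide) (neg_ne_zero.mpr one_ne_zero) hj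
  have hx : ∀ j, gens k E8 2 = C (-1) * X 0 ^ 20 + X 1 * j → IsRelPrime (X 1) (gens k E8 2) :=
    fun j hj => isRelPrime_X_of_eq (by decide) (neg_ne_zero.mpr one_ne_zero) hj
  have g2 : gens k E8 2 = -X 0 ^ 20 - X 1 ^ 20 + 228 * (X 0 ^ 15 * X 1 ^ 5 - X 1 ^ 15 * X 0 ^ 5)
        - 494 * (X 0 ^ 10 * X 1 ^ 10) := rfl
  change IsRelPrime (X 0 * X 1 * (X 0 ^ 10 + 11 * X 0 ^ 5 * X 1 ^ 5 - X 1 ^ 10)) _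
  refine IsRelPrime.mul_left (IsRelPrime.mul_left (hy (-X 0 ^ 19 + 228 * (X 0 ^ 14 * X 1 ^ 5 -
    X 1 ^ 15 * X 0 ^ 4) - 494 * (X 0 ^ 9 * X 1 ^ 10)) ?_) (hx (-X 1 ^ 19 + 228 * (X 0 ^ 15 * X 1 ^ 4
    - X 1 ^ 14 * X 0 ^ 5) - 494 * (X 0 ^ 10 * X 1 ^ 9)) ?_)) ?_
  · rw [g2, C_neg, C_1]
    ring
  · rw [g2, C_neg, C_1]
    ring
  · have e : gens k E8 2 = C (-3125) * (X 0 ^ 10 * X 1 ^ 10) +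
        (X 0 ^ 10 + 11 * X 0 ^ 5 * X 1 ^ 5 - X 1 ^ 10) *
          (-(X 0 ^ 10 - X 1 ^ 10) + 239 * X 0 ^ 5 * X 1 ^ 5) := by
      rw [g2, hC]
      ring
    rw [e]
    refine IsRelPrime.add_mul_left_right (IsRelPrime.mul_right
      (isUnit_C h3125).isRelPrime_right (IsRelPrime.mul_right
        (IsRelPrime.pow_right (IsRelPrime.symm ?_)) (IsRelPrime.pow_right (IsRelPrime.symm ?_)))) _
    · refine isRelPrime_X_of_eq (i := 0) (j := 1) (by decide) (neg_ne_zero.mpr one_ne_zero)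
        (m := 10) (g := X 0 ^ 9 + 11 * X 0 ^ 4 * X 1 ^ 5) ?_
      rw [C_neg, C_1]
      ring
    · refine isRelPrime_X_of_eq (i := 1) (j := 0) (by decide) one_ne_zero
        (m := 10) (g := 11 * X 0 ^ 5 * X 1 ^ 4 - X 1 ^ 9) ?_
      rw [C_1]
      ring

/-- As in type `E₆`: Euler's identities for the forms of degrees `12` and `20`, whose Jacobian
determinant is a multiple of the form of degree `30`. -/
theorem isMinors_E8 (h30 : (30 : k) ≠ 0) :
    IsMinors (syzygyE8 k 0) (syzygyE8 k 1) (gens k E8) (degrees E8) (syzygyDegree E8) := by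
  have h2 : (2 : k) ≠ 0 := fun h => h30 (by linear_combination 15 * h)
  have h3 : (3 : k) ≠ 0 := fun h => h30 (by linear_combination 10 * h)
  have h5 : (5 : k) ≠ 0 := fun h => h30 (by linear_combination 6 * h)
  have h12 : (12 : k) ≠ 0 := by
    rw [show (12 : k) = 2 * 2 * 3 by norm_num]
    exact mul_ne_zero (mul_ne_zero h2 h2) h3
  have hC : (C 12⁻¹ * 12 : MvPolynomial (Fin 2) k) = 1 := by
    rw [show (12 : MvPolynomial (Fin 2) k) = C 12 from (map_ofNat C 12).symm, ← C_mul,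
      inv_mul_cancel₀ h12, C_1]
  refine ⟨?_, ?_, ?_, fun i => ?_, ⟨0, 2, isRelPrime_gens_E8 h5⟩, degrees_pos (t := E8) trivial,
    degrees_lt (t := E8) trivial, sum_degrees _, IsIcosa.isHomogeneous_gens,
    isHomogeneous_syzygyE8 0, isHomogeneous_syzygyE8 1⟩
  · change X 0 * X 1 * (X 0 ^ 10 + 11 * X 0 ^ 5 * X 1 ^ 5 - X 1 ^ 10) = C 12⁻¹ * X 0 *
      (11 * X 0 ^ 10 * X 1 + 66 * X 0 ^ 5 * X 1 ^ 6 - X 1 ^ 11) -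
      C 12⁻¹ * (X 0 ^ 11 + 66 * X 0 ^ 6 * X 1 ^ 5 - 11 * X 0 * X 1 ^ 10) * -X 1
    linear_combination -(X 0 * X 1 * (X 0 ^ 10 + 11 * X 0 ^ 5 * X 1 ^ 5 - X 1 ^ 10)) * hC
  · change X 0 ^ 30 + X 1 ^ 30 + 522 * (X 0 ^ 25 * X 1 ^ 5 - X 1 ^ 25 * X 0 ^ 5)
        - 10005 * (X 0 ^ 20 * X 1 ^ 10 + X 0 ^ 10 * X 1 ^ 20) =
      C 12⁻¹ * (X 0 ^ 11 + 66 * X 0 ^ 6 * X 1 ^ 5 - 11 * X 0 * X 1 ^ 10) *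
        (12 * X 0 ^ 19 - 684 * (3 * (X 0 ^ 14 * X 1 ^ 5) - X 1 ^ 15 * X 0 ^ 4) +
        2964 * (X 0 ^ 9 * X 1 ^ 10)) -
      C 12⁻¹ * (12 * X 1 ^ 19 - 684 * (X 0 ^ 15 * X 1 ^ 4 - 3 * (X 1 ^ 14 * X 0 ^ 5)) +
        2964 * (X 0 ^ 10 * X 1 ^ 9)) * (11 * X 0 ^ 10 * X 1 + 66 * X 0 ^ 5 * X 1 ^ 6 - X 1 ^ 11)
    linear_combination -(X 0 ^ 30 + X 1 ^ 30 + 522 * (X 0 ^ 25 * X 1 ^ 5 - X 1 ^ 25 * X 0 ^ 5)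
        - 10005 * (X 0 ^ 20 * X 1 ^ 10 + X 0 ^ 10 * X 1 ^ 20)) * hC
  · change -X 0 ^ 20 - X 1 ^ 20 + 228 * (X 0 ^ 15 * X 1 ^ 5 - X 1 ^ 15 * X 0 ^ 5)
        - 494 * (X 0 ^ 10 * X 1 ^ 10) =
      C 12⁻¹ * (12 * X 1 ^ 19 - 684 * (X 0 ^ 15 * X 1 ^ 4 - 3 * (X 1 ^ 14 * X 0 ^ 5)) +
        2964 * (X 0 ^ 10 * X 1 ^ 9)) * -X 1 - C 12⁻¹ * X 0 *
        (12 * X 0 ^ 19 - 684 * (3 * (X 0 ^ 14 * X 1 ^ 5) - X 1 ^ 15 * X 0 ^ 4) +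
        2964 * (X 0 ^ 9 * X 1 ^ 10))
    linear_combination -(-X 0 ^ 20 - X 1 ^ 20 + 228 * (X 0 ^ 15 * X 1 ^ 5 - X 1 ^ 15 * X 0 ^ 5)
        - 494 * (X 0 ^ 10 * X 1 ^ 10)) * hC
  · intro h
    have h1 := IsIcosa.eval_gens (k := k) i
    fin_cases i
    · exact IsIcosa.gens_zero_ne_zero h
    · rw [h] at h1
      simp at h1
    · rw [h] at h1
      simp at h1

end Syzygies

end KleinType

namespace HilbertKunz

/-! ### The kernel of `k[X₁, X₂, X₃] → R` by dimension. -/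

section Kernel

variable {k : Type*} [Field k]

/-- `F` is a non-zero-divisor in `A`, and `f` is one in the domain `A ⧸ (F)`. Each of the two
quotients lowers the dimension by at least one. -/
theorem ringKrullDim_succ_succ_le_of_mem {A : Type*} [CommRing A] [IsDomain A] {I : Ideal A}
    {F f : A} (hF : Prime F) (hFI : F ∈ I) (hfI : f ∈ I) (hf : ¬ F ∣ f) :
    ringKrullDim (A ⧸ I) + 1 + 1 ≤ ringKrullDim A := by
  have hprime : (Ideal.span {F}).IsPrime := (Ideal.span_singleton_prime hF.ne_zero).mpr hF
  have h1 := ringKrullDim_quotient_succ_le_of_nonZeroDivisor (mem_nonZeroDivisors_of_ne_zero hF.ne_zero)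
  have hf0 : Ideal.Quotient.mk (Ideal.span {F}) f ≠ 0 := by
    rwa [Ne, Ideal.Quotient.eq_zero_iff_mem, Ideal.mem_span_singleton]
  have h2 := ringKrullDim_quotient_succ_le_of_nonZeroDivisor (mem_nonZeroDivisors_of_ne_zero hf0)
  have hle : Ideal.span {F} ≤ I := (Ideal.span_singleton_le_iff_mem I).mpr hFI
  have h3 := ringKrullDim_le_of_surjective
    (Ideal.Quotient.lift (Ideal.span {Ideal.Quotient.mk (Ideal.span {F}) f})
      (Ideal.Quotient.factor hle) (fun a ha => by
        obtain ⟨b, rfl⟩ := Ideal.mem_span_singleton.mp ha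
        rw [map_mul, Ideal.Quotient.factor_mk, Ideal.Quotient.eq_zero_iff_mem.mpr hfI, zero_mul]))
    (Ideal.Quotient.lift_surjective_of_surjective _ _ (Ideal.Quotient.factor_surjective hle))
  exact ((add_le_add (add_le_add h3 le_rfl) le_rfl).trans (add_le_add h2 le_rfl)).trans h1

/-- An element of the kernel outside `(F)` would lower the dimension of the image from `3` to at
most `1`, but the image `S` has dimension `2`. -/
theorem ker_aeval_eq_span {G : Subgroup (SpecialLinearGroup (Fin 2) k)} [Finite G]
    {h : Fin 3 → MvPolynomial (Fin 2) k}
    (hS : invariantRing G = Algebra.adjoin k (Set.range h)) {F : MvPolynomial (Fin 3) k}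
    (hF : Irreducible F) (hFh : aeval h F = 0) :
    RingHom.ker (aeval h : MvPolynomial (Fin 3) k →ₐ[k] MvPolynomial (Fin 2) k) =
      Ideal.span {F} := by
  refine le_antisymm (fun f hf => ?_) ((Ideal.span_singleton_le_iff_mem _).mpr hFh)
  rw [Ideal.mem_span_singleton]
  by_contra hdvd
  have h1 := ringKrullDim_succ_succ_le_of_mem hF.prime (show F ∈ RingHom.ker
    (aeval h : MvPolynomial (Fin 3) k →ₐ[k] MvPolynomial (Fin 2) k) from hFh) hf hdvd
  have h2 : ringKrullDim (MvPolynomial (Fin 3) k ⧸ RingHom.ker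
      (aeval h : MvPolynomial (Fin 3) k →ₐ[k] MvPolynomial (Fin 2) k)) = 2 := by
    rw [← ringKrullDim_invariantRing G, hS.trans (Algebra.adjoin_range_eq_range_aeval k h)]
    exact ringKrullDim_eq_of_ringEquiv (Ideal.quotientKerEquivRange
      (aeval h : MvPolynomial (Fin 3) k →ₐ[k] MvPolynomial (Fin 2) k)).toRingEquiv
  rw [h2, MvPolynomial.ringKrullDim_of_isNoetherianRing, ringKrullDim_eq_zero_of_field] at h1
  simp at h1
  have h3 : ((2 + 1 + 1 : ℕ) : WithBot ℕ∞) ≤ (3 : ℕ) := by exact_mod_cast h1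
  exact absurd (Nat.cast_le.mp h3) (by norm_num)

end Kernel

end HilbertKunz

namespace KleinType

open HilbertKunz

/-! ### The relations hold and are irreducible. -/

section Relations

variable {k : Type*} [Field k]

theorem aeval_relation_D (n : ℕ) : aeval (gens k (D n)) (relation k (D n)) = 0 := by
  have e : (-2 * X 0 ^ 2 * X 1 ^ 2 : MvPolynomial (Fin 2) k) ^ n =
      (-1) ^ n * 2 ^ n * X 0 ^ (2 * n) * X 1 ^ (2 * n) := by
    rw [show (-2 * X 0 ^ 2 * X 1 ^ 2 : MvPolynomial (Fin 2) k) =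
      -1 * 2 * X 0 ^ 2 * X 1 ^ 2 by ring, mul_pow, mul_pow, mul_pow, ← pow_mul, ← pow_mul]
  simp only [relation, map_sub, map_add, map_mul, map_pow, map_ofNat, aeval_X]
  change 2 ^ (n + 1) * (X 0 * X 1 * (X 0 ^ (2 * n) - (-1) ^ n * X 1 ^ (2 * n))) ^ 2 +
    2 ^ n * (-2 * X 0 ^ 2 * X 1 ^ 2) * (X 0 ^ (2 * n) + (-1) ^ n * X 1 ^ (2 * n)) ^ 2 -
    4 * (-2 * X 0 ^ 2 * X 1 ^ 2) ^ (n + 1) = (0 : MvPolynomial (Fin 2) k)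
  rw [pow_succ (-2 * X 0 ^ 2 * X 1 ^ 2), pow_succ 2, e]
  generalize (X 0 ^ (2 * n) : MvPolynomial (Fin 2) k) = a
  generalize (X 1 ^ (2 * n) : MvPolynomial (Fin 2) k) = b
  generalize ((-1) ^ n : MvPolynomial (Fin 2) k) = s
  ring

theorem aeval_relation (t : KleinType) : aeval (gens k t) (relation k t) = 0 := by
  cases t with
  | A n =>
    simp only [relation, map_sub, map_mul, map_pow, aeval_X]
    change (X 0 * X 1) ^ n - X 0 ^ n * X 1 ^ n = 0
    rw [mul_pow, sub_self]
  | D n => exact aeval_relation_D n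
  | E6 =>
    simp only [relation, map_sub, map_add, map_mul, map_pow, map_ofNat, aeval_X]
    change 108 * octaT k ^ 4 - octaW k ^ 3 + octaX k ^ 2 = 0
    rw [octaX_sq]
    ring
  | E7 =>
    simp only [relation, map_sub, map_add, map_mul, map_pow, map_ofNat, aeval_X]
    change (octaT k * octaX k) ^ 2 - octaW k ^ 3 * octaT k ^ 2 + 108 * (octaT k ^ 2) ^ 3 = 0
    rw [mul_pow, octaX_sq]
    ring
  | E8 =>
    simp only [relation, map_sub, map_add, map_mul, map_pow, map_ofNat, aeval_X]
    change (X 0 ^ 30 + X 1 ^ 30 + 522 * (X 0 ^ 25 * X 1 ^ 5 - X 1 ^ 25 * X 0 ^ 5)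
        - 10005 * (X 0 ^ 20 * X 1 ^ 10 + X 0 ^ 10 * X 1 ^ 20)) ^ 2 +
      (-X 0 ^ 20 - X 1 ^ 20 + 228 * (X 0 ^ 15 * X 1 ^ 5 - X 1 ^ 15 * X 0 ^ 5)
        - 494 * (X 0 ^ 10 * X 1 ^ 10)) ^ 3 -
      1728 * (X 0 * X 1 * (X 0 ^ 10 + 11 * X 0 ^ 5 * X 1 ^ 5 - X 1 ^ 10)) ^ 5 =
      (0 : MvPolynomial (Fin 2) k)
    ring

/-- The polynomials in three variables as polynomials in the `j`-th one. -/
noncomputable def splitVar (k : Type*) [Field k] (j : Fin 3) :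
    MvPolynomial (Fin 3) k ≃ₐ[k] Polynomial (MvPolynomial (Fin 2) k) :=
  (renameEquiv k (Equiv.swap 0 j)).trans (finSuccEquiv k 2)

/-- A monic quadratic polynomial over a domain is irreducible if it has no root, and a root of `X² -
g` would be a square root of `g`. -/
theorem irreducible_of_splitVar {j : Fin 3} {F : MvPolynomial (Fin 3) k} {u : k} (hu : u ≠ 0)
    {g : MvPolynomial (Fin 2) k}
    (hF : splitVar k j F = Polynomial.C (C u) * (Polynomial.X ^ 2 - Polynomial.C g))
    (hg : ¬ IsSquare g) : Irreducible F := by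
  rw [← MulEquiv.irreducible_iff (splitVar k j).toMulEquiv]
  change Irreducible (splitVar k j F)
  rw [hF, irreducible_isUnit_mul ((isUnit_C hu).map Polynomial.C)]
  have hm : (Polynomial.X ^ 2 - Polynomial.C g).Monic :=
    Polynomial.monic_X_pow_sub_C g two_ne_zero
  have hd : (Polynomial.X ^ 2 - Polynomial.C g).natDegree = 2 :=
    Polynomial.natDegree_X_pow_sub_C
  rw [hm.irreducible_iff_roots_eq_zero_of_degree_le_three (by rw [hd]) (by rw [hd]; norm_num),
    Multiset.eq_zero_iff_forall_notMem]
  intro r hr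
  have := Polynomial.isRoot_of_mem_roots hr
  simp only [Polynomial.IsRoot.def, Polynomial.eval_sub, Polynomial.eval_pow, Polynomial.eval_X,
    Polynomial.eval_C] at this
  exact hg ⟨r, by linear_combination -this⟩

/-- A specialization of odd degree cannot be a square. This holds for every `a`, so the value of
`108` in `k` does not matter. -/
theorem not_isSquare_cubic {g : MvPolynomial (Fin 2) k} (v : Fin 2 → Polynomial k) (a : k)
    (hv : aeval v g = Polynomial.X ^ 3 - Polynomial.C a) : ¬ IsSquare g := by
  rintro ⟨r, rfl⟩
  have h := congrArg Polynomial.natDegree hv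
  rw [map_mul, ← sq, Polynomial.natDegree_pow, Polynomial.natDegree_X_pow_sub_C] at h
  omega

/-- A square has no simple zero. -/
theorem not_isSquare_of_derivative {g : MvPolynomial (Fin 2) k} (v : Fin 2 → Polynomial k)
    (h0 : (aeval v g).eval 0 = 0) (h1 : (Polynomial.derivative (aeval v g)).eval 0 ≠ 0) :
    ¬ IsSquare g := by
  rintro ⟨r, rfl⟩
  rw [map_mul, Polynomial.eval_mul, mul_self_eq_zero] at h0
  rw [map_mul, Polynomial.derivative_mul, Polynomial.eval_add, Polynomial.eval_mul,
    Polynomial.eval_mul, h0] at h1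
  simp at h1

theorem splitVar_two (i : Fin 3) : splitVar k 2 (X i) =
    ![Polynomial.C (X 1), Polynomial.C (X 0), Polynomial.X] i := by
  have h : splitVar k 2 (X i) = finSuccEquiv k 2 (X (Equiv.swap 0 2 i)) := by simp [splitVar]
  rw [h]
  fin_cases i
  · exact finSuccEquiv_X_succ (j := 1)
  · exact finSuccEquiv_X_succ (j := 0)
  · exact finSuccEquiv_X_zero

theorem splitVar_one (i : Fin 3) : splitVar k 1 (X i) =
    ![Polynomial.C (X 0), Polynomial.X, Polynomial.C (X 1)] i := by
  have h : splitVar k 1 (X i) = finSuccEquiv k 2 (X (Equiv.swap 0 1 i)) := by simp [splitVar]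
  rw [h]
  fin_cases i
  · exact finSuccEquiv_X_succ (j := 0)
  · exact finSuccEquiv_X_zero
  · exact finSuccEquiv_X_succ (j := 1)

/-- In type `A` the relation is linear in one variable with coprime coefficients; in the other types
it is quadratic in one variable without a linear term. -/
theorem irreducible_relation {t : KleinType} (ht : t.IsValid) (h : (t.order : k) ≠ 0) :
    Irreducible (relation k t) := by
  cases t with
  | A n =>
    have := irreducible_mul_X_add (R := k) (-X 1) (X 0 ^ n) (2 : Fin 3)
      (neg_ne_zero.mpr (X_ne_zero _)) (by simp)
      (fun h => by simpa using vars_pow (X 0) n h) (IsRelPrime.neg_left (IsRelPrime.pow_right (by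
        rw [(X_prime (R := k) (i := (1 : Fin 3))).irreducible.isRelPrime_iff_not_dvd, X_dvd_X]
        decide)))
    convert this using 1
    change X 0 ^ n - X 1 * X 2 = _
    ring
  | D n =>
    have h2 : (2 : k) ≠ 0 := fun h2 => h (by
      simp only [order, Nat.cast_mul, Nat.cast_ofNat]
      linear_combination 2 * n * h2)
    have hn : n ≠ 0 := by
      have : 2 ≤ n := ht
      omega
    have hC : (C (2 ^ (n + 1)) : MvPolynomial (Fin 2) k) * C ((2 ^ (n + 1))⁻¹) = 1 := by
      rw [← C_mul, mul_inv_cancel₀ (pow_ne_zero _ h2), C_1]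
    refine irreducible_of_splitVar (j := 2) (u := 2 ^ (n + 1)) (pow_ne_zero _ h2)
      (g := C ((2 ^ (n + 1))⁻¹) * (4 * X 1 ^ (n + 1) - 2 ^ n * X 1 * X 0 ^ 2)) ?_
      (not_isSquare_of_derivative ![1, Polynomial.X] ?_ ?_)
    · simp only [relation, map_sub, map_add, map_mul, map_pow, map_ofNat, splitVar_two]
      have h3 := congrArg Polynomial.C hC
      simp only [map_mul, map_pow, map_ofNat, map_one] at h3
      change 2 ^ (n + 1) * Polynomial.X ^ 2 + 2 ^ n * Polynomial.C (X 1) * Polynomial.C (X 0) ^ 2 -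
        4 * Polynomial.C (X 1) ^ (n + 1) = _
      linear_combination (4 * Polynomial.C (X 1) ^ (n + 1) -
        2 ^ n * Polynomial.C (X 1) * Polynomial.C (X 0) ^ 2) * h3
    · simp
    · simpa [hn] using h2
  | E6 =>
    refine irreducible_of_splitVar (j := 2) (u := 1) one_ne_zero (g := X 0 ^ 3 - 108 * X 1 ^ 4) ?_
      (not_isSquare_cubic ![Polynomial.X, 0] 0 ?_)
    · simp only [relation, map_sub, map_add, map_mul, map_pow, map_ofNat, splitVar_two]
      simp
      ring
    · simp
  | E7 =>
    refine irreducible_of_splitVar (j := 2) (u := 1) one_ne_zero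
      (g := X 1 ^ 3 * X 0 - 108 * X 0 ^ 3) ?_ (not_isSquare_cubic ![1, Polynomial.X] 108 ?_)
    · simp only [relation, map_sub, map_add, map_mul, map_pow, map_ofNat, splitVar_two]
      simp
      ring
    · simp [show (108 : Polynomial k) = Polynomial.C 108 from (map_ofNat Polynomial.C 108).symm]
  | E8 =>
    refine irreducible_of_splitVar (j := 1) (u := 1) one_ne_zero
      (g := 1728 * X 0 ^ 5 - X 1 ^ 3) ?_ (not_isSquare_cubic ![0, -Polynomial.X] 0 ?_)
    · simp only [relation, map_sub, map_add, map_mul, map_pow, map_ofNat, splitVar_one]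
      simp
      ring
    · simp
      ring

end Relations

end KleinType

/-! ### Assembly of the types and the main theorem. -/

namespace KleinType

open HilbertKunz

/-- The hypothesis on the order enters through the invertibility of `n`, of `2` and `n`, of `6`, or
of `30`, according to the type. -/
theorem IsStandard.properties {k : Type*} [Field k] {t : KleinType} (ht : t.IsValid)
    {H : Subgroup (SpecialLinearGroup (Fin 2) k)} (hH : t.IsStandard H)
    (h : (t.order : k) ≠ 0) :
    Nat.card H = t.order ∧ invariantRing H = Algebra.adjoin k (Set.range (gens k t)) ∧
      ∃ a b, IsMinors a b (gens k t) t.degrees t.syzygyDegree := by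
  cases t with
  | A n =>
    have ht : 2 ≤ n := ht
    obtain ⟨ε, hε, rfl⟩ := hH
    have hn : n ≠ 0 := by omega
    exact ⟨card_A hε hn h, invariantRing_A hε hn, _, _, isMinors_A ht⟩
  | D n =>
    have ht : 2 ≤ n := ht
    obtain ⟨ε, i, hε, hi, rfl⟩ := hH
    have hn : n ≠ 0 := by omega
    simp only [order, Nat.cast_mul, Nat.cast_ofNat] at h
    have h2 : (2 : k) ≠ 0 := fun h2 => h (by linear_combination 2 * n * h2)
    have hnk : (n : k) ≠ 0 := fun hn => h (by rw [hn, mul_zero])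
    exact ⟨card_D hε hn hi h2 hnk, invariantRing_D hε hn hi h2, _, _, isMinors_D ht h2⟩
  | E6 =>
    obtain ⟨i, hi, rfl⟩ := hH
    simp only [order, Nat.cast_ofNat] at h
    have h2 : (2 : k) ≠ 0 := fun h2 => h (by linear_combination 12 * h2)
    have h6 : (6 : k) ≠ 0 := fun h6 => h (by linear_combination 4 * h6)
    exact ⟨card_E6 hi h2, invariantRing_E6 hi h6, _, _, isMinors_E6 h6⟩
  | E7 =>
    obtain ⟨ζ, hζ, rfl⟩ := hH
    simp only [order, Nat.cast_ofNat] at h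
    have h2 : (2 : k) ≠ 0 := fun h2 => h (by linear_combination 24 * h2)
    have h6 : (6 : k) ≠ 0 := fun h6 => h (by linear_combination 8 * h6)
    exact ⟨card_E7 hζ h2, invariantRing_E7 hζ h6, _, _, isMinors_E7 h6⟩
  | E8 =>
    obtain ⟨ε, s, hε, hs, rfl⟩ := hH
    simp only [order, Nat.cast_ofNat] at h
    have h30 : (30 : k) ≠ 0 := fun h30 => h (by linear_combination 4 * h30)
    have hI := isIcosa hε h30 hs
    rw [show (ε - ε ^ 4) / s = -((ε ^ 4 - ε) / s) by ring]
    exact ⟨hI.card_eq, hI.invariantRing_eq, _, _, isMinors_E8 h30⟩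

end KleinType

theorem mainTheorem7 {k : Type*} [Field k] (p : ℕ) [Fact p.Prime] [CharP k p]
    (t : KleinType) (ht : t.IsValid) (hp : ¬ p ∣ t.order)
    (P : GL (Fin 2) k) (G : Subgroup (SpecialLinearGroup (Fin 2) k))
    (hG : t.IsConjStandard P G)
    (h : Fin 3 → MvPolynomial (Fin 2) k)
    (hh : h = fun i => HilbertKunz.subst P⁻¹.val (t.gens k i)) :
    Nat.card G = t.order ∧
    HilbertKunz.invariantRing G = Algebra.adjoin k (Set.range h) ∧
    RingHom.ker (MvPolynomial.aeval h : MvPolynomial (Fin 3) k →ₐ[k] MvPolynomial (Fin 2) k) =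
      Ideal.span {t.relation k} ∧
    (HilbertKunz.gradedMaximalIdeal G).map (HilbertKunz.invariantRing G).val =
      Ideal.span (Set.range h) ∧
    (∃ ψ : Matrix (Fin 2) (Fin 3) (MvPolynomial (Fin 2) k),
      HilbertKunz.IsHilbertBurchResolution h t.degrees t.syzygyDegree ψ) ∧
    HilbertKunz.IsHKDensity (HilbertKunz.invGrading G) (HilbertKunz.gradedMaximalIdeal G) p
      t.density ∧
    HilbertKunz.IsHKMultiplicity (HilbertKunz.gradedMaximalIdeal G) p (2 - 1 / (Nat.card G : ℝ)) ∧
    MeasureTheory.IntegrableOn t.density (Set.Ioi 0) ∧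
    ∫ x in Set.Ioi (0 : ℝ), t.density x = 2 - 1 / (Nat.card G : ℝ) := by
  have hk : (t.order : k) ≠ 0 := by rwa [Ne, CharP.cast_eq_zero_iff k p]
  obtain ⟨H, hH, hGH⟩ := hG
  obtain ⟨hcard, hS, a, b, hM⟩ := hH.properties ht hk
  have hcardG : Nat.card G = t.order := (KleinType.card_eq_of_conj hGH).trans hcard
  -- Finiteness follows from the count: `Nat.card G` is not zero because its image in `k` is not.
  have hfin : Finite G := Nat.finite_of_card_ne_zero (by
    rw [hcardG]
    intro h0
    exact hk (by rw [h0, Nat.cast_zero]))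
  have hSG : HilbertKunz.invariantRing G = Algebra.adjoin k (Set.range h) := by
    rw [KleinType.invariantRing_eq_map_of_conj hGH, hS, AlgHom.map_adjoin, ← Set.range_comp, hh]
    rfl
  have hMG := hM.subst P⁻¹
  rw [← hh] at hMG
  have hker := HilbertKunz.ker_aeval_eq_span hSG (KleinType.irreducible_relation ht hk)
    (by
      have h0 : t.relation k ∈ RingHom.ker (MvPolynomial.aeval h :
          MvPolynomial (Fin 3) k →ₐ[k] MvPolynomial (Fin 2) k) := by
        rw [hh, KleinType.ker_aeval_subst]
        exact KleinType.aeval_relation t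
      exact h0)
  have hmult := KleinType.multiplicity_eq ht
  have hint := HilbertKunz.integral_density (f := t.density) (d := fun i => (t.degrees i : ℝ))
    (l := t.syzygyDegree) (n := t.degreeStep) (c := t.order)
    (by exact_mod_cast t.degreeStep_pos) (fun x _ => KleinType.density_eq ht x)
    (fun i => Nat.cast_nonneg _) (Nat.cast_nonneg _)
    (fun i => by exact_mod_cast (hMG.lt i).le) (by exact_mod_cast hMG.sum_eq)
  have hdens := HilbertKunz.isHKDensity_profile p hSG hMG t.degreeStep_pos t.degreeStep_dvd
    t.dvd_degreeStep
  have hHK := HilbertKunz.isHKMultiplicity_of_isMinors p hSG hMG t.degreeStep_pos t.degreeStep_dvd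
    t.dvd_degreeStep
  rw [hcardG] at hdens hHK ⊢
  rw [hmult] at hHK hint
  rw [← funext fun x => KleinType.density_eq ht x] at hdens
  exact ⟨rfl, hSG, hker, HilbertKunz.map_gradedMaximalIdeal hSG hMG.pos hMG.homogeneous,
    ⟨_, hMG.isHilbertBurchResolution⟩, hdens, hHK, hint⟩
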